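/- Let $F$ be a non-archimedean local field and let $\mathrm{Irr}_c$ be the set of isomorphism classes of irreducible supercuspidal complex smooth representations of the groups $\mathrm{GL}_n(F)$, $n>0$. For $\rho\in\mathrm{Irr}_c$ put $\overrightarrow\rho=\rho\otimes|\det|$ and $\overleftarrow\rho=\rho\otimes|\det|^{-1}$, where $|\cdot|$ is the normalized absolute value. A segment is a set $\Delta=\{\rho_1,\dots,\rho_k\}\subset\mathrm{Irr}_c$, $k\ge1$, with $\rho_{i+1}=\overrightarrow{\rho_i}$; put $b(\Delta)=\rho_1$, $e(\Delta)=\rho_k$, $\overrightarrow\Delta=\{\overrightarrow{\rho_1},\dots,\overrightarrow{\rho_k}\}$. Write $\Delta\prec\Delta'$ if $b(\Delta)\notin\Delta'$, $b(\Delta')\in\overrightarrow\Delta$ and $e(\Delta')\notin\Delta$. A multisegment is a finite formal sum of segments. Closure and density are with respect to the Zariski topology. For a finite-dimensional $\mathrm{Irr}_c$-graded complex vector space $V=\bigoplus_\rho V_\rho$ let $\mathbb G(V)=\prod_\rho \mathrm{GL}(V_\rho)$, let $\overrightarrow{\mathbb E}(V)$ (resp. $\overleftarrow{\mathbb E}(V)$)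 be the space of linear maps $V\to V$ sending each $V_\rho$ to $V_{\overrightarrow\rho}$ (resp. $V_{\overleftarrow\rho}$), and let $\mathfrak X(V)=\{(A,B)\in\overrightarrow{\mathbb E}(V)\times\overleftarrow{\mathbb E}(V): AB=BA\}$. The group $\mathbb G(V)$ acts on all of these by conjugation. For a multisegment $\mathfrak m=\sum_{i\in I}\Delta_i$ let $\mathcal O_{\mathfrak m}$ be the set of $A\in\overrightarrow{\mathbb E}(V)$ for which $V$ has a basis $x_{\rho,i}$ ($i\in I$, $\rho\in\Delta_i$) with $x_{\rho,i}\in V_\rho$ and $Ax_{\rho,i}=x_{\overrightarrow\rho,i}$, where $x_{\rho,i}=0$ if $\rho\notin\Delta_i$ (a graded Jordan basis). Let $\mathfrak C^\circ_{\mathfrak m}=\{(A,B)\in\mathfrak X(V):A\in\mathcal O_{\mathfrak m}\}$ and $\mathfrak C_{\mathfrak m}=\overline{\mathfrak C^\circ_{\mathfrak m}}$. Let $\mathfrak m=\sum_{i\in I}\Delta_i$ and $\mathfrak m'=\sum_{i'\in I'}\Delta_{i'}$ ($I\cap I'=\emptyset$) be multisegments, $\mathfrak n=\mathfrak m+\mathfrak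 m'$. Let $V,V'$ be finite-dimensional $\mathrm{Irr}_c$-graded complex vector spaces, $A_{\mathfrak m}\in\mathcal O_{\mathfrak m}\subset\overrightarrow{\mathbb E}(V)$ and $A_{\mathfrak m'}\in\mathcal O_{\mathfrak m'}\subset\overrightarrow{\mathbb E}(V')$ with graded Jordan bases $x_{\rho,i}$, $i\in I$, of $V$ and $x_{\rho,i}$, $i\in I'$, of $V'$; put $\tilde V=V\oplus V'$ and $A_{\mathfrak n}=A_{\mathfrak m}\oplus A_{\mathfrak m'}$. Let $\mathbb P^\iota$ be the stabilizer of $V$ in $\mathbb G(\tilde V)$ and $\mathbb U^\iota$ the group of $g\in\mathbb G(\tilde V)$ that are the identity on $V$ and induce the identity on $\tilde V/V$. * $\mathfrak Y^{\iota}_{\mathfrak m,\mathfrak m'}$ is the closure of the set of $(A,B)\in\mathfrak C_{\mathfrak n}$ with $A(V),B(V)\subset V$ whose restriction to $V$ is in $\mathfrak C^\circ_{\mathfrak m}$ and whose induced pair on $\tilde V/V\simeq V'$ is in $\mathfrak C^\circ_{\mathfrak m'}$; $\mathfrak Y^{\iota'}_{\mathfrak m',\mathfrak m}$ is defined in the same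 way with the roles of $(V,\mathfrak m)$ and $(V',\mathfrak m')$ interchanged; $\mathfrak Z_{\mathfrak m,\mathfrak m'}=\mathfrak Y^{\iota}_{\mathfrak m,\mathfrak m'}\cap\mathfrak Y^{\iota'}_{\mathfrak m',\mathfrak m}$. * $\mathrm{LC}(\mathfrak m,\mathfrak m')$ is the condition that $\mathbb G(\tilde V)\cdot\mathfrak Y^{\iota'}_{\mathfrak m',\mathfrak m}$ is dense in $\mathfrak C_{\mathfrak n}$, or, equivalently, that $\mathbb P^\iota\cdot\mathfrak Z_{\mathfrak m,\mathfrak m'}$ is dense in $\mathfrak Y^{\iota}_{\mathfrak m,\mathfrak m'}$. * $\mathbf C_{\mathfrak m},\mathbf C_{\mathfrak m'},\mathbf C_{\mathfrak n}$ are the centralizers of $A_{\mathfrak m},A_{\mathfrak m'},A_{\mathfrak n}$ in $\overleftarrow{\mathbb E}(V),\overleftarrow{\mathbb E}(V'),\overleftarrow{\mathbb E}(\tilde V)$; $\mathbf C^{\iota}_{\mathfrak n}=\{B\in\mathbf C_{\mathfrak n}:B(V)\subset V\}$, $\mathbf C^{\iota'}_{\mathfrak n}=\{B\in\mathbf C_{\mathfrak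 n}:B(V')\subset V'\}$, $\mathbf C^{\iota,\iota'}_{\mathfrak n}=\mathbf C^{\iota}_{\mathfrak n}\cap\mathbf C^{\iota'}_{\mathfrak n}$. * $\mathbf G_{\mathfrak n}$ is the stabilizer of $A_{\mathfrak n}$ in $\mathbb G(\tilde V)$; $\mathbf P^\iota=\mathbf G_{\mathfrak n}\cap\mathbb P^\iota$, $\mathbf U^\iota=\mathbf G_{\mathfrak n}\cap\mathbb U^\iota$. * $X_{\mathfrak m,\mathfrak m'}=\{(i,i')\in I\times I':\Delta_i\prec\Delta_{i'}\}$, $Y_{\mathfrak m,\mathfrak m'}=\{(i,i')\in I\times I':\Delta_i\prec\overrightarrow{\Delta_{i'}}\}$, $X_{\mathfrak m}=X_{\mathfrak m,\mathfrak m}$, $X_{\mathfrak m'}=X_{\mathfrak m',\mathfrak m'}$. The coordinates $\lambda_{i,j}$, $(i,j)\in X_{\mathfrak m}$, of $\lambda\in\mathbf C_{\mathfrak m}$ are the scalars with $\lambda(x_{\rho,j})=\sum_{i:(i,j)\in X_{\mathfrak m}}\lambda_{i,j}x_{\overleftarrow\rho,i}$ for all $j\in I$, $\rho\in\Delta_j$;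 similarly for $\mathbf C_{\mathfrak m'}$. **Proposition.** We have $\overline{\mathbf G_{\mathfrak n}\cdot\mathbf C^{\iota'}_{\mathfrak n}}=\overline{\mathbf U^\iota\cdot\mathbf C^{\iota'}_{\mathfrak n}}$ and $\mathbf P^\iota\cdot\mathbf C^{\iota,\iota'}_{\mathfrak n}=\mathbf U^\iota\cdot\mathbf C^{\iota,\iota'}_{\mathfrak n}$. Moreover, the following conditions are equivalent, and they are equivalent to $\mathrm{LC}(\mathfrak m,\mathfrak m')$ (in each of its two forms). 1. $\mathbf G_{\mathfrak n}\cdot\mathbf C^{\iota'}_{\mathfrak n}$ (or equivalently, $\mathbf U^\iota\cdot\mathbf C^{\iota'}_{\mathfrak n}$) is dense in $\mathbf C_{\mathfrak n}$. 2. $\mathbf P^\iota\cdot\mathbf C^{\iota,\iota'}_{\mathfrak n}$ (or equivalently, $\mathbf U^\iota\cdot\mathbf C^{\iota,\iota'}_{\mathfrak n}$) is dense in $\mathbf C^{\iota}_{\mathfrak n}$. 3. There exist $\lambda\in\mathbf C_{\mathfrak m}$ and $\lambda'\in\mathbf C_{\mathfrak m'}$ with coordinates $\lambda_{i,j}$,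 $(i,j)\in X_{\mathfrak m}$, and $\lambda'_{i,j}$, $(i,j)\in X_{\mathfrak m'}$, such that the vectors $$v^{\mathfrak m,\mathfrak m'}_{i,j}(\lambda,\lambda')=\sum_{r\in I:\,(i,r)\in X_{\mathfrak m},\,(r,j)\in Y_{\mathfrak m,\mathfrak m'}}\lambda_{i,r}\,y_{r,j}-\sum_{s\in I':\,(s,j)\in X_{\mathfrak m'},\,(i,s)\in Y_{\mathfrak m,\mathfrak m'}}\lambda'_{s,j}\,y_{i,s},\qquad (i,j)\in X_{\mathfrak m,\mathfrak m'},$$ are linearly independent in the complex vector space $\mathbb C^{Y_{\mathfrak m,\mathfrak m'}}$ with standard basis $y_{i,j}$, $(i,j)\in Y_{\mathfrak m,\mathfrak m'}$. -/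

import Mathlib

namespace MultisegGeom

open ValuativeRel

noncomputable section

/-! ### Irreducible supercuspidal representations of the groups `GL_n(F)` -/

/-- The unipotent radical of the standard maximal parabolic subgroup of block upper triangular
matrices of type `(k, n - k)`: its elements are the matrices `[1, *; 0, 1]`. -/
def unipotentRadical (F : Type*) [Field F] (n k : ℕ) : Set (GL (Fin n) F) :=
  {u | ∀ i j : Fin n, ¬ ((i : ℕ) < k ∧ k ≤ (j : ℕ)) → u i j = if i = j then 1 else 0}

theorem det_unipotentRadical {F : Type*} [Field F] {n k : ℕ} {u : GL (Fin n) F} (hu : u ∈ unipotentRadical F n k) :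
    Matrix.GeneralLinearGroup.det u = 1 := by
  ext
  have h : (u : Matrix (Fin n) (Fin n) F).IsUpperTriangular := by
    intro i j hij
    have hij' : j < i := hij
    have := hu i j (by rintro ⟨h1, h2⟩; have : (j : ℕ) < i := hij'; omega)
    rw [if_neg hij'.ne'] at this
    exact this
  change (u : Matrix (Fin n) (Fin n) F).det = 1
  rw [Matrix.det_of_isUpperTriangular h]
  refine Finset.prod_eq_one fun i _ => ?_
  have := hu i i (by omega)
  simpa using this

/-! Two general facts: an endomorphism of a nonzero complex vector space of countable dimension
has a nonempty spectrum, and hence Schur's lemma holds in countable dimension. -/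

theorem isUnit_aeval {V : Type*} [AddCommGroup V] [Module ℂ V] [Nontrivial V]
    (P : Module.End ℂ V) (hP : ∀ a : ℂ, IsUnit (P - algebraMap ℂ _ a)) (p : Polynomial ℂ) (hp : p ≠ 0) :
    IsUnit (Polynomial.aeval P p) := by
  by_cases hd : 0 < p.degree
  · by_contra h
    have h0 : (0 : ℂ) ∈ spectrum ℂ (Polynomial.aeval P p) := spectrum.zero_mem ℂ h
    rw [spectrum.map_polynomial_aeval_of_degree_pos P p hd] at h0
    obtain ⟨k, hk, -⟩ := h0
    apply hk
    have := (hP k).neg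
    rwa [neg_sub] at this
  · rw [Polynomial.eq_C_of_degree_le_zero (not_lt.1 hd)] at hp ⊢
    rw [Polynomial.aeval_C]
    exact (isUnit_iff_ne_zero.2 (by simpa using hp)).map _

theorem exists_eigen {V : Type*} [AddCommGroup V] [Module ℂ V] [Nontrivial V]
    (hV : Module.rank ℂ V ≤ Cardinal.aleph0) (P : Module.End ℂ V) :
    ∃ a : ℂ, ¬ IsUnit (P - algebraMap ℂ _ a) := by
  by_contra! hP
  obtain ⟨v, hv⟩ := exists_ne (0 : V)
  have hLI : LinearIndependent ℂ (fun a : ℂ => ((hP a).unit⁻¹ : (Module.End ℂ V)ˣ).1 v) := by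
    rw [linearIndependent_iff']
    intro s m hm i hi
    let p : Polynomial ℂ := ∑ a ∈ s, Polynomial.C (m a) * ∏ j ∈ s.erase a, (Polynomial.X - Polynomial.C j)
    have hp : Polynomial.aeval P p v = 0 := by
      have h1 := congrArg (Polynomial.aeval P (∏ j ∈ s, (Polynomial.X - Polynomial.C j))) hm
      rw [map_zero, map_sum] at h1
      rw [← h1]
      simp only [p, map_sum, LinearMap.sum_apply]
      refine Finset.sum_congr rfl fun a ha => ?_
      rw [← Finset.prod_erase_mul _ _ ha, map_mul, map_mul, Module.End.mul_apply,
        Module.End.mul_apply, map_smul, Polynomial.aeval_C]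
      have h2 : (Polynomial.aeval P (Polynomial.X - Polynomial.C a)) (((hP a).unit⁻¹ : (Module.End ℂ V)ˣ).1 v) = v := by
        rw [map_sub, Polynomial.aeval_X, Polynomial.aeval_C]
        have := (hP a).mul_val_inv
        exact congrArg (fun T : Module.End ℂ V => T v) this
      rw [map_smul, h2]
      rfl
    have hp0 : p = 0 := by
      by_contra h
      have hu := isUnit_aeval P hP p h
      rw [Module.End.isUnit_iff] at hu
      exact hv (hu.1 (by rw [hp, map_zero]))
    have he := congrArg (Polynomial.eval i) hp0
    simp only [p, Polynomial.eval_finsetSum, Polynomial.eval_mul, Polynomial.eval_C, Polynomial.eval_prod, Polynomial.eval_sub, Polynomial.eval_X, Polynomial.eval_zero] at he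
    rw [Finset.sum_eq_single i] at he
    · refine (mul_eq_zero.1 he).resolve_right (Finset.prod_ne_zero_iff.2 fun j hj => ?_)
      exact sub_ne_zero.2 (Finset.ne_of_mem_erase hj).symm
    · intro b _ hb
      rw [Finset.prod_eq_zero (i := i) (Finset.mem_erase.2 ⟨hb.symm, hi⟩) (sub_self i), mul_zero]
    · intro h; exact absurd hi h
  have h1 := hLI.cardinal_lift_le_rank
  have h2 : Cardinal.lift (Cardinal.mk ℂ) ≤ Cardinal.aleph0 :=
    h1.trans (by simpa using hV)
  rw [Cardinal.mk_complex, Cardinal.lift_continuum] at h2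
  exact absurd h2 (not_le.2 Cardinal.aleph0_lt_continuum)

theorem exists_scalar {G V : Type*} [Group G] [AddCommGroup V] [Module ℂ V] (π : Representation ℂ G V)
    (h : π.IsIrreducible) (hV : Module.rank ℂ V ≤ Cardinal.aleph0) (P : Module.End ℂ V)
    (hP : ∀ g v, P (π g v) = π g (P v)) : ∃ a : ℂ, ∀ v, P v = a • v := by
  have : Nontrivial V := by
    by_contra hn
    rw [not_nontrivial_iff_subsingleton] at hn
    have := h.toNontrivial
    obtain ⟨A, B, hAB⟩ := this
    exact hAB (Subrepresentation.toSubmodule_injective (Subsingleton.elim _ _))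
  obtain ⟨a, ha⟩ := exists_eigen hV P
  refine ⟨a, ?_⟩
  let f : π.IntertwiningMap π := ⟨P - algebraMap ℂ _ a, by
    intro g; ext v
    simp [hP, Algebra.algebraMap_eq_smul_one]⟩
  rcases Representation.IsIrreducible.bijective_or_eq_zero f with hb | h0
  · exact absurd ((Module.End.isUnit_iff _).2 hb) ha
  · intro v
    have : (P - algebraMap ℂ _ a) v = 0 := congrArg (fun T : π.IntertwiningMap π => T v) h0
    rwa [LinearMap.sub_apply, sub_eq_zero] at this

section Supercuspidal

variable (F : Type*) [Field F] [ValuativeRel F] [TopologicalSpace F]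
  [IsNonarchimedeanLocalField F]

/-- The exponent `e(x) ∈ ℤ` for which the normalized absolute value of `x ∈ Fˣ` is `q ^ e(x)`,
`q` being the cardinality of the residue field (so a uniformizer has exponent `-1`). -/
def absExp : Fˣ →* Multiplicative ℤ where
  toFun x := Multiplicative.ofAdd (WithZero.log
    (IsNonarchimedeanLocalField.valueGroupWithZeroIsoInt F (valuation F (x : F))))
  map_one' := by simp
  map_mul' x y := by
    rw [Units.val_mul, map_mul, map_mul, WithZero.log_mul, ofAdd_add] <;> simp

/-- The normalized absolute value of `F`, as a complex valued character of `Fˣ`. -/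
def normAbs : Fˣ →* ℂˣ where
  toFun x := (Units.mk0 (Nat.card 𝓀[F] : ℂ) (Nat.cast_ne_zero.2 Nat.card_pos.ne')) ^
    (Multiplicative.toAdd (absExp F x))
  map_one' := by simp
  map_mul' x y := by rw [map_mul, toAdd_mul, zpow_add]

/-- The character `g ↦ |det g| ^ k` of `GL_n(F)`. -/
def detAbs (n : ℕ) (k : ℤ) : GL (Fin n) F →* ℂˣ :=
  (zpowGroupHom k).comp ((normAbs F).comp Matrix.GeneralLinearGroup.det)

theorem detAbs_apply (n : ℕ) (k : ℤ) (g : GL (Fin n) F) :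
    detAbs F n k g = normAbs F (Matrix.GeneralLinearGroup.det g) ^ k := rfl

/-- An irreducible supercuspidal smooth complex representation of `GL_n(F)`. Supercuspidality is
expressed by the vanishing of the Jacquet modules (the coinvariants of the unipotent radicals)
along all proper standard maximal parabolic subgroups. -/
structure SupercuspidalRep (n : ℕ) where
  /-- the underlying vector space -/
  V : Type
  [acg : AddCommGroup V]
  [mod : Module ℂ V]
  /-- the action -/
  π : Representation ℂ (GL (Fin n) F) V
  irreducible : π.IsIrreducible
  smooth : ∀ v : V, IsOpen {g : GL (Fin n) F | π g v = v}
  cuspidal : ∀ k : ℕ, 0 < k → k < n →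
    Submodule.span ℂ {w : V | ∃ u ∈ unipotentRadical F n k, ∃ v : V, w = π u v - v} = ⊤

attribute [instance] SupercuspidalRep.acg SupercuspidalRep.mod

variable {F}

/-- The twist `π ⊗ χ` of a representation by a character. -/
def twistRep {G V : Type*} [Group G] [AddCommGroup V] [Module ℂ V] (χ : G →* ℂˣ)
    (π : Representation ℂ G V) : Representation ℂ G V where
  toFun g := (χ g : ℂ) • π g
  map_one' := by simp
  map_mul' g h := by
    ext v
    simp [smul_smul, mul_comm]

theorem twistRep_apply {G V : Type*} [Group G] [AddCommGroup V] [Module ℂ V] (χ : G →* ℂˣ)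
    (π : Representation ℂ G V) (g : G) (v : V) : twistRep χ π g v = (χ g : ℂ) • π g v := rfl

theorem twistRep_irreducible {G V : Type*} [Group G] [AddCommGroup V] [Module ℂ V] (χ : G →* ℂˣ)
    (π : Representation ℂ G V) (h : π.IsIrreducible) : (twistRep χ π).IsIrreducible := by
  have key : ∀ (W : Submodule ℂ V) (g : G) (v : V), (χ g : ℂ) • π g v ∈ W ↔ π g v ∈ W := by
    intro W g v
    exact Submodule.smul_mem_iff W (Units.ne_zero _)
  let e : Subrepresentation π ≃o Subrepresentation (twistRep χ π) :=
    { toFun := fun W => ⟨W.toSubmodule, fun g v hv => by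
        rw [twistRep_apply, key]; exact W.apply_mem_toSubmodule g hv⟩
      invFun := fun W => ⟨W.toSubmodule, fun g v hv => by
        have := W.apply_mem_toSubmodule g hv
        rwa [twistRep_apply, key] at this⟩
      left_inv := fun _ => rfl
      right_inv := fun _ => rfl
      map_rel_iff' := Iff.rfl }
  exact (OrderIso.isSimpleOrder_iff e).1 h

theorem absExp_eq_one_iff (x : Fˣ) : absExp F x = 1 ↔ valuation F (x : F) = 1 := by
  have hx : valuation F (x : F) ≠ 0 := by simp
  constructor
  · intro h
    have h1 : WithZero.log
        (IsNonarchimedeanLocalField.valueGroupWithZeroIsoInt F (valuation F (x : F))) = 0 := h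
    have h2 := WithZero.exp_log (x :=
      IsNonarchimedeanLocalField.valueGroupWithZeroIsoInt F (valuation F (x : F))) (by simp)
    rw [h1, WithZero.exp_zero] at h2
    exact (map_eq_one_iff _
      (IsNonarchimedeanLocalField.valueGroupWithZeroIsoInt F).injective).1 h2.symm
  · intro h
    change Multiplicative.ofAdd (WithZero.log _) = 1
    rw [h]
    simp

theorem isOpen_absExp_eq_one : IsOpen {x : Fˣ | absExp F x = 1} := by
  have h : IsOpen ((valuation F).integer : Set F) := (valuation F).isOpen_integer
  have h2 : {x : Fˣ | absExp F x = 1} =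
      (fun x : Fˣ => (x : F)) ⁻¹' ((valuation F).integer : Set F) ∩
      (fun x : Fˣ => ((x⁻¹ : Fˣ) : F)) ⁻¹' ((valuation F).integer : Set F) := by
    ext x
    have hx : 0 < valuation F (x : F) := by simp [zero_lt_iff]
    simp only [Set.mem_ofPred_eq, absExp_eq_one_iff, Set.mem_inter_iff, Set.mem_preimage,
      SetLike.mem_coe, Valuation.mem_integer_iff, Units.val_inv_eq_inv_val, map_inv₀]
    rw [inv_le_one₀ hx, le_antisymm_iff]
  rw [h2]
  exact (h.preimage Units.continuous_val).inter
    (h.preimage (Units.continuous_val.comp continuous_inv))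

theorem isOpen_detAbs (n : ℕ) (k : ℤ) : IsOpen {g : GL (Fin n) F | detAbs F n k g = 1} := by
  have hd : Continuous (Matrix.GeneralLinearGroup.det : GL (Fin n) F → Fˣ) := by
    rw [Units.continuous_iff]
    refine ⟨Units.continuous_val.matrix_det, ?_⟩
    exact (Units.continuous_val.comp continuous_inv).matrix_det
  have h1 : IsOpen {g : GL (Fin n) F | absExp F (Matrix.GeneralLinearGroup.det g) = 1} :=
    isOpen_absExp_eq_one.preimage hd
  have h2 : IsOpen (((detAbs F n k).ker : Subgroup (GL (Fin n) F)) : Set (GL (Fin n) F)) := by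
    refine Subgroup.isOpen_mono
      (H₁ := ((absExp F).comp Matrix.GeneralLinearGroup.det).ker) ?_ h1
    intro g hg
    have hg' : absExp F (Matrix.GeneralLinearGroup.det g) = 1 := hg
    simp [MonoidHom.mem_ker, detAbs, normAbs, hg']
  exact h2

/-- The twist `ρ |det| ^ k` of an irreducible supercuspidal representation. -/
def SupercuspidalRep.twist {n : ℕ} (ρ : SupercuspidalRep F n) (k : ℤ) :
    SupercuspidalRep F n where
  V := ρ.V
  π := twistRep (detAbs F n k) ρ.π
  irreducible := twistRep_irreducible _ _ ρ.irreducible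
  smooth v := by
    let S : Subgroup (GL (Fin n) F) :=
      { carrier := {g | ρ.π g v = v}
        one_mem' := by simp
        mul_mem' := by
          intro a b ha hb
          simp only [Set.mem_ofPred_eq, map_mul, Module.End.mul_apply] at *
          rw [hb, ha]
        inv_mem' := by
          intro a ha
          simp only [Set.mem_ofPred_eq] at *
          conv_lhs => rw [← ha]
          simp }
    let T : Subgroup (GL (Fin n) F) :=
      { carrier := {g | twistRep (detAbs F n k) ρ.π g v = v}
        one_mem' := by simp
        mul_mem' := by
          intro a b ha hb
          simp only [Set.mem_ofPred_eq, map_mul, Module.End.mul_apply] at *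
          rw [hb, ha]
        inv_mem' := by
          intro a ha
          simp only [Set.mem_ofPred_eq] at *
          conv_lhs => rw [← ha]
          simp }
    have hS : IsOpen ((S ⊓ (detAbs F n k).ker : Subgroup (GL (Fin n) F)) :
        Set (GL (Fin n) F)) :=
      IsOpen.inter (s := {g | ρ.π g v = v}) (t := {g | detAbs F n k g = 1})
        (ρ.smooth v) (isOpen_detAbs n k)
    refine Subgroup.isOpen_mono (H₂ := T) ?_ hS
    rintro g ⟨h1, h2⟩
    have h1' : ρ.π g v = v := h1
    have h2' : detAbs F n k g = 1 := h2
    change twistRep (detAbs F n k) ρ.π g v = v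
    rw [twistRep_apply, h1', h2']
    simp
  cuspidal j hj hjn := by
    rw [← ρ.cuspidal j hj hjn]
    congr 1
    ext w
    refine exists_congr fun u => and_congr_right fun hu => ?_
    simp [twistRep_apply, detAbs, det_unipotentRadical hu]

variable (F)

/-- Isomorphism of representations. -/
def isoSetoid (n : ℕ) : Setoid (SupercuspidalRep F n) where
  r ρ ρ' := Nonempty (ρ.π.Equiv ρ'.π)
  iseqv := ⟨fun ρ => ⟨.refl ρ.π⟩, fun ⟨e⟩ => ⟨e.symm⟩, fun ⟨e⟩ ⟨f⟩ => ⟨e.trans f⟩⟩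

/-- `Irr_c`: the set of isomorphism classes of irreducible supercuspidal representations of the
groups `GL_n(F)`, `n > 0`. -/
def IrrC : Type _ := Σ n : ℕ+, Quotient (isoSetoid F n)

variable {F}

theorem twist_congr {n : ℕ} (k : ℤ) {ρ ρ' : SupercuspidalRep F n} (h : isoSetoid F n ρ ρ') :
    isoSetoid F n (ρ.twist k) (ρ'.twist k) := by
  obtain ⟨e⟩ := h
  refine ⟨.mk e.toLinearEquiv fun g => ?_⟩
  ext v
  change e ((detAbs F n k g : ℂ) • ρ.π g v) = (detAbs F n k g : ℂ) • ρ'.π g (e v)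
  rw [map_smul]
  congr 1
  exact Representation.IntertwiningMap.isIntertwining _ _ e.toIntertwiningMap g v

/-- The isomorphism class of the twist by `|det| ^ k`. -/
def IrrC.twist (k : ℤ) (ρ : IrrC F) : IrrC F :=
  ⟨ρ.1, Quotient.map (fun τ => τ.twist k) (fun _ _ h => twist_congr k h) ρ.2⟩

theorem twist_twist_iso {n : ℕ} (j k : ℤ) (τ : SupercuspidalRep F n) :
    isoSetoid F n ((τ.twist j).twist k) (τ.twist (j + k)) := by
  refine ⟨.mk (LinearEquiv.refl ℂ τ.V) fun g => ?_⟩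
  ext v
  change (detAbs F n k g : ℂ) • (detAbs F n j g : ℂ) • τ.π g v =
    (detAbs F n (j + k) g : ℂ) • τ.π g v
  rw [smul_smul, ← Units.val_mul, detAbs_apply, detAbs_apply, detAbs_apply, zpow_add, mul_comm]

theorem twist_zero_iso {n : ℕ} (τ : SupercuspidalRep F n) :
    isoSetoid F n (τ.twist 0) τ := by
  refine ⟨.mk (LinearEquiv.refl ℂ τ.V) fun g => ?_⟩
  ext v
  change (detAbs F n 0 g : ℂ) • τ.π g v = τ.π g v
  rw [detAbs_apply, zpow_zero, Units.val_one, one_smul]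

theorem IrrC.twist_twist (j k : ℤ) (ρ : IrrC F) : (ρ.twist j).twist k = ρ.twist (j + k) := by
  obtain ⟨n, q⟩ := ρ
  induction q using Quotient.inductionOn with | h τ => ?_
  exact congrArg (Sigma.mk n) (Quotient.sound (twist_twist_iso j k τ))

theorem IrrC.twist_zero (ρ : IrrC F) : ρ.twist 0 = ρ := by
  obtain ⟨n, q⟩ := ρ
  induction q using Quotient.inductionOn with | h τ => ?_
  exact congrArg (Sigma.mk n) (Quotient.sound (twist_zero_iso τ))

variable (F)

/-- The permutation `ρ ↦ ρ |det|` of `Irr_c`; its inverse is `ρ ↦ ρ |det|⁻¹`. -/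
def IrrC.shift : Equiv.Perm (IrrC F) where
  toFun := IrrC.twist 1
  invFun := IrrC.twist (-1)
  left_inv ρ := by rw [IrrC.twist_twist, add_neg_cancel, IrrC.twist_zero]
  right_inv ρ := by rw [IrrC.twist_twist, neg_add_cancel, IrrC.twist_zero]

variable {F}

/-! #### The permutation `ρ ↦ ρ |det|` has no finite orbits

This makes the beginning and the end of a segment well defined. The proof is by central
characters. -/

theorem sigmaCompact_field : SigmaCompactSpace F := by
  let e := IsNonarchimedeanLocalField.valueGroupWithZeroIsoInt F
  refine ⟨⟨fun n => {x | valuation F x ≤ e.symm (WithZero.exp (n : ℤ))}, fun n =>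
    IsNonarchimedeanLocalField.isCompact_closedBall F _, ?_⟩⟩
  ext x
  simp only [Set.mem_iUnion, Set.mem_ofPred_eq, Set.mem_univ, iff_true]
  refine ⟨(WithZero.log (e (valuation F x))).toNat, ?_⟩
  rw [← map_le_map_iff e, e.apply_symm_apply]
  by_cases h : e (valuation F x) = 0
  · rw [h]; exact zero_le
  · conv_lhs => rw [← WithZero.exp_log h]
    rw [WithZero.exp_le_exp]
    exact Int.self_le_toNat _

theorem sigmaCompact_GL (n : ℕ) : SigmaCompactSpace (GL (Fin n) F) := by
  have := sigmaCompact_field (F := F)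
  have : SigmaCompactSpace (Matrix (Fin n) (Fin n) F) :=
    inferInstanceAs (SigmaCompactSpace (Fin n → Fin n → F))
  have : SigmaCompactSpace (Matrix (Fin n) (Fin n) F)ᵐᵒᵖ :=
    MulOpposite.opHomeomorph.symm.isClosedEmbedding.sigmaCompactSpace
  have : T2Space F := by
    refine IsTopologicalAddGroup.t2Space_of_zero_sep fun x hx => ?_
    exact ⟨{y | valuation F y < valuation F x},
      (IsValuativeTopology.hasBasis_nhds_zero' F).mem_of_mem (by simpa using hx),
      fun h => lt_irrefl (valuation F x) h⟩
  have hc : Topology.IsClosedEmbedding (Units.embedProduct (Matrix (Fin n) (Fin n) F)) := by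
    refine ⟨Units.isEmbedding_embedProduct, ?_⟩
    have : Set.range (Units.embedProduct (Matrix (Fin n) (Fin n) F)) =
        {p | p.1 * p.2.unop = 1} ∩ {p | p.2.unop * p.1 = 1} := by
      ext p
      constructor
      · rintro ⟨u, rfl⟩; simp
      · rintro ⟨h1, h2⟩; exact ⟨⟨p.1, p.2.unop, h1, h2⟩, rfl⟩
    rw [this]
    have c2 := MulOpposite.continuous_unop.comp
      (continuous_snd (X := Matrix (Fin n) (Fin n) F) (Y := (Matrix (Fin n) (Fin n) F)ᵐᵒᵖ))
    exact (isClosed_eq (continuous_fst.mul c2) continuous_const).inter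
      (isClosed_eq (c2.mul continuous_fst) continuous_const)
  exact hc.sigmaCompactSpace

theorem rank_supercuspidal_le {n : ℕ} (τ : SupercuspidalRep F n) : Module.rank ℂ τ.V ≤ Cardinal.aleph0 := by
  have := sigmaCompact_GL (F := F) n
  by_cases hn : Nontrivial τ.V
  swap
  · rw [not_nontrivial_iff_subsingleton] at hn
    simp
  obtain ⟨v, hv⟩ := exists_ne (0 : τ.V)
  let S : Subgroup (GL (Fin n) F) :=
      { carrier := {g | τ.π g v = v}
        one_mem' := by simp
        mul_mem' := by
          intro a b ha hb
          simp only [Set.mem_ofPred_eq, map_mul, Module.End.mul_apply] at *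
          rw [hb, ha]
        inv_mem' := by
          intro a ha
          simp only [Set.mem_ofPred_eq] at *
          conv_lhs => rw [← ha]
          simp }
  have hS : IsOpen (S : Set (GL (Fin n) F)) := τ.smooth v
  have : DiscreteTopology (GL (Fin n) F ⧸ S) := QuotientGroup.discreteTopology hS
  have hcount : Countable (GL (Fin n) F ⧸ S) := by
    have hsc : IsSigmaCompact (Set.univ : Set (GL (Fin n) F ⧸ S)) := by
      have := (isSigmaCompact_univ (X := GL (Fin n) F)).image
        (QuotientGroup.continuous_mk (N := S))
      rwa [Set.image_univ, Set.range_eq_univ.2 Quotient.mk_surjective] at this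
    exact Set.countable_univ_iff.1 hsc.isLindelof.countable_of_discrete
  let f : GL (Fin n) F ⧸ S → τ.V := Quotient.lift (fun g => τ.π g v) (by
    intro a b hab
    have h1 : a⁻¹ * b ∈ S := QuotientGroup.leftRel_apply.1 hab
    have h2 : τ.π (a⁻¹ * b) v = v := h1
    have h3 := congrArg (τ.π a) h2
    rw [← Module.End.mul_apply, ← map_mul, mul_inv_cancel_left] at h3
    exact h3.symm)
  have hspan : Submodule.span ℂ (Set.range f) = ⊤ := by
    let W : Subrepresentation τ.π := ⟨Submodule.span ℂ (Set.range f), by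
      intro g w hw
      induction hw using Submodule.span_induction with
      | mem x hx =>
        obtain ⟨q, rfl⟩ := hx
        induction q using Quotient.inductionOn with | h a => ?_
        refine Submodule.subset_span ⟨Quotient.mk _ (g * a), ?_⟩
        change τ.π (g * a) v = τ.π g (τ.π a v)
        simp
      | zero => simp
      | add x y _ _ hx hy => rw [map_add]; exact add_mem hx hy
      | smul c x _ hx => rw [map_smul]; exact Submodule.smul_mem _ _ hx⟩
    have hi := τ.irreducible
    rcases hi.eq_bot_or_eq_top W with h | h
    · exfalso
      have hvW : v ∈ W.toSubmodule := Submodule.subset_span ⟨Quotient.mk _ 1, by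
        change τ.π 1 v = v; simp⟩
      rw [h] at hvW
      exact hv hvW
    · exact congrArg Subrepresentation.toSubmodule h
  rw [← rank_top ℂ τ.V, ← hspan]
  refine (rank_span_le _).trans ?_
  exact (Set.countable_range f).le_aleph0

theorem exists_absExp : ∃ x : Fˣ, absExp F x = Multiplicative.ofAdd 1 := by
  let e := IsNonarchimedeanLocalField.valueGroupWithZeroIsoInt F
  obtain ⟨y, hy⟩ := ValuativeRel.valuation_surjective (e.symm (WithZero.exp (1 : ℤ)))
  have hy0 : y ≠ 0 := by
    rintro rfl
    rw [map_zero] at hy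
    have := congrArg e hy
    rw [map_zero, e.apply_symm_apply] at this
    exact WithZero.exp_ne_zero this.symm
  refine ⟨Units.mk0 y hy0, ?_⟩
  change Multiplicative.ofAdd (WithZero.log (e (valuation F y))) = _
  rw [hy, e.apply_symm_apply, WithZero.log_exp]

theorem IrrC.twist_ne (k : ℤ) (hk : k ≠ 0) (ρ : IrrC F) : ρ.twist k ≠ ρ := by
  obtain ⟨n, q⟩ := ρ
  induction q using Quotient.inductionOn with | h τ => ?_
  intro h
  have h1 := eq_of_heq (Sigma.mk.inj h).2
  obtain ⟨T0⟩ : isoSetoid F n (τ.twist k) τ := Quotient.exact h1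
  let T : τ.V ≃ₗ[ℂ] τ.V := T0.toLinearEquiv
  obtain ⟨x, hx⟩ := exists_absExp (F := F)
  let z : GL (Fin n) F := Matrix.GeneralLinearGroup.scalar (Fin n) x
  have hz : ∀ g, z * g = g * z :=
    fun g => Matrix.GeneralLinearGroup.scalar_commute x g
  obtain ⟨a, ha⟩ := exists_scalar τ.π τ.irreducible (rank_supercuspidal_le τ) (τ.π z) (by
    intro g v
    rw [← Module.End.mul_apply, ← map_mul, hz, map_mul, Module.End.mul_apply])
  have hirr := τ.irreducible
  have : Nontrivial τ.V := by
    by_contra hn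
    rw [not_nontrivial_iff_subsingleton] at hn
    obtain ⟨A, B, hAB⟩ := hirr.toNontrivial
    exact hAB (Subrepresentation.toSubmodule_injective (Subsingleton.elim _ _))
  obtain ⟨v, hv⟩ := exists_ne (0 : τ.V)
  have ha0 : a ≠ 0 := by
    rintro rfl
    have h2 : τ.π (z⁻¹ * z) v = v := by simp
    rw [map_mul, Module.End.mul_apply, ha v, zero_smul, map_zero] at h2
    exact hv h2.symm
  have h3 : T ((detAbs F n k z : ℂ) • τ.π z v) = τ.π z (T v) :=
    Representation.IntertwiningMap.isIntertwining _ _ T0.toIntertwiningMap z v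
  rw [ha, ha, map_smul, map_smul, smul_smul] at h3
  have hTv : T v ≠ 0 := by
    intro h0
    exact hv (T.map_eq_zero_iff.1 h0)
  have h4 : (detAbs F n k z : ℂ) = 1 := by
    have := smul_left_injective ℂ hTv h3
    exact mul_right_cancel₀ ha0 (by simpa using this)
  have hq : 1 < Nat.card 𝓀[F] := Finite.one_lt_card
  have h5 : (Nat.card 𝓀[F] : ℂ) ^ ((n : ℤ) * k) = 1 := by
    rw [← h4, detAbs_apply]
    have : Matrix.GeneralLinearGroup.det z = x ^ (n : ℕ) := by
      ext
      change (Matrix.scalar (Fin n) (x : F)).det = _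
      simp [Matrix.det_diagonal]
    rw [this, map_pow]
    simp [normAbs, hx, zpow_mul]
  have h6 := congrArg norm h5
  rw [norm_zpow, Complex.norm_natCast, norm_one] at h6
  have h7 : (1 : ℝ) < Nat.card 𝓀[F] := by exact_mod_cast hq
  have := zpow_right_injective₀ (by linarith) h7.ne' (h6.trans (zpow_zero _).symm)
  have hn := n.ne_zero
  simp_all

theorem IrrC.shift_pow (k : ℕ) (ρ : IrrC F) : (IrrC.shift F ^ k) ρ = ρ.twist k := by
  induction k with
  | zero => exact (IrrC.twist_zero ρ).symm
  | succ k ih =>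
    rw [pow_succ', Equiv.Perm.mul_apply, ih]
    exact IrrC.twist_twist k 1 ρ

theorem IrrC.shift_pow_ne (k : ℕ) (hk : 0 < k) (ρ : IrrC F) : (IrrC.shift F ^ k) ρ ≠ ρ := by
  rw [IrrC.shift_pow]
  exact IrrC.twist_ne _ (by exact_mod_cast hk.ne') ρ

end Supercuspidal

/-! ### Segments and multisegments

In this part `R` stands for `Irr_c`, and `σ` for the permutation `ρ ↦ ρ |det|` of it. A
multisegment is an element of `Multiset (Seg R)`. -/

/-- The segment `{ρ, σ ρ, …, σ ^ (k - 1) ρ}`, `k > 0`, given by its beginning `ρ` and its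
length `k`. -/
structure Seg (R : Type*) where
  /-- the beginning `b(Δ)` -/
  b : R
  /-- the number of elements -/
  len : ℕ
  len_pos : 0 < len

namespace Seg

variable {R : Type*} (σ : Equiv.Perm R)

/-- The elements of a segment. -/
def elems (Δ : Seg R) : Set R := {ρ | ∃ j < Δ.len, ρ = (σ ^ j) Δ.b}

/-- The end `e(Δ)` of a segment. -/
def e (Δ : Seg R) : R := (σ ^ (Δ.len - 1)) Δ.b

/-- The segment `{σ ρ | ρ ∈ Δ}`. -/
def rshift (Δ : Seg R) : Seg R := ⟨σ Δ.b, Δ.len, Δ.len_pos⟩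

/-- The relation `Δ ≺ Δ'`. -/
def Prec (Δ Δ' : Seg R) : Prop :=
  Δ.b ∉ Δ'.elems σ ∧ Δ'.b ∈ (Δ.rshift σ).elems σ ∧ Δ'.e σ ∉ Δ.elems σ

/-- When `σ` has no finite orbits, a segment is determined by the set of its elements. -/
theorem elems_injective (hσ : ∀ k : ℕ, 0 < k → ∀ ρ : R, (σ ^ k) ρ ≠ ρ) :
    Function.Injective (elems σ) := by
  have hinj : ∀ (ρ : R) (i j : ℕ), i ≤ j → (σ ^ i) ρ = (σ ^ j) ρ → i = j := by
    intro ρ i j hij h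
    obtain ⟨d, rfl⟩ := Nat.exists_eq_add_of_le hij
    rw [pow_add, Equiv.Perm.mul_apply] at h
    have h' := (σ ^ i).injective h
    by_contra hne
    exact hσ d (by omega) ρ h'.symm
  have hle : ∀ Δ Δ' : Seg R, Δ.b = Δ'.b → Δ.elems σ = Δ'.elems σ → Δ.len ≤ Δ'.len := by
    intro Δ Δ' hb h
    have hl := Δ.len_pos
    have hm : (σ ^ (Δ.len - 1)) Δ.b ∈ Δ'.elems σ := h ▸ ⟨Δ.len - 1, by omega, rfl⟩
    obtain ⟨j, hj, he⟩ := hm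
    rw [← hb] at he
    rcases le_total (Δ.len - 1) j with h1 | h1
    · have := hinj _ _ _ h1 he; omega
    · have := hinj _ _ _ h1 he.symm; omega
  intro Δ Δ' h
  have hb : Δ.b = Δ'.b := by
    obtain ⟨i, -, hi⟩ : Δ.b ∈ Δ'.elems σ := h ▸ ⟨0, Δ.len_pos, rfl⟩
    obtain ⟨j, -, hj⟩ : Δ'.b ∈ Δ.elems σ := h ▸ ⟨0, Δ'.len_pos, rfl⟩
    have h2 : (σ ^ 0) Δ.b = (σ ^ (i + j)) Δ.b := by
      rw [pow_add, Equiv.Perm.mul_apply, ← hj]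
      exact hi
    have h3 := hinj _ _ _ (Nat.zero_le _) h2
    obtain rfl : i = 0 := by omega
    exact hi
  obtain ⟨b, n, hn⟩ := Δ
  obtain ⟨b', n', hn'⟩ := Δ'
  have h1 := hle _ _ hb h
  have h2 := hle _ _ hb.symm h.symm
  simp only [Seg.mk.injEq]
  exact ⟨hb, le_antisymm h1 h2⟩

end Seg

/-- The multisegment `∑ i, Δ i`. -/
def multiseg {R I : Type*} [Fintype I] (Δ : I → Seg R) : Multiset (Seg R) :=
  Finset.univ.val.map Δ

/-- The set `X_{𝔪,𝔪'} = {(i, i') | Δ i ≺ Δ' i'}`; moreover `X_𝔪 = X_{𝔪,𝔪}`. -/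
abbrev XSet {R I I' : Type*} (σ : Equiv.Perm R) (Δ : I → Seg R) (Δ' : I' → Seg R) : Type _ :=
  {p : I × I' // (Δ p.1).Prec σ (Δ' p.2)}

/-- The set `Y_{𝔪,𝔪'}` of all `(i, i')` such that `Δ i` precedes the shift of `Δ' i'`. -/
abbrev YSet {R I I' : Type*} (σ : Equiv.Perm R) (Δ : I → Seg R) (Δ' : I' → Seg R) : Type _ :=
  {p : I × I' // (Δ p.1).Prec σ ((Δ' p.2).rshift σ)}

/-! ### Zariski closure in a complex vector space -/

section Zariski

variable {W : Type*} [AddCommGroup W] [Module ℂ W]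

variable (W) in
/-- The polynomial functions on a complex vector space. -/
def polyFun : Subalgebra ℂ (W → ℂ) :=
  Algebra.adjoin ℂ {f | ∃ φ : Module.Dual ℂ W, f = fun w => φ w}

/-- The Zariski closure of a subset. -/
def zclosure (S : Set W) : Set W :=
  {w | ∀ f ∈ polyFun W, (∀ s ∈ S, f s = 0) → f w = 0}

/-- `S` is a Zariski dense subset of `T`. -/
def DenseIn (S T : Set W) : Prop := S ⊆ T ∧ T ⊆ zclosure S

end Zariski

/-! ### Graded vector spaces -/

section Graded

variable {R : Type*} (σ : Equiv.Perm R) {V : Type*} [AddCommGroup V] [Module ℂ V]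
  (𝒱 : R → Submodule ℂ V)

/-- `𝔾(V)`: the grading preserving linear automorphisms. -/
def gradedAut : Set (V ≃ₗ[ℂ] V) := {g | ∀ ρ, (𝒱 ρ).map (g : V →ₗ[ℂ] V) = 𝒱 ρ}

/-- The linear maps of degree one (`V_ρ` goes to `V_{σ ρ}`). -/
def degUp : Set (Module.End ℂ V) := {A | ∀ ρ, ∀ v ∈ 𝒱 ρ, A v ∈ 𝒱 (σ ρ)}

/-- The linear maps of degree minus one (`V_ρ` goes to `V_{σ⁻¹ ρ}`). -/
def degDown : Set (Module.End ℂ V) := {B | ∀ ρ, ∀ v ∈ 𝒱 ρ, B v ∈ 𝒱 (σ⁻¹ ρ)}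

/-- The commuting variety `𝔛(V)`. -/
def commVar : Set (Module.End ℂ V × Module.End ℂ V) :=
  {p | p.1 ∈ degUp σ 𝒱 ∧ p.2 ∈ degDown σ 𝒱 ∧ p.1 * p.2 = p.2 * p.1}

/-- The set `H · S`, for a set `H` of automorphisms of `V`, acting on `End V` by conjugation. -/
def orb (H : Set (V ≃ₗ[ℂ] V)) (S : Set (Module.End ℂ V)) : Set (Module.End ℂ V) :=
  {T | ∃ g ∈ H, ∃ A ∈ S, T = g.conj A}

/-- The set `H · S`, for a set `H` of automorphisms of `V`, acting on pairs of endomorphisms by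
simultaneous conjugation. -/
def orbPair (H : Set (V ≃ₗ[ℂ] V)) (S : Set (Module.End ℂ V × Module.End ℂ V)) :
    Set (Module.End ℂ V × Module.End ℂ V) :=
  {T | ∃ g ∈ H, ∃ p ∈ S, T = (g.conj p.1, g.conj p.2)}

/-- The index set `{(i, ρ) | ρ ∈ Δ i}` of the graded bases below. -/
abbrev Pts {I : Type*} (Δ : I → Seg R) : Type _ := {p : I × R // p.2 ∈ (Δ p.1).elems σ}

variable {σ} in
open Classical in
/-- The basis vector `x_{ρ,i}`, with the convention `x_{ρ,i} = 0` if `ρ ∉ Δ i`. -/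
def bvec {I : Type*} {Δ : I → Seg R} (x : Module.Basis (Pts σ Δ) ℂ V) (ρ : R) (i : I) : V :=
  if h : ρ ∈ (Δ i).elems σ then x ⟨(i, ρ), h⟩ else 0

/-- The basis `x_{ρ,i}` is graded (with `x_{ρ,i} ∈ V_ρ`), and the endomorphism `A` has graded
Jordan form in it: `A x_{ρ,i} = x_{σ ρ,i}`. -/
def IsJordanBasis {I : Type*} (Δ : I → Seg R) (A : Module.End ℂ V)
    (x : Module.Basis (Pts σ Δ) ℂ V) : Prop :=
  ∀ i, ∀ ρ ∈ (Δ i).elems σ, bvec x ρ i ∈ 𝒱 ρ ∧ A (bvec x ρ i) = bvec x (σ ρ) i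

/-- The orbit `𝒪_𝔪` attached to a multisegment `𝔪`. -/
def orbitOf (m : Multiset (Seg R)) : Set (Module.End ℂ V) :=
  {A | A ∈ degUp σ 𝒱 ∧ ∃ (k : ℕ) (Δ : Fin k → Seg R), multiseg Δ = m ∧
    ∃ x : Module.Basis (Pts σ Δ) ℂ V, IsJordanBasis σ 𝒱 Δ A x}

/-- `ℭ°_𝔪`: the inverse image of the orbit `𝒪_𝔪` in the commuting variety. -/
def compOpen (m : Multiset (Seg R)) : Set (Module.End ℂ V × Module.End ℂ V) :=
  {p | p ∈ commVar σ 𝒱 ∧ p.1 ∈ orbitOf σ 𝒱 m}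

/-- `ℭ_𝔪`: the irreducible component of the commuting variety attached to `𝔪`. -/
def irrComp (m : Multiset (Seg R)) : Set (Module.End ℂ V × Module.End ℂ V) :=
  zclosure (compOpen σ 𝒱 m)

/-- `𝐂_𝔪`: the centralizer of `A` in the space of maps of degree minus one. -/
def centDown (A : Module.End ℂ V) : Set (Module.End ℂ V) :=
  {B | B ∈ degDown σ 𝒱 ∧ A * B = B * A}

/-- `𝐆_𝔪`: the stabilizer of `A` in `𝔾(V)`. -/
def stab (A : Module.End ℂ V) : Set (V ≃ₗ[ℂ] V) := {g | g ∈ gradedAut 𝒱 ∧ g.conj A = A}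

variable {σ} in
open Classical in
/-- The scalars `c (i, j)` are the coordinates of `B ∈ 𝐂_𝔪`:
`B x_{ρ,j} = ∑ c (i, j) x_{σ⁻¹ ρ,i}`, the sum being over all `i` such that `Δ i ≺ Δ j`. -/
def IsCoord {I : Type*} [Fintype I] {Δ : I → Seg R} (x : Module.Basis (Pts σ Δ) ℂ V)
    (B : Module.End ℂ V) (c : XSet σ Δ Δ → ℂ) : Prop :=
  ∀ j, ∀ ρ ∈ (Δ j).elems σ, B (bvec x ρ j) =
    ∑ i : I, if h : (Δ i).Prec σ (Δ j) then c ⟨(i, j), h⟩ • bvec x (σ⁻¹ ρ) i else 0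

end Graded

/-! ### Direct sums of two graded vector spaces -/

section DirectSum

variable {R : Type*} (σ : Equiv.Perm R)
  {V : Type*} [AddCommGroup V] [Module ℂ V] (𝒱 : R → Submodule ℂ V)
  {V' : Type*} [AddCommGroup V'] [Module ℂ V'] (𝒱' : R → Submodule ℂ V')

/-- The grading of `V ⊕ V'`. -/
def sumGrading (ρ : R) : Submodule ℂ (V × V') := (𝒱 ρ).prod (𝒱' ρ)

variable (V V') in
/-- The endomorphisms of `V ⊕ V'` which map `V` to itself. -/
def presFst : Set (Module.End ℂ (V × V')) := {A | ∀ v : V, (A (v, 0)).2 = 0}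

variable (V V') in
/-- The endomorphisms of `V ⊕ V'` which map `V'` to itself. -/
def presSnd : Set (Module.End ℂ (V × V')) := {A | ∀ v' : V', (A (0, v')).1 = 0}

/-- The diagonal block in `End V` of an endomorphism of `V ⊕ V'`: the restriction to `V`, if `V`
is preserved, and the map induced on the quotient `V`, if `V'` is preserved. -/
def blockFst (A : Module.End ℂ (V × V')) : Module.End ℂ V :=
  LinearMap.fst ℂ V V' ∘ₗ A ∘ₗ LinearMap.inl ℂ V V'

/-- The diagonal block in `End V'` of an endomorphism of `V ⊕ V'`. -/
def blockSnd (A : Module.End ℂ (V × V')) : Module.End ℂ V' :=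
  LinearMap.snd ℂ V V' ∘ₗ A ∘ₗ LinearMap.inr ℂ V V'

/-- The parabolic subgroup `ℙ^ι`: the stabilizer of `V` in `𝔾(V ⊕ V')`. -/
def parab : Set ((V × V') ≃ₗ[ℂ] (V × V')) :=
  {g | g ∈ gradedAut (sumGrading 𝒱 𝒱') ∧
    (LinearMap.range (LinearMap.inl ℂ V V')).map (g : (V × V') →ₗ[ℂ] (V × V')) =
      LinearMap.range (LinearMap.inl ℂ V V')}

/-- The unipotent radical `𝕌^ι` of `ℙ^ι`. -/
def unip : Set ((V × V') ≃ₗ[ℂ] (V × V')) :=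
  {g | g ∈ gradedAut (sumGrading 𝒱 𝒱') ∧
    (∀ v : V, g (v, 0) = (v, 0)) ∧ ∀ w : V × V', (g w).2 = w.2}

/-- `𝔜^ι_{𝔪,𝔪'}`: the Zariski closure of the set of `(A, B) ∈ ℭ_{𝔪+𝔪'}` which preserve `V`, with
restriction to `V` in `ℭ°_𝔪`, and induced pair on `V'` in `ℭ°_𝔪'`. -/
def yVar (m m' : Multiset (Seg R)) :
    Set (Module.End ℂ (V × V') × Module.End ℂ (V × V')) :=
  zclosure {p | p ∈ irrComp σ (sumGrading 𝒱 𝒱') (m + m') ∧ p.1 ∈ presFst V V' ∧ p.2 ∈ presFst V V' ∧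
    (blockFst p.1, blockFst p.2) ∈ compOpen σ 𝒱 m ∧
    (blockSnd p.1, blockSnd p.2) ∈ compOpen σ 𝒱' m'}

/-- `𝔜^ι'_{𝔪',𝔪}`: the Zariski closure of the set of `(A, B) ∈ ℭ_{𝔪+𝔪'}` which preserve `V'`, with
restriction to `V'` in `ℭ°_𝔪'`, and induced pair on `V` in `ℭ°_𝔪`. -/
def yVar' (m m' : Multiset (Seg R)) :
    Set (Module.End ℂ (V × V') × Module.End ℂ (V × V')) :=
  zclosure {p | p ∈ irrComp σ (sumGrading 𝒱 𝒱') (m + m') ∧ p.1 ∈ presSnd V V' ∧ p.2 ∈ presSnd V V' ∧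
    (blockSnd p.1, blockSnd p.2) ∈ compOpen σ 𝒱' m' ∧
    (blockFst p.1, blockFst p.2) ∈ compOpen σ 𝒱 m}

/-- `ℨ_{𝔪,𝔪'}`. -/
def zVar (m m' : Multiset (Seg R)) :
    Set (Module.End ℂ (V × V') × Module.End ℂ (V × V')) :=
  yVar σ 𝒱 𝒱' m m' ∩ yVar' σ 𝒱 𝒱' m m'

/-- The condition LC: `𝔾(V ⊕ V') · 𝔜^ι'_{𝔪',𝔪}` is dense in `ℭ_{𝔪+𝔪'}`. -/
def LC (m m' : Multiset (Seg R)) : Prop :=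
  DenseIn (orbPair (gradedAut (sumGrading 𝒱 𝒱')) (yVar' σ 𝒱 𝒱' m m'))
    (irrComp σ (sumGrading 𝒱 𝒱') (m + m'))

/-- The second form of the condition LC: `ℙ^ι · ℨ_{𝔪,𝔪'}` is dense in `𝔜^ι_{𝔪,𝔪'}`. -/
def LCparab (m m' : Multiset (Seg R)) : Prop :=
  DenseIn (orbPair (parab 𝒱 𝒱') (zVar σ 𝒱 𝒱' m m')) (yVar σ 𝒱 𝒱' m m')

/-! In the remaining definitions, `A` and `A'` stand for `𝐀_𝔪` and `𝐀_𝔪'`, and `𝔫 = 𝔪 + 𝔪'`. -/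

variable (A : Module.End ℂ V) (A' : Module.End ℂ V')

/-- `𝐂_𝔫`, the centralizer of `𝐀_𝔫 = 𝐀_𝔪 ⊕ 𝐀_𝔪'`. -/
def cN : Set (Module.End ℂ (V × V')) := centDown σ (sumGrading 𝒱 𝒱') (A.prodMap A')

/-- `𝐂_𝔫^ι`: the elements of `𝐂_𝔫` which preserve `V`. -/
def cFst : Set (Module.End ℂ (V × V')) := cN σ 𝒱 𝒱' A A' ∩ presFst V V'

/-- `𝐂_𝔫^ι'`: the elements of `𝐂_𝔫` which preserve `V'`. -/
def cSnd : Set (Module.End ℂ (V × V')) := cN σ 𝒱 𝒱' A A' ∩ presSnd V V'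

/-- `𝐂_𝔫^{ι,ι'}`. -/
def cBoth : Set (Module.End ℂ (V × V')) := cFst σ 𝒱 𝒱' A A' ∩ cSnd σ 𝒱 𝒱' A A'

/-- `𝐆_𝔫`, the stabilizer of `𝐀_𝔫` in `𝔾(V ⊕ V')`. -/
def gN : Set ((V × V') ≃ₗ[ℂ] (V × V')) := stab (sumGrading 𝒱 𝒱') (A.prodMap A')

/-- `𝐏^ι`. -/
def pN : Set ((V × V') ≃ₗ[ℂ] (V × V')) := gN 𝒱 𝒱' A A' ∩ parab 𝒱 𝒱'

/-- `𝐔^ι`. -/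
def uN : Set ((V × V') ≃ₗ[ℂ] (V × V')) := gN 𝒱 𝒱' A A' ∩ unip 𝒱 𝒱'

end DirectSum

/-! ### The vectors `v_{i,j}` -/

section Vectors

variable {R : Type*} (σ : Equiv.Perm R) {I I' : Type*} (Δ : I → Seg R) (Δ' : I' → Seg R)

open Classical in
/-- The vector `v_{i,j}(λ, λ')` of `ℂ^Y`, `Y = Y_{𝔪,𝔪'}`, where `c` and `c'` are the coordinates of
`λ` and `λ'`. -/
def vvec [Fintype I] [Fintype I'] (c : XSet σ Δ Δ → ℂ) (c' : XSet σ Δ' Δ' → ℂ) (i : I) (j : I') :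
    YSet σ Δ Δ' → ℂ :=
  (∑ r : I, if h : (Δ i).Prec σ (Δ r) ∧ (Δ r).Prec σ ((Δ' j).rshift σ) then
    c ⟨(i, r), h.1⟩ • Pi.single (⟨(r, j), h.2⟩ : YSet σ Δ Δ') (1 : ℂ) else 0) -
  ∑ s : I', if h : (Δ' s).Prec σ (Δ' j) ∧ (Δ i).Prec σ ((Δ' s).rshift σ) then
    c' ⟨(s, j), h.1⟩ • Pi.single (⟨(i, s), h.2⟩ : YSet σ Δ Δ') (1 : ℂ) else 0

end Vectors

end

end MultisegGeom

/-!
Everything takes place in the algebra `𝓔 = End (V ⊕ V')`, with the idempotent `e` projecting onto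
`V`, which commutes with `N = 𝐀_𝔫`. The groups are groups of units of subalgebras: `𝐆_𝔫` is the
group of units of `M`, the endomorphisms of degree zero commuting with `N`; the parabolic group
`𝐏^ι` consists of its block upper triangular elements, and `𝐔^ι` of the elements `1 + u`, where `u
= e u (1 - e)` runs through the upper right block of `M`. Put `C = 𝐂_𝔫`. All conditions are shown
to be equivalent to a linear one (`SurjComm`):

for some block diagonal `d ∈ C`, the map `u ↦ u d - d u`, from the upper right block of `M` to the
upper right block of `C`, is surjective.

* The two equalities follow from the density of the big cell (`conjSet_subset_zclosure_unipSet`)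
  and from the Levi decomposition (`conjSet_triang_eq_unipSet`).
* Conditions (1) and (2) ask whether the map `(u, d) ↦ (1 + u) d (1 - u)` is dominant, `d` running
  through the block lower triangular elements of `C`, resp. through the block diagonal ones. By
  the Jacobian criterion (`dominant_iff_exists_surjective_deriv`) this means that its differential
  is surjective at some point, and by equivariance one may take `u = 0`
  (`subset_zclosure_unipSet_iff`). In both cases, only the upper right block of the differential
  matters, and this is `u ↦ u d - d u`.
* The conditions LC concern pairs `(A, B)` with a variable `A`. The pairs in the definitions of
  the varieties `𝔜` are conjugate under the parabolic group to pairs `(N, B)` with `B` in the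
  fibre (`triangPairs_eq`). The point is that a block triangular element in the closure of the
  orbit of `N`, with the same diagonal blocks as `N`, is conjugate to `N` under the unipotent
  group; this is proved by semicontinuity of the dimension of the space of intertwining maps
  (`exists_offDiag_of_mem_zclosure_conjTo`). Hence density in the fibre above `N` implies density
  in the total space. Conversely, the equation `g A = N g` has a solution `g` that is a rational
  function of `A` near `N`, on the closure of the orbit of `N`; conjugation by this `g` moves
  nearby fibres to the fibre above `N` (`mem_zclosure_of_slice`).
* In a graded Jordan basis, maps `V' → V` of degree zero intertwining `𝐀_𝔪'` and `𝐀_𝔪` have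
  coordinates indexed by `Y_{𝔪,𝔪'}`, and those of degree minus one have coordinates indexed by
  `X_{𝔪,𝔪'}` (`exists_hasCoeff`). The vectors `v_{i,j}(λ, λ')` are the rows of the matrix of `u ↦
  λ u - u λ'` (`sum_vvec_mul`, `repr_comm`), so that condition (3) is `SurjComm` for `d = λ ⊕ λ'`.
-/

namespace MultisegGeom

/-! ### Polynomial functions and the Zariski closure -/

section Regular

variable {X : Type*} {E F G : Type*} [AddCommGroup E] [Module ℂ E] [AddCommGroup F] [Module ℂ F]
  [AddCommGroup G] [Module ℂ G]

/-- A map from a set `X` to a complex vector space is regular with respect to an algebra `𝒜` of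
functions on `X` if its composition with every linear form belongs to `𝒜`. -/
def IsRegular (𝒜 : Subalgebra ℂ (X → ℂ)) (Φ : X → E) : Prop :=
  ∀ φ : Module.Dual ℂ E, (fun x => φ (Φ x)) ∈ 𝒜

variable {𝒜 : Subalgebra ℂ (X → ℂ)}

theorem isRegular_const (v : E) : IsRegular 𝒜 (fun _ => v) :=
  fun φ => 𝒜.algebraMap_mem (φ v)

theorem IsRegular.linear {Φ : X → E} (h : IsRegular 𝒜 Φ) (T : E →ₗ[ℂ] F) :
    IsRegular 𝒜 (fun x => T (Φ x)) :=
  fun φ => h (φ ∘ₗ T)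

theorem IsRegular.add {Φ Ψ : X → E} (h : IsRegular 𝒜 Φ) (h' : IsRegular 𝒜 Ψ) :
    IsRegular 𝒜 (fun x => Φ x + Ψ x) := fun φ => by
  simp only [map_add]
  exact 𝒜.add_mem (h φ) (h' φ)

theorem IsRegular.sub {Φ Ψ : X → E} (h : IsRegular 𝒜 Φ) (h' : IsRegular 𝒜 Ψ) :
    IsRegular 𝒜 (fun x => Φ x - Ψ x) := fun φ => by
  simp only [map_sub]
  exact 𝒜.sub_mem (h φ) (h' φ)

theorem IsRegular.sum {ι : Type*} (s : Finset ι) {Φ : ι → X → E}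
    (h : ∀ i ∈ s, IsRegular 𝒜 (Φ i)) : IsRegular 𝒜 (fun x => ∑ i ∈ s, Φ i x) := fun φ => by
  have h1 := 𝒜.sum_mem fun i hi => h i hi φ
  convert h1 using 1
  ext x
  simp

theorem IsRegular.smul {f : X → ℂ} {Φ : X → E} (hf : f ∈ 𝒜) (h : IsRegular 𝒜 Φ) :
    IsRegular 𝒜 (fun x => f x • Φ x) := fun φ => by
  simp only [map_smul]
  exact 𝒜.mul_mem hf (h φ)

theorem IsRegular.prodMk {Φ : X → E} {Ψ : X → F} (h : IsRegular 𝒜 Φ) (h' : IsRegular 𝒜 Ψ) :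
    IsRegular 𝒜 (fun x => (Φ x, Ψ x)) := by
  have := (h.linear (LinearMap.inl ℂ E F)).add (h'.linear (LinearMap.inr ℂ E F))
  simpa using this

theorem IsRegular.bilin [FiniteDimensional ℂ E] {Φ : X → E} {Ψ : X → F} (h : IsRegular 𝒜 Φ)
    (h' : IsRegular 𝒜 Ψ) (β : E →ₗ[ℂ] F →ₗ[ℂ] G) : IsRegular 𝒜 (fun x => β (Φ x) (Ψ x)) := by
  let b := Module.finBasis ℂ E
  have h1 : (fun x => β (Φ x) (Ψ x)) = fun x => ∑ i, b.coord i (Φ x) • β (b i) (Ψ x) := by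
    ext x
    conv_lhs => rw [← b.sum_repr (Φ x), map_sum, LinearMap.sum_apply]
    simp
  rw [h1]
  exact IsRegular.sum _ fun i _ => IsRegular.smul (h (b.coord i)) (h'.linear (β (b i)))

theorem IsRegular.mul {𝓔 : Type*} [Ring 𝓔] [Algebra ℂ 𝓔] [FiniteDimensional ℂ 𝓔]
    {Φ Ψ : X → 𝓔} (h : IsRegular 𝒜 Φ) (h' : IsRegular 𝒜 Ψ) :
    IsRegular 𝒜 (fun x => Φ x * Ψ x) :=
  h.bilin h' (LinearMap.mul ℂ 𝓔)

theorem isRegular_linearMap (T : E →ₗ[ℂ] F) : IsRegular (polyFun E) T :=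
  fun φ => Algebra.subset_adjoin ⟨φ ∘ₗ T, rfl⟩

theorem IsRegular.polyFun_comp {Φ : X → E} (h : IsRegular 𝒜 Φ) {f : E → ℂ} (hf : f ∈ polyFun E) :
    (fun x => f (Φ x)) ∈ 𝒜 := by
  refine Algebra.adjoin_induction (p := fun f _ => (fun x => f (Φ x)) ∈ 𝒜) ?_ ?_ ?_ ?_ hf
  · rintro _ ⟨φ, rfl⟩
    exact h φ
  · exact fun r => 𝒜.algebraMap_mem r
  · exact fun f g _ _ hf hg => 𝒜.add_mem hf hg
  · exact fun f g _ _ hf hg => 𝒜.mul_mem hf hg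

/-- The adjugate of an endomorphism, computed in some basis. -/
noncomputable def endAdj [FiniteDimensional ℂ E] (T : Module.End ℂ E) : Module.End ℂ E :=
  Matrix.toLin (Module.finBasis ℂ E) (Module.finBasis ℂ E)
    (LinearMap.toMatrix (Module.finBasis ℂ E) (Module.finBasis ℂ E) T).adjugate

variable [FiniteDimensional ℂ E]

theorem mul_endAdj (T : Module.End ℂ E) : T * endAdj T = LinearMap.det T • 1 := by
  let b := Module.finBasis ℂ E
  apply (LinearMap.toMatrix b b).injective
  rw [LinearMap.toMatrix_mul]
  simp only [endAdj, b, LinearMap.toMatrix_toLin]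
  rw [Matrix.mul_adjugate, LinearMap.det_toMatrix, map_smul, LinearMap.toMatrix_one]

theorem endAdj_one : endAdj (1 : Module.End ℂ E) = 1 := by
  simp [endAdj, Matrix.toLin_one, Module.End.one_eq_id]

theorem IsRegular.exists_matrix {T : X → Module.End ℂ E} (h : IsRegular 𝒜 T) :
    ∃ m : Matrix (Fin (Module.finrank ℂ E)) (Fin (Module.finrank ℂ E)) 𝒜, ∀ x,
      LinearMap.toMatrix (Module.finBasis ℂ E) (Module.finBasis ℂ E) (T x) =
        ((Pi.evalRingHom (fun _ : X => ℂ) x).comp 𝒜.val.toRingHom).mapMatrix m := by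
  let b := Module.finBasis ℂ E
  refine ⟨fun i j => ⟨fun x => LinearMap.toMatrix b b (T x) i j, ?_⟩, ?_⟩
  · exact h ((LinearMap.proj j ∘ₗ LinearMap.proj i :
      Matrix (Fin (Module.finrank ℂ E)) (Fin (Module.finrank ℂ E)) ℂ →ₗ[ℂ] ℂ) ∘ₗ
      (LinearMap.toMatrix b b).toLinearMap)
  · intro x
    rfl

theorem IsRegular.det {T : X → Module.End ℂ E} (h : IsRegular 𝒜 T) :
    (fun x => LinearMap.det (T x)) ∈ 𝒜 := by
  obtain ⟨m, hm⟩ := h.exists_matrix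
  convert m.det.2 using 1
  ext x
  rw [← LinearMap.det_toMatrix (Module.finBasis ℂ E), hm, ← RingHom.map_det]
  rfl

theorem IsRegular.endAdj {T : X → Module.End ℂ E} (h : IsRegular 𝒜 T) :
    IsRegular 𝒜 (fun x => endAdj (T x)) := by
  obtain ⟨m, hm⟩ := h.exists_matrix
  have h1 : IsRegular 𝒜 (fun x => ∑ i, ∑ j, (m.adjugate i j : X → ℂ) x •
      Matrix.toLin (Module.finBasis ℂ E) (Module.finBasis ℂ E) (Matrix.single i j (1 : ℂ))) :=
    IsRegular.sum _ fun i _ => IsRegular.sum _ fun j _ =>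
      IsRegular.smul (m.adjugate i j).2 (isRegular_const _)
  convert h1 using 2 with x
  rw [MultisegGeom.endAdj, hm, ← RingHom.map_adjugate]
  conv_lhs => rw [Matrix.matrix_eq_sum_single (RingHom.mapMatrix _ m.adjugate)]
  simp only [map_sum]
  refine Finset.sum_congr rfl fun i _ => Finset.sum_congr rfl fun j _ => ?_
  rw [← map_smul, Matrix.smul_single, smul_eq_mul, mul_one]
  rfl

end Regular

section Closure

variable {W E F : Type*} [AddCommGroup W] [Module ℂ W] [AddCommGroup E] [Module ℂ E]
  [AddCommGroup F] [Module ℂ F]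

theorem subset_zclosure (S : Set W) : S ⊆ zclosure S := fun _ hs _ _ h => h _ hs

theorem zclosure_mono {S T : Set W} (h : S ⊆ T) : zclosure S ⊆ zclosure T :=
  fun _ hw f hf hT => hw f hf fun s hs => hT s (h hs)

theorem zclosure_subset_of_subset {S T : Set W} (h : S ⊆ zclosure T) : zclosure S ⊆ zclosure T :=
  fun _ hw f hf hT => hw f hf fun _ hs => h hs f hf hT

theorem IsRegular.mapsTo_zclosure {Φ : W → E} (h : IsRegular (polyFun W) Φ) {S : Set W}
    {T : Set E} (hST : Set.MapsTo Φ S (zclosure T)) :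
    Set.MapsTo Φ (zclosure S) (zclosure T) := fun _ hw f hf hT =>
  hw _ (h.polyFun_comp hf) fun _ hs => hST hs f hf hT

theorem zclosure_zero : zclosure ({0} : Set W) ⊆ {0} := by
  intro w hw
  refine (Module.forall_dual_apply_eq_zero_iff ℂ w).1 fun φ => ?_
  exact hw _ (isRegular_linearMap (LinearMap.id : W →ₗ[ℂ] W) φ) (by simp)

/-- The zero set of a regular map is Zariski closed. -/
theorem IsRegular.eq_zero_of_mem_zclosure {Φ : W → E} (h : IsRegular (polyFun W) Φ) {S : Set W}
    (hS : ∀ s ∈ S, Φ s = 0) {w : W} (hw : w ∈ zclosure S) : Φ w = 0 :=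
  zclosure_zero (h.mapsTo_zclosure (T := {0}) (fun s hs => subset_zclosure _ (hS s hs)) hw)

theorem zclosure_submodule_subset (p : Submodule ℂ W) {S : Set W} (hS : S ⊆ p) :
    zclosure S ⊆ p := fun w hw => by
  have := (isRegular_linearMap p.mkQ).eq_zero_of_mem_zclosure (S := S)
    (fun s hs => (Submodule.Quotient.mk_eq_zero p).2 (hS hs)) hw
  exact (Submodule.Quotient.mk_eq_zero p).1 this

theorem exists_polynomial_line {f : W → ℂ} (hf : f ∈ polyFun W) (w v : W) :
    ∃ q : Polynomial ℂ, ∀ t : ℂ, f (w + t • v) = q.eval t := by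
  refine Algebra.adjoin_induction
    (p := fun f _ => ∃ q : Polynomial ℂ, ∀ t : ℂ, f (w + t • v) = q.eval t) ?_ ?_ ?_ ?_ hf
  · rintro _ ⟨φ, rfl⟩
    exact ⟨Polynomial.C (φ w) + Polynomial.C (φ v) * Polynomial.X, fun t => by
      simp only [map_add, map_smul, smul_eq_mul, Polynomial.eval_add, Polynomial.eval_mul,
        Polynomial.eval_C, Polynomial.eval_X]
      ring⟩
  · exact fun r => ⟨Polynomial.C r, by simp⟩
  · rintro f g _ _ ⟨p, hp⟩ ⟨q, hq⟩
    exact ⟨p + q, by simp [hp, hq]⟩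
  · rintro f g _ _ ⟨p, hp⟩ ⟨q, hq⟩
    exact ⟨p * q, by simp [hp, hq]⟩

/-- The algebra of polynomial functions is a domain. -/
theorem polyFun_eq_zero_of_mul {f g : W → ℂ} (hf : f ∈ polyFun W) (hg : g ∈ polyFun W)
    (h : ∀ w, f w * g w = 0) {w₀ : W} (hw₀ : g w₀ ≠ 0) (w : W) : f w = 0 := by
  obtain ⟨p, hp⟩ := exists_polynomial_line hf w (w₀ - w)
  obtain ⟨q, hq⟩ := exists_polynomial_line hg w (w₀ - w)
  have h1 : p * q = 0 := Polynomial.funext fun t => by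
    rw [Polynomial.eval_mul, ← hp, ← hq, h, Polynomial.eval_zero]
  rcases mul_eq_zero.1 h1 with h2 | h2
  · simpa [h2] using hp 0
  · exact absurd (by simpa [h2] using hq 1) hw₀

/-- Semicontinuity of the rank. -/
theorem finrank_range_le_of_mem_zclosure [FiniteDimensional ℂ E] [FiniteDimensional ℂ F]
    {T : W → E →ₗ[ℂ] F} (hT : IsRegular (polyFun W) T) {S : Set W} {r : ℕ}
    (hS : ∀ s ∈ S, Module.finrank ℂ (LinearMap.range (T s)) ≤ r) {w : W} (hw : w ∈ zclosure S) :
    Module.finrank ℂ (LinearMap.range (T w)) ≤ r := by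
  by_contra! hr
  set n := Module.finrank ℂ (LinearMap.range (T w)) with hn
  let b := Module.finBasis ℂ (LinearMap.range (T w))
  -- `α` and `β` exhibit `T w` as a map of rank `n`: the composition `β ∘ T w ∘ α` is the identity
  obtain ⟨α', hα⟩ := (T w).rangeRestrict.exists_rightInverse_of_surjective
    (LinearMap.range_rangeRestrict _)
  obtain ⟨β', hβ⟩ := (LinearMap.range (T w)).subtype.exists_leftInverse_of_injective
    (Submodule.ker_subtype _)
  let Q : (E →ₗ[ℂ] F) →ₗ[ℂ] Module.End ℂ (LinearMap.range (T w)) :=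
    (LinearMap.llcomp ℂ _ _ _ β') ∘ₗ (LinearMap.lcomp ℂ F α')
  have hQ : ∀ L, Q L = β' ∘ₗ L ∘ₗ α' := fun L => rfl
  have hQw : Q (T w) = 1 := by
    rw [hQ]
    ext y
    have h1 := LinearMap.congr_fun hα y
    have h2 : T w (α' y) = (LinearMap.range (T w)).subtype y := congrArg Subtype.val h1
    have h3 := LinearMap.congr_fun hβ y
    simp only [LinearMap.comp_apply, h2] at h3 ⊢
    rw [h3]; rfl
  have hdet : LinearMap.det (Q (T w)) = 0 := by
    refine hw _ (hT.linear Q).det fun s hs => ?_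
    by_contra hne
    have hsurj : LinearMap.range (Q (T s)) = ⊤ :=
      LinearMap.range_eq_top.2 ((LinearMap.equivOfDetNeZero _ hne).surjective)
    have h1 : n ≤ Module.finrank ℂ (LinearMap.range (T s)) := by
      calc n = Module.finrank ℂ (LinearMap.range (Q (T s))) := by rw [hsurj, finrank_top]
        _ ≤ Module.finrank ℂ ((LinearMap.range (T s)).map β') := by
          refine Submodule.finrank_mono ?_
          rintro _ ⟨y, rfl⟩
          exact ⟨T s (α' y), ⟨_, rfl⟩, rfl⟩
        _ ≤ _ := Submodule.finrank_map_le _ _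
    exact absurd (h1.trans (hS s hs)) (not_le.2 hr)
  rw [hQw, map_one] at hdet
  exact one_ne_zero hdet

end Closure

/-! ### The Jacobian criterion -/

section Jacobian

open MvPolynomial

variable {ι κ : Type*}

theorem eq_C_of_pderiv_eq_zero {q : MvPolynomial κ ℂ} (h : ∀ k, pderiv k q = 0) :
    q = C (coeff 0 q) := by
  classical
  ext m
  rw [coeff_C]
  split_ifs with hm
  · rw [hm]
  · obtain ⟨k, hk⟩ : ∃ k, m k ≠ 0 := by
      by_contra! h0
      exact hm (Finsupp.ext fun k => (h0 k).symm)
    have h1 := coeff_pderiv (i := k) q (m - Finsupp.single k 1)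
    have h2 : m - Finsupp.single k 1 + Finsupp.single k 1 = m :=
      tsub_add_cancel_of_le (by simpa using Nat.one_le_iff_ne_zero.2 hk)
    rw [h, h2, coeff_zero] at h1
    exact (mul_eq_zero.1 h1.symm).resolve_right (Nat.cast_add_one_ne_zero _)

/-- A finite family of vectors of `ℂ ^ ι` is linearly independent if and only if the linear map
given by the matrix with these rows is surjective. -/
theorem linearIndependent_rows_iff_surjective [Fintype ι] [Finite κ] (v : κ → ι → ℂ) :
    LinearIndependent ℂ v ↔ ∀ b : κ → ℂ, ∃ w : ι → ℂ, ∀ k, ∑ i, v k i * w i = b k := by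
  classical
  have := Fintype.ofFinite κ
  rw [linearIndependent_iff_card_eq_finrank_span, Set.finrank,
    show Set.range v = Set.range (Matrix.of v).row from rfl, ← Matrix.rank_eq_finrank_span_row,
    Matrix.rank, eq_comm, ← Module.finrank_fintype_fun_eq_card (R := ℂ) (η := κ)]
  constructor
  · intro h b
    obtain ⟨w, hw⟩ := LinearMap.range_eq_top.1 (Submodule.eq_top_of_finrank_eq h) b
    exact ⟨w, fun k => congrFun hw k⟩
  · intro h
    rw [LinearMap.range_eq_top.2 fun b => ?_, finrank_top]
    obtain ⟨w, hw⟩ := h b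
    exact ⟨w, funext hw⟩

theorem pderiv_aeval [Fintype κ] (p : κ → MvPolynomial ι ℂ) (i : ι) (q : MvPolynomial κ ℂ) :
    pderiv i (aeval p q) = ∑ k, aeval p (pderiv k q) * pderiv i (p k) := by
  classical
  induction q using MvPolynomial.induction_on with
  | C a => simp
  | add f g hf hg => simp only [map_add, hf, hg, add_mul, Finset.sum_add_distrib]
  | mul_X f j hf =>
    simp only [map_mul, aeval_X, Derivation.leibniz, smul_eq_mul, hf, map_add, add_mul,
      Finset.sum_add_distrib, pderiv_X, Finset.mul_sum]
    rw [add_comm (∑ _, _)]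
    rw [add_comm]
    congr 1
    · refine Finset.sum_congr rfl fun k _ => by ring
    · rw [Finset.sum_eq_single j]
      · simp
      · intro k _ hk
        simp [hk.symm]
      · simp

/-- Polynomials whose differentials are linearly independent at some point are algebraically
independent: the partial derivatives of a relation of minimal degree are relations too. -/
theorem algebraicIndependent_of_linearIndependent_pderiv [Fintype ι] [Fintype κ]
    (p : κ → MvPolynomial ι ℂ) (x : ι → ℂ)
    (hx : LinearIndependent ℂ fun k i => eval x (pderiv i (p k))) :
    AlgebraicIndependent ℂ p := by
  classical
  -- a maximal minor of the Jacobian matrix, after multiplication by a constant matrix, is nonzero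
  choose B hB using fun l : κ =>
    (linearIndependent_rows_iff_surjective _).1 hx (Pi.single l 1)
  have hind : ∀ a : κ → MvPolynomial ι ℂ, (∀ i, ∑ k, a k * pderiv i (p k) = 0) → a = 0 := by
    intro a ha
    let J : Matrix κ κ (MvPolynomial ι ℂ) :=
      Matrix.of fun k l => ∑ i, pderiv i (p k) * C (B l i)
    refine Matrix.eq_zero_of_vecMul_eq_zero (M := J) ?_ ?_
    · intro h0
      have h1 := congrArg (eval x) h0
      rw [RingHom.map_det, map_zero] at h1
      have h2 : (eval x).mapMatrix J = 1 := by
        ext k l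
        simp [J, hB, Matrix.one_apply, Pi.single_apply]
      rw [h2, Matrix.det_one] at h1
      exact one_ne_zero h1
    · ext1 l
      have h1 : ∑ k, a k * ∑ i, pderiv i (p k) * C (B l i) =
          ∑ i, (∑ k, a k * pderiv i (p k)) * C (B l i) := by
        simp only [Finset.mul_sum, Finset.sum_mul, mul_assoc]
        exact Finset.sum_comm
      change ∑ k, a k * ∑ i, pderiv i (p k) * C (B l i) = 0
      rw [h1]
      simp [ha]
  have key : ∀ n : ℕ, ∀ q : MvPolynomial κ ℂ, (∀ m, n < Finsupp.degree m → coeff m q = 0) →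
      aeval p q = 0 → q = 0 := by
    intro n
    induction n with
    | zero =>
      intro q hq h0
      have h1 : q = C (coeff 0 q) := eq_C_of_pderiv_eq_zero fun k => by
        ext m
        rw [coeff_pderiv, hq, zero_mul, coeff_zero]
        simp
      rw [h1, aeval_C] at h0
      rw [h1, (map_eq_zero_iff _ (C_injective ι ℂ)).1 h0, C_0]
    | succ n ih =>
      intro q hq h0
      have h2 : ∀ k, aeval p (pderiv k q) = 0 := congrFun (hind _ fun i => by
        rw [← pderiv_aeval, h0, map_zero])
      have h1 : q = C (coeff 0 q) := eq_C_of_pderiv_eq_zero fun k => ih _ (fun m hm => by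
        rw [coeff_pderiv, hq, zero_mul]
        simpa using hm) (h2 k)
      rw [h1, aeval_C] at h0
      rw [h1, (map_eq_zero_iff _ (C_injective ι ℂ)).1 h0, C_0]
  refine (injective_iff_map_eq_zero _).2 fun q hq => key q.totalDegree q (fun m hm => ?_) hq
  exact coeff_eq_zero_of_totalDegree_lt (f := q) (d := m) hm

theorem pderiv_mem_span_of_mem_adjoin (S : Set (MvPolynomial ι ℂ)) {f : MvPolynomial ι ℂ}
    (hf : f ∈ Algebra.adjoin ℂ S) :
    (fun i => pderiv i f) ∈ Submodule.span (MvPolynomial ι ℂ)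
      ((fun g i => pderiv i g) '' S : Set (ι → MvPolynomial ι ℂ)) := by
  induction hf using Algebra.adjoin_induction with
  | mem x hx => exact Submodule.subset_span ⟨x, hx, rfl⟩
  | algebraMap r =>
    convert Submodule.zero_mem _ using 1
    ext1 i
    exact pderiv_C (σ := ι) (i := i)
  | add f g _ _ hf hg =>
    convert Submodule.add_mem _ hf hg
    ext1 i
    simp
  | mul f g _ _ hf hg =>
    convert Submodule.add_mem _ (Submodule.smul_mem _ f hg) (Submodule.smul_mem _ g hf)
    ext1 i
    simp

/-- If `g` is algebraic over `ℂ[S]`, some nonzero multiple of its differential is a combination of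
the differentials of the elements of `S`: differentiate an equation of minimal degree. -/
theorem exists_smul_pderiv_mem_span (S : Set (MvPolynomial ι ℂ)) (g : MvPolynomial ι ℂ)
    (hg : IsAlgebraic (Algebra.adjoin ℂ S) g) :
    ∃ a : MvPolynomial ι ℂ, a ≠ 0 ∧ (a • fun i => pderiv i g) ∈
      Submodule.span (MvPolynomial ι ℂ)
        ((fun g i => pderiv i g) '' S : Set (ι → MvPolynomial ι ℂ)) := by
  classical
  obtain ⟨n, hn⟩ : ∃ n, ∃ P : Polynomial (Algebra.adjoin ℂ S), P ≠ 0 ∧ Polynomial.aeval g P = 0 ∧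
      P.natDegree = n := by
    obtain ⟨P, h1, h2⟩ := hg
    exact ⟨_, P, h1, h2, rfl⟩
  obtain ⟨P, hP0, hPg, hPn⟩ := Nat.find_spec (⟨n, hn⟩ : ∃ n, ∃ P : Polynomial (Algebra.adjoin ℂ S),
    P ≠ 0 ∧ Polynomial.aeval g P = 0 ∧ P.natDegree = n)
  have hmin : ∀ Q : Polynomial (Algebra.adjoin ℂ S), Q ≠ 0 → Polynomial.aeval g Q = 0 →
      P.natDegree ≤ Q.natDegree := fun Q h1 h2 => by
    rw [hPn]
    exact Nat.find_min' _ ⟨Q, h1, h2, rfl⟩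
  have hdeg : P.natDegree ≠ 0 := by
    intro h0
    rw [Polynomial.eq_C_of_natDegree_eq_zero h0, Polynomial.aeval_C] at hPg
    have h1 : P.coeff 0 = 0 := Subtype.ext hPg
    rw [Polynomial.eq_C_of_natDegree_eq_zero h0, h1, Polynomial.C_0] at hP0
    exact hP0 rfl
  refine ⟨Polynomial.aeval g P.derivative, ?_, ?_⟩
  · intro h0
    have h1 : P.derivative ≠ 0 := by
      intro h
      exact hdeg (Polynomial.derivative_eq_zero.1 h)
    exact absurd (hmin _ h1 h0) (not_le.2 (Polynomial.natDegree_derivative_lt hdeg))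
  · have h1 : ∀ Q : Polynomial (Algebra.adjoin ℂ S), (fun i => pderiv i (Polynomial.aeval g Q)) -
        (Polynomial.aeval g Q.derivative • fun i => pderiv i g) ∈ Submodule.span (MvPolynomial ι ℂ)
        ((fun g i => pderiv i g) '' S : Set (ι → MvPolynomial ι ℂ)) := by
      intro Q
      induction Q using Polynomial.induction_on' with
      | add Q R hQ hR =>
        convert Submodule.add_mem _ hQ hR using 1
        ext1 i
        simp
        ring
      | monomial n a =>
        convert Submodule.smul_mem _ (g ^ n) (pderiv_mem_span_of_mem_adjoin S a.2) using 1
        ext1 i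
        have : algebraMap (Algebra.adjoin ℂ S) (MvPolynomial ι ℂ) a = a.1 := rfl
        simp [Polynomial.aeval_monomial, Polynomial.derivative_monomial, Derivation.leibniz_pow,
            this]
        ring
    have h2 := Submodule.neg_mem _ (h1 P)
    rw [hPg] at h2
    convert h2 using 1
    ext1 i
    simp

/-- The converse: the differentials of algebraically independent polynomials are linearly
independent at some point. One extends the polynomials to a transcendence basis; since the variables
are algebraic over it, its differentials span the space of all differentials at a general point, and
there are as many of them as there are variables. -/
theorem exists_linearIndependent_pderiv_of_algebraicIndependent {ι κ : Type} [Finite ι]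
    {p : κ → MvPolynomial ι ℂ} (hp : AlgebraicIndependent ℂ p) :
    ∃ x : ι → ℂ, LinearIndependent ℂ fun k i => eval x (pderiv i (p k)) := by
  classical
  have := Fintype.ofFinite ι
  obtain ⟨S, hpS, hS⟩ := exists_isTranscendenceBasis_superset
    ((algebraicIndependent_subtype_range hp.injective).2 hp)
  have hX : IsTranscendenceBasis ℂ (X : ι → MvPolynomial ι ℂ) := IsTranscendenceBasis.mvPolynomial
      ι ℂ
  have hcard := hX.cardinalMk_eq hS
  have hfin : Finite S := by
    rw [← Cardinal.lt_aleph0_iff_finite, ← hcard]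
    exact Cardinal.lt_aleph0_of_finite ι
  have := Fintype.ofFinite S
  have halg := hS.isAlgebraic
  rw [Subtype.range_coe] at halg
  choose a ha0 ha using fun j : ι => exists_smul_pderiv_mem_span S (X j) (halg.isAlgebraic (X j))
  obtain ⟨x, hx⟩ : ∃ x : ι → ℂ, eval x (∏ j, a j) ≠ 0 := by
    by_contra! h
    have h1 : ∏ j, a j = 0 := MvPolynomial.funext fun x => by rw [h, map_zero]
    exact Finset.prod_ne_zero_iff.2 (fun j _ => ha0 j) h1
  rw [map_prod, Finset.prod_ne_zero_iff] at hx
  have hev : ∀ v ∈ Submodule.span (MvPolynomial ι ℂ)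
        ((fun g i => pderiv i g) '' S : Set (ι → MvPolynomial ι ℂ)),
      (fun i => eval x (v i)) ∈ Submodule.span ℂ
        (Set.range fun (s : S) i => eval x (pderiv i (s : MvPolynomial ι ℂ))) := by
    intro v hv
    induction hv using Submodule.span_induction with
    | mem v hv =>
      obtain ⟨s, hs, rfl⟩ := hv
      exact Submodule.subset_span ⟨⟨s, hs⟩, rfl⟩
    | zero =>
      simp only [Pi.zero_apply, map_zero]
      exact Submodule.zero_mem _
    | add v w _ _ hv hw =>
      simp only [Pi.add_apply, map_add]
      exact Submodule.add_mem _ hv hw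
    | smul c v _ hv =>
      simp only [Pi.smul_apply, smul_eq_mul, map_mul]
      exact Submodule.smul_mem _ (eval x c) hv
  have hspan : ⊤ ≤ Submodule.span ℂ
      (Set.range fun (s : S) i => eval x (pderiv i (s : MvPolynomial ι ℂ))) := by
    rw [← (Pi.basisFun ℂ ι).span_eq, Submodule.span_le]
    rintro _ ⟨j, rfl⟩
    have h1 := Submodule.smul_mem _ (eval x (a j))⁻¹ (hev _ (ha j))
    have h2 : Pi.basisFun ℂ ι j = (eval x (a j))⁻¹ • fun i => eval x ((a j • fun i =>
        pderiv i (X j : MvPolynomial ι ℂ)) i) := by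
      ext1 i
      by_cases hij : j = i
      · subst hij
        simp [hx j (Finset.mem_univ _)]
      · simp [hij, Ne.symm hij]
    rw [h2]
    exact h1
  have hli := linearIndependent_of_top_le_span_of_card_eq_finrank hspan (by
    rw [Module.finrank_fintype_fun_eq_card, ← Nat.card_eq_fintype_card, ← Nat.card_eq_fintype_card]
    exact (congrArg Cardinal.toNat hcard).symm)
  exact ⟨x, hli.comp (fun k => ⟨p k, hpS ⟨k, rfl⟩⟩) fun k l hkl =>
    hp.injective (congrArg Subtype.val hkl)⟩

theorem hasDerivAt_eval_line [Fintype ι] (q : MvPolynomial ι ℂ) (x y : ι → ℂ) :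
    HasDerivAt (fun t : ℂ => eval (fun i => x i + t * y i) q)
      (∑ i, eval x (pderiv i q) * y i) 0 := by
  classical
  induction q using MvPolynomial.induction_on with
  | C a => simpa using hasDerivAt_const (0 : ℂ) a
  | add f g hf hg =>
    simp only [map_add, add_mul, Finset.sum_add_distrib]
    exact hf.add hg
  | mul_X f j hf =>
    have h1 : HasDerivAt (fun t : ℂ => x j + t * y j) (y j) 0 := by
      simpa using ((hasDerivAt_id (0 : ℂ)).mul_const (y j)).const_add (x j)
    have h2 := hf.mul h1
    simp only [map_mul, eval_X]
    refine h2.congr_deriv (Eq.symm ?_)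
    simp only [zero_mul, add_zero, Derivation.leibniz, smul_eq_mul, map_add, map_mul, eval_X,
      add_mul, Finset.sum_add_distrib, Finset.sum_mul]
    rw [add_comm]
    congr 1
    · exact Finset.sum_congr rfl fun i _ => by ring
    · rw [Finset.sum_eq_single j]
      · simp
      · intro i _ hi
        simp [pderiv_X, Ne.symm hi]
      · simp

theorem eval_aeval_eq (p : κ → MvPolynomial ι ℂ) (q : MvPolynomial κ ℂ) (z : ι → ℂ) :
    eval z (aeval p q) = eval (fun k => eval z (p k)) q := by
  induction q using MvPolynomial.induction_on with
  | C a => simp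
  | add f g hf hg => simp only [map_add, hf, hg]
  | mul_X f j hf => simp only [map_mul, aeval_X, eval_X, hf]

section Basis

variable {E P : Type*} [AddCommGroup E] [Module ℂ E] [AddCommGroup P] [Module ℂ P]

theorem exists_mvPolynomial_of_mem_polyFun [Fintype ι] (b : Module.Basis ι ℂ E) {f : E → ℂ}
    (hf : f ∈ polyFun E) : ∃ q : MvPolynomial ι ℂ, ∀ w, f w = eval (fun i => b.coord i w) q := by
  refine Algebra.adjoin_induction (p := fun f _ => ∃ q : MvPolynomial ι ℂ, ∀ w,
    f w = eval (fun i => b.coord i w) q) ?_ ?_ ?_ ?_ hf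
  · rintro _ ⟨φ, rfl⟩
    refine ⟨∑ i, C (φ (b i)) * X i, fun w => ?_⟩
    change φ w = _
    conv_lhs => rw [← b.sum_repr w, map_sum]
    simp [mul_comm]
  · exact fun r => ⟨C r, by simp⟩
  · rintro f g _ _ ⟨p, hp⟩ ⟨q, hq⟩
    exact ⟨p + q, by simp [hp, hq]⟩
  · rintro f g _ _ ⟨p, hp⟩ ⟨q, hq⟩
    exact ⟨p * q, by simp [hp, hq]⟩

theorem eval_coord_mem_polyFun (b : Module.Basis ι ℂ E) (q : MvPolynomial ι ℂ) :
    (fun w => eval (fun i => b.coord i w) q) ∈ polyFun E := by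
  induction q using MvPolynomial.induction_on with
  | C a =>
    simp only [eval_C]
    exact (polyFun E).algebraMap_mem a
  | add f g hf hg =>
    simp only [map_add]
    exact (polyFun E).add_mem hf hg
  | mul_X f j hf =>
    simp only [map_mul, eval_X]
    exact (polyFun E).mul_mem hf (isRegular_linearMap LinearMap.id (b.coord j))

/-- A regular map between complex vector spaces is dominant if and only if its differential is
surjective at some point. -/
theorem dominant_iff_exists_surjective_deriv [FiniteDimensional ℂ E] [FiniteDimensional ℂ P]
    {φ : P → E} (hφ : IsRegular (polyFun P) φ) (dφ : P → P → E)
    (hd : ∀ x y, ∀ ψ : Module.Dual ℂ E, HasDerivAt (fun t : ℂ => ψ (φ (x + t • y))) (ψ (dφ x y))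
        0) :
    (∀ w, w ∈ zclosure (Set.range φ)) ↔ ∃ x, Function.Surjective (dφ x) := by
  let b := Module.finBasis ℂ P
  let c := Module.finBasis ℂ E
  choose p hp using fun k => exists_mvPolynomial_of_mem_polyFun b (hφ (c.coord k))
  have hdp : ∀ x y k, c.coord k (dφ x y) =
      ∑ i, eval (fun i => b.coord i x) (pderiv i (p k)) * b.coord i y := by
    intro x y k
    have h1 := hd x y (c.coord k)
    have h2 := hasDerivAt_eval_line (p k) (fun i => b.coord i x) (fun i => b.coord i y)
    refine h1.unique ?_
    have h3 : (fun t : ℂ => c.coord k (φ (x + t • y))) =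
        fun t => eval (fun i => b.coord i x + t * b.coord i y) (p k) := by
      ext t
      rw [hp]
      simp
    rw [h3]
    exact h2
  have h1 : (∀ w, w ∈ zclosure (Set.range φ)) ↔ AlgebraicIndependent ℂ p := by
    constructor
    · intro h
      refine (injective_iff_map_eq_zero _).2 fun q hq => MvPolynomial.funext fun z => ?_
      have h2 := h (c.equivFun.symm z) _ (eval_coord_mem_polyFun c q) (by
        rintro _ ⟨x, rfl⟩
        have h3 := congrArg (eval fun i => b.coord i x) hq
        rw [map_zero] at h3
        rw [← h3, eval_aeval_eq]
        simp only [hp])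
      simpa only [Module.Basis.coord_equivFun_symm, map_zero] using h2
    · intro h w f hf hfφ
      obtain ⟨q, hq⟩ := exists_mvPolynomial_of_mem_polyFun c hf
      have hq0 : aeval p q = 0 := MvPolynomial.funext fun z => by
        have h2 := hfφ _ ⟨b.equivFun.symm z, rfl⟩
        rw [hq] at h2
        simp only [hp, Module.Basis.coord_equivFun_symm] at h2
        rw [map_zero, ← h2, eval_aeval_eq]
      rw [hq, (injective_iff_map_eq_zero _).1 h q hq0, map_zero]
  rw [h1]
  have h2 : AlgebraicIndependent ℂ p ↔
      ∃ x : Fin (Module.finrank ℂ P) → ℂ, LinearIndependent ℂ fun k i => eval x (pderiv i (p k)) :=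
    ⟨exists_linearIndependent_pderiv_of_algebraicIndependent,
      fun ⟨x, hx⟩ => algebraicIndependent_of_linearIndependent_pderiv p x hx⟩
  rw [h2]
  simp only [linearIndependent_rows_iff_surjective]
  constructor
  · rintro ⟨x, hx⟩
    refine ⟨b.equivFun.symm x, fun w => ?_⟩
    obtain ⟨y, hy⟩ := hx (c.equivFun w)
    refine ⟨b.equivFun.symm y, c.ext_elem fun k => ?_⟩
    have := hdp (b.equivFun.symm x) (b.equivFun.symm y) k
    simp only [Module.Basis.coord_equivFun_symm] at this
    rw [hy] at this
    exact this
  · rintro ⟨x, hx⟩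
    refine ⟨fun i => b.coord i x, fun z => ?_⟩
    obtain ⟨y, hy⟩ := hx (c.equivFun.symm z)
    refine ⟨fun i => b.coord i y, fun k => ?_⟩
    rw [← hdp, hy, Module.Basis.coord_equivFun_symm]

end Basis

end Jacobian

/-! ### Conjugation and block triangular elements in a finite dimensional algebra -/

section Algebra

variable {𝓔 : Type*} [Ring 𝓔]

/-- The set of all conjugates `g c g⁻¹`, for the invertible elements `g` of `H`, and for `c ∈ S`.
The inverse of `g` is denoted by `h`. -/
def conjSet (H S : Set 𝓔) : Set 𝓔 :=
  {T | ∃ g h, g ∈ H ∧ g * h = 1 ∧ h * g = 1 ∧ ∃ c ∈ S, T = g * c * h}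

/-- The analogue of `conjSet` for pairs, under simultaneous conjugation. -/
def conjPair (H : Set 𝓔) (S : Set (𝓔 × 𝓔)) : Set (𝓔 × 𝓔) :=
  {T | ∃ g h, g ∈ H ∧ g * h = 1 ∧ h * g = 1 ∧ ∃ p ∈ S, T = (g * p.1 * h, g * p.2 * h)}

theorem conjSet_mono {H H' S S' : Set 𝓔} (h : H ⊆ H') (h' : S ⊆ S') :
    conjSet H S ⊆ conjSet H' S' := by
  rintro _ ⟨g, k, hg, h1, h2, c, hc, rfl⟩
  exact ⟨g, k, h hg, h1, h2, c, h' hc, rfl⟩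

variable [Algebra ℂ 𝓔]

/-- For an idempotent `e`, the subalgebra of the elements `m` of `M` with `e m (1 - e) = 0`. The
elements with `(1 - e) m e = 0` form the subalgebra attached to `1 - e`. -/
def triang (M : Subalgebra ℂ 𝓔) {e : 𝓔} (he : IsIdempotentElem e) : Subalgebra ℂ 𝓔 where
  carrier := {m | m ∈ M ∧ e * m * e = e * m}
  mul_mem' := by
    rintro m n ⟨hm, h1⟩ ⟨hn, h2⟩
    refine ⟨M.mul_mem hm hn, ?_⟩
    linear_combination (norm := noncomm_ring) -h1 * n * e + e * m * h2 + h1 * n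
  add_mem' := by
    rintro m n ⟨hm, h1⟩ ⟨hn, h2⟩
    exact ⟨M.add_mem hm hn, by rw [mul_add, add_mul, h1, h2]⟩
  algebraMap_mem' r := ⟨M.algebraMap_mem r, by
    rw [← Algebra.commutes, mul_assoc, he.eq]⟩

variable {M : Subalgebra ℂ 𝓔} {e : 𝓔} (he : IsIdempotentElem e)

theorem mem_triang_one_sub {m : 𝓔} :
    m ∈ triang M he.one_sub ↔ m ∈ M ∧ e * m * e = m * e := by
  refine and_congr_right fun _ => ⟨fun h => ?_, fun h => ?_⟩
  · linear_combination (norm := noncomm_ring) h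
  · linear_combination (norm := noncomm_ring) h

/-- The elements `u` of `M` with `u = e u (1 - e)`. -/
def offDiag (M : Subalgebra ℂ 𝓔) (e : 𝓔) : Submodule ℂ 𝓔 where
  carrier := {u | u ∈ M ∧ e * u = u ∧ u * e = 0}
  add_mem' := by
    rintro u v ⟨h1, h2, h3⟩ ⟨h4, h5, h6⟩
    exact ⟨M.add_mem h1 h4, by rw [mul_add, h2, h5], by rw [add_mul, h3, h6, add_zero]⟩
  zero_mem' := ⟨M.zero_mem, by simp, by simp⟩
  smul_mem' := by
    rintro c u ⟨h1, h2, h3⟩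
    exact ⟨M.smul_mem h1 c, by rw [mul_smul_comm, h2], by rw [smul_mul_assoc, h3, smul_zero]⟩

theorem mul_eq_zero_of_mem_offDiag {u v : 𝓔} (hu : u ∈ offDiag M e) (hv : v ∈ offDiag M e) :
    u * v = 0 := by
  rw [← hv.2.1, ← mul_assoc, hu.2.2, zero_mul]

/-- The unipotent group of all `1 + u`, `u = e u (1 - e) ∈ M`. -/
def unipSet (M : Subalgebra ℂ 𝓔) (e : 𝓔) : Set 𝓔 := {g | ∃ u ∈ offDiag M e, g = 1 + u}

theorem one_add_mul_one_sub {u : 𝓔} (hu : u ∈ offDiag M e) : (1 + u) * (1 - u) = 1 := by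
  linear_combination (norm := noncomm_ring) -mul_eq_zero_of_mem_offDiag hu hu

theorem one_sub_mul_one_add {u : 𝓔} (hu : u ∈ offDiag M e) : (1 - u) * (1 + u) = 1 := by
  linear_combination (norm := noncomm_ring) -mul_eq_zero_of_mem_offDiag hu hu

theorem mem_conjSet_unipSet {S : Set 𝓔} {T : 𝓔} :
    T ∈ conjSet (unipSet M e) S ↔ ∃ u ∈ offDiag M e, ∃ c ∈ S, T = (1 + u) * c * (1 - u) := by
  constructor
  · rintro ⟨_, h, ⟨u, hu, rfl⟩, h1, h2, c, hc, rfl⟩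
    refine ⟨u, hu, c, hc, ?_⟩
    suffices h = 1 - u by rw [this]
    calc h = (1 - u) * (1 + u) * h := by rw [one_sub_mul_one_add hu, one_mul]
      _ = 1 - u := by rw [mul_assoc, h1, mul_one]
  · rintro ⟨u, hu, c, hc, rfl⟩
    exact ⟨1 + u, 1 - u, ⟨u, hu, rfl⟩, one_add_mul_one_sub hu, one_sub_mul_one_add hu, c, hc, rfl⟩

theorem unipSet_subset (M : Subalgebra ℂ 𝓔) (e : 𝓔) : unipSet M e ⊆ M := by
  rintro _ ⟨u, hu, rfl⟩
  exact M.add_mem M.one_mem hu.1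

theorem unipSet_subset_triang : unipSet M e ⊆ triang M he.one_sub := by
  rintro _ ⟨u, hu, rfl⟩
  refine (mem_triang_one_sub he).2 ⟨unipSet_subset M e ⟨u, hu, rfl⟩, ?_⟩
  linear_combination (norm := noncomm_ring) he.eq + hu.2.1 * e

theorem det_mulLeft_ne_zero {g h : 𝓔} (hgh : g * h = 1) :
    LinearMap.det (LinearMap.mulLeft ℂ g) ≠ 0 := by
  intro h0
  have h1 : LinearMap.mulLeft ℂ g * LinearMap.mulLeft ℂ h = 1 := by
    ext x
    change g * (h * x) = x
    rw [← mul_assoc, hgh, one_mul]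
  have h2 := congrArg LinearMap.det h1
  rw [map_mul, h0, zero_mul, map_one] at h2
  exact zero_ne_one h2

variable [FiniteDimensional ℂ 𝓔]

/-- An analogue of the adjugate matrix in a finite dimensional algebra. -/
noncomputable def algAdj (g : 𝓔) : 𝓔 := endAdj (LinearMap.mulLeft ℂ g) 1

theorem mul_algAdj (g : 𝓔) : g * algAdj g = LinearMap.det (LinearMap.mulLeft ℂ g) • (1 : 𝓔) := by
  have h := LinearMap.congr_fun (mul_endAdj (LinearMap.mulLeft ℂ g)) 1
  exact h

theorem algAdj_one : algAdj (1 : 𝓔) = 1 := by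
  rw [algAdj, LinearMap.mulLeft_one]
  exact LinearMap.congr_fun endAdj_one 1

theorem IsRegular.det_mulLeft {X : Type*} {𝒜 : Subalgebra ℂ (X → ℂ)} {Φ : X → 𝓔}
    (h : IsRegular 𝒜 Φ) : (fun x => LinearMap.det (LinearMap.mulLeft ℂ (Φ x))) ∈ 𝒜 :=
  (h.linear (LinearMap.mul ℂ 𝓔)).det

theorem IsRegular.algAdj {X : Type*} {𝒜 : Subalgebra ℂ (X → ℂ)} {Φ : X → 𝓔}
    (h : IsRegular 𝒜 Φ) : IsRegular 𝒜 (fun x => algAdj (Φ x)) :=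
  (h.linear (LinearMap.mul ℂ 𝓔)).endAdj.linear (LinearMap.applyₗ 1)

theorem exists_inv_of_det_mulLeft_ne_zero {g : 𝓔}
    (hg : LinearMap.det (LinearMap.mulLeft ℂ g) ≠ 0) :
    ∃ h, g * h = 1 ∧ h * g = 1 ∧ algAdj g = LinearMap.det (LinearMap.mulLeft ℂ g) • h := by
  have hinj := (LinearMap.equivOfDetNeZero _ hg).injective
  have h1 : g * ((LinearMap.det (LinearMap.mulLeft ℂ g))⁻¹ • algAdj g) = 1 := by
    rw [mul_smul_comm, mul_algAdj, inv_smul_smul₀ hg]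
  refine ⟨_, h1, hinj ?_, (smul_inv_smul₀ hg _).symm⟩
  change g * (_ * g) = g * 1
  rw [← mul_assoc, h1, one_mul, mul_one]

/-- A subalgebra of a finite dimensional algebra contains the inverses of its elements. -/
theorem inv_mem_subalgebra (M : Subalgebra ℂ 𝓔) {g h : 𝓔} (hg : g ∈ M)
    (h2 : h * g = 1) : h ∈ M := by
  let T : M →ₗ[ℂ] M := LinearMap.mulLeft ℂ ⟨g, hg⟩
  have hinj : Function.Injective T := by
    intro x y hxy
    have h3 : g * x = g * y := congrArg Subtype.val hxy
    have h4 := congrArg (h * ·) h3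
    simp only [← mul_assoc, h2, one_mul] at h4
    exact Subtype.ext h4
  obtain ⟨k, hk⟩ := LinearMap.injective_iff_surjective.1 hinj 1
  have h3 : g * k = 1 := congrArg Subtype.val hk
  have h4 : h = k := by rw [← mul_one h, ← h3, ← mul_assoc, h2, one_mul]
  rw [h4]
  exact k.2

/-- The big cell: an element of `M` whose `1 - e` block is invertible is the product of an element
of the unipotent group and of a block triangular element. -/
theorem exists_unip_mul_triang (heM : e ∈ M) {m n k : 𝓔} (hm : m ∈ M) (hmn : m * n = 1)
    (hnm : n * m = 1)
    (hk' : k * (e + (1 - e) * m * (1 - e)) = 1) :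
    ∃ u ∈ offDiag M e, ∃ p ∈ triang M he, ∃ q ∈ triang M he, m = (1 + u) * p ∧
      p * q = 1 ∧ q * p = 1 ∧ n = q * (1 - u) := by
  have hee := he.eq
  have heM' : 1 - e ∈ M := M.sub_mem M.one_mem heM
  have hkM : k ∈ M := inv_mem_subalgebra M
    (M.add_mem heM (M.mul_mem (M.mul_mem heM' hm) heM')) hk'
  -- `k` commutes with `e`
  have hke : k * e = e := by
    have h1 : (e + (1 - e) * m * (1 - e)) * e = e := by
      linear_combination (norm := noncomm_ring) hee - (1 - e) * m * hee
    calc k * e = k * ((e + (1 - e) * m * (1 - e)) * e) := by rw [h1]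
      _ = e := by rw [← mul_assoc, hk', one_mul]
  have hu : e * m * (1 - e) * k ∈ offDiag M e := by
    refine ⟨M.mul_mem (M.mul_mem (M.mul_mem heM hm) heM') hkM, ?_, ?_⟩
    · linear_combination (norm := noncomm_ring) hee * m * (1 - e) * k
    · linear_combination (norm := noncomm_ring) e * m * (1 - e) * hke - e * m * hee
  set u := e * m * (1 - e) * k with hudef
  have hp : (1 - u) * m ∈ triang M he := by
    refine ⟨M.mul_mem (M.sub_mem M.one_mem hu.1) hm, ?_⟩
    have h1 : u * (1 - e) * m * (1 - e) = e * m * (1 - e) := by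
      have h2 : u * (e + (1 - e) * m * (1 - e)) = e * m * (1 - e) := by
        rw [hudef, mul_assoc, hk', mul_one]
      linear_combination (norm := noncomm_ring) h2 - hu.2.2
    linear_combination (norm := noncomm_ring) h1 + hu.2.2 * m * (1 - e) + hu.2.1 * m * (1 - e)
  refine ⟨u, hu, (1 - u) * m, hp, n * (1 + u), ?_, ?_, ?_, ?_, ?_⟩
  · refine inv_mem_subalgebra _ hp ?_
    rw [mul_assoc, ← mul_assoc (1 + u), one_add_mul_one_sub hu, one_mul, hnm]
  · rw [← mul_assoc, one_add_mul_one_sub hu, one_mul]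
  · rw [mul_assoc, ← mul_assoc m, hmn, one_mul, one_sub_mul_one_add hu]
  · rw [mul_assoc, ← mul_assoc (1 + u), one_add_mul_one_sub hu, one_mul, hnm]
  · rw [mul_assoc, one_add_mul_one_sub hu, mul_one]

/-- For a subspace `D` stable under the group of invertible block triangular elements, the
conjugates of `D` under all invertible elements of `M` lie in the closure of the conjugates under
the unipotent group, because the big cell is dense. -/
theorem conjSet_subset_zclosure_unipSet (heM : e ∈ M) (D : Submodule ℂ 𝓔)
    (hD : ∀ p ∈ triang M he, ∀ q ∈ triang M he, ∀ d ∈ D, p * d * q ∈ D) :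
    conjSet (M : Set 𝓔) D ⊆ zclosure (conjSet (unipSet M e) D) := by
  rintro _ ⟨g, h, hg, hgh, hhg, c, hc, rfl⟩ f hf hfD
  let δ : 𝓔 → ℂ := fun m => LinearMap.det (LinearMap.mulLeft ℂ m)
  let blk : 𝓔 → 𝓔 := fun m => e + (1 - e) * m * (1 - e)
  have hδg : δ g ≠ 0 := det_mulLeft_ne_zero hgh
  let c' : 𝓔 := (δ g)⁻¹ • c
  have hc' : c' ∈ D := D.smul_mem _ hc
  have hval : IsRegular (polyFun M) (fun m : M => (m : 𝓔)) := isRegular_linearMap M.val.toLinearMap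
  have hblk : IsRegular (polyFun M) (fun m : M => blk m) :=
    (isRegular_const e).add (((isRegular_const (1 - e)).mul hval).mul (isRegular_const (1 - e)))
  have hF : (fun m : M => f (m * c' * algAdj (m : 𝓔))) ∈ polyFun M :=
    ((hval.mul (isRegular_const c')).mul hval.algAdj).polyFun_comp hf
  have hG : (fun m : M => δ m * δ (blk m)) ∈ polyFun M :=
    (polyFun M).mul_mem hval.det_mulLeft hblk.det_mulLeft
  have hblk1 : blk 1 = 1 := by
    change e + (1 - e) * 1 * (1 - e) = 1
    linear_combination (norm := noncomm_ring) he.eq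
  have hδ1 : δ 1 = 1 := by
    change LinearMap.det (LinearMap.mulLeft ℂ (1 : 𝓔)) = 1
    rw [LinearMap.mulLeft_one, LinearMap.det_id]
  have key := polyFun_eq_zero_of_mul hF hG (fun m => ?_) (w₀ := 1) (by
    change δ 1 * δ (blk 1) ≠ 0
    rw [hblk1, hδ1]
    simp) ⟨g, hg⟩
  · obtain ⟨h', h1, h2, h3⟩ := exists_inv_of_det_mulLeft_ne_zero hδg
    have h4 : h' = h := by rw [← one_mul h', ← hhg, mul_assoc, h1, mul_one]
    have h5 : g * c' * algAdj g = g * c * h := by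
      rw [h3, h4]
      simp only [c', mul_smul_comm, smul_mul_assoc]
      exact smul_inv_smul₀ hδg _
    rw [← h5]
    exact key
  · by_cases hm : δ m = 0
    · simp [hm]
    by_cases hm' : δ (blk m) = 0
    · simp [hm']
    obtain ⟨n, h1, h2, h3⟩ := exists_inv_of_det_mulLeft_ne_zero hm
    obtain ⟨k, -, h5, -⟩ := exists_inv_of_det_mulLeft_ne_zero hm'
    obtain ⟨u, hu, p, hp, q, hq, hmu, -, -, hn⟩ :=
      exists_unip_mul_triang he heM m.2 h1 h2 h5
    rw [hfD _ (mem_conjSet_unipSet.2 ⟨u, hu, δ m • (p * c' * q),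
      D.smul_mem _ (hD p hp q hq c' hc'), ?_⟩), zero_mul]
    rw [h3, hn]
    have h6 : (m : 𝓔) * c' * (q * (1 - u)) = (1 + u) * (p * c' * q) * (1 - u) := by
      rw [hmu]
      simp only [mul_assoc]
    rw [mul_smul_comm, h6, mul_smul_comm (δ m), smul_mul_assoc (δ m)]

/-- The Levi decomposition of the parabolic group: for a set `D` stable under conjugation by block
diagonal elements, the parabolic and the unipotent group have the same conjugates of `D`. -/
theorem conjSet_triang_eq_unipSet (heM : e ∈ M) (D : Set 𝓔)
    (hD : ∀ l ∈ M, ∀ k ∈ M, e * l = l * e → e * k = k * e → ∀ d ∈ D, l * d * k ∈ D) :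
    conjSet (triang M he.one_sub : Set 𝓔) D = conjSet (unipSet M e) D := by
  have hee := he.eq
  refine Set.Subset.antisymm ?_ (conjSet_mono (unipSet_subset_triang he) subset_rfl)
  rintro _ ⟨p, q, hp, hpq, hqp, d, hd, rfl⟩
  have hq := inv_mem_subalgebra _ hp hqp
  obtain ⟨hpM, hp⟩ := (mem_triang_one_sub he).1 hp
  obtain ⟨hqM, hq⟩ := (mem_triang_one_sub he).1 hq
  have heM' : 1 - e ∈ M := M.sub_mem M.one_mem heM
  rw [mem_conjSet_unipSet]
  have hl : ∀ m ∈ M, e * m * e + (1 - e) * m * (1 - e) ∈ M := fun m hm =>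
    M.add_mem (M.mul_mem (M.mul_mem heM hm) heM) (M.mul_mem (M.mul_mem heM' hm) heM')
  have hl' : ∀ m, e * (e * m * e + (1 - e) * m * (1 - e)) =
      (e * m * e + (1 - e) * m * (1 - e)) * e := fun m => by
    linear_combination (norm := noncomm_ring) hee * m * e - hee * m * (1 - e) - e * m * hee
      + (1 - e) * m * hee
  have hu : e * p * (1 - e) * q * (1 - e) ∈ offDiag M e := by
    refine ⟨M.mul_mem (M.mul_mem (M.mul_mem (M.mul_mem heM hpM) heM') hqM) heM', ?_, ?_⟩
    · linear_combination (norm := noncomm_ring) hee * p * (1 - e) * q * (1 - e)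
    · linear_combination (norm := noncomm_ring) - e * p * (1 - e) * q * hee
  set u := e * p * (1 - e) * q * (1 - e) with hudef
  have hA : (1 - e) * q * (1 - e) * p * (1 - e) = 1 - e := by
    linear_combination (norm := noncomm_ring) (1 - e) * hqp * (1 - e) + hq * p * (1 - e) + hee
  have hB : (1 - e) * p * (1 - e) * q * (1 - e) = 1 - e := by
    linear_combination (norm := noncomm_ring) (1 - e) * hpq * (1 - e) + hp * q * (1 - e) + hee
  have h1 : p = (1 + u) * (e * p * e + (1 - e) * p * (1 - e)) := by
    have h3 : u * (1 - e) * p * (1 - e) = e * p * (1 - e) := by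
      linear_combination (norm := noncomm_ring) e * p * hA +
        e * p * (1 - e) * q * hee * p * (1 - e) + hudef * (1 - e) * p * (1 - e)
    linear_combination (norm := noncomm_ring) -h3 - hu.2.2 * p * e - hp
  have h2 : q = (e * q * e + (1 - e) * q * (1 - e)) * (1 - u) := by
    have h3 : e * q * e * p * (1 - e) = -(e * q * (1 - e) * p * (1 - e)) := by
      linear_combination (norm := noncomm_ring) e * hqp * (1 - e) - hee
    have h4 : e * q * e * u = -(e * q * (1 - e)) := by
      linear_combination (norm := noncomm_ring) e * q * hee * p * (1 - e) * q * (1 - e) +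
        h3 * q * (1 - e) - e * q * hB + e * q * e * hudef
    linear_combination (norm := noncomm_ring) h4 - (1 - e) * q * hu.2.1 - hq
  refine ⟨_, hu, _, hD _ (hl p hpM) _ (hl q hqM) (hl' p) (hl' q) d hd, ?_⟩
  conv_lhs => rw [h1, h2]
  simp only [mul_assoc]

end Algebra

/-! ### Density of the conjugates under the unipotent group -/

section UnipDense

theorem mem_zclosure_submodule_iff {W : Type*} [AddCommGroup W] [Module ℂ W] (p : Submodule ℂ W)
    (S : Set p) (w : p) : w ∈ zclosure S ↔ (w : W) ∈ zclosure (Subtype.val '' S) := by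
  constructor
  · intro hw
    exact (isRegular_linearMap p.subtype).mapsTo_zclosure
      (T := Subtype.val '' S) (fun s hs => subset_zclosure _ ⟨s, hs, rfl⟩) hw
  · intro hw
    obtain ⟨r, hr⟩ := p.subtype.exists_leftInverse_of_injective (Submodule.ker_subtype _)
    have hr' : ∀ x : p, r x = x := fun x => LinearMap.congr_fun hr x
    have := (isRegular_linearMap r).mapsTo_zclosure (S := Subtype.val '' S) (T := S) (by
      rintro _ ⟨s, hs, rfl⟩
      rw [hr']
      exact subset_zclosure _ hs) hw
    rwa [hr'] at this

theorem IsRegular.codRestrict {X W : Type*} [AddCommGroup W] [Module ℂ W]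
    {𝒜 : Subalgebra ℂ (X → ℂ)} (p : Submodule ℂ W) {Φ : X → p}
    (h : IsRegular 𝒜 (fun x => (Φ x : W))) : IsRegular 𝒜 Φ := fun φ => by
  obtain ⟨ψ, hψ⟩ := φ.exists_extend
  convert h ψ using 2 with x
  rw [← hψ]
  rfl

theorem hasDerivAt_cubic {W : Type*} [AddCommGroup W] [Module ℂ W] (ψ : Module.Dual ℂ W)
    (a b c d : W) :
    HasDerivAt (fun t : ℂ => ψ (a + t • b + t ^ 2 • c + t ^ 3 • d)) (ψ b) 0 := by
  simp only [map_add, map_smul, smul_eq_mul]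
  have h1 : HasDerivAt (fun t : ℂ => ψ a + t * ψ b + t ^ 2 * ψ c + t ^ 3 * ψ d)
      (0 + 1 * ψ b + (2 * 0 ^ 1 * 1) * ψ c + (3 * 0 ^ 2 * 1) * ψ d) 0 :=
    ((((hasDerivAt_const (0 : ℂ) (ψ a)).add ((hasDerivAt_id (0 : ℂ)).mul_const _)).add
      (((hasDerivAt_id (0 : ℂ)).pow 2).mul_const _)).add
      (((hasDerivAt_id (0 : ℂ)).pow 3).mul_const _))
  convert h1 using 1
  simp

variable {𝓔 : Type*} [Ring 𝓔] [Algebra ℂ 𝓔] [FiniteDimensional ℂ 𝓔] {M : Subalgebra ℂ 𝓔} {e : 𝓔}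

/-- The conjugates under the unipotent group of a complement `D` of the upper right block of `E`
are dense in `E` if and only if the map `(u, d) ↦ (1 + u) d (1 - u)` has a surjective differential
somewhere. As the map is equivariant, one may take `u = 0`. -/
theorem subset_zclosure_unipSet_iff {D E : Submodule ℂ 𝓔} (hDE : D ≤ E)
    (hE : ∀ u ∈ offDiag M e, ∀ x ∈ E, (1 + u) * x * (1 - u) ∈ E)
    (hE' : ∀ u ∈ offDiag M e, ∀ x ∈ E, u * x - x * u ∈ E)
    (hED : ∀ x ∈ E, e * x * (1 - e) = 0 → x ∈ D)
    (hD : ∀ x ∈ D, e * x * (1 - e) = 0) :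
    (E : Set 𝓔) ⊆ zclosure (conjSet (unipSet M e) D) ↔
      ∃ d ∈ D, ∀ x ∈ E, ∃ u ∈ offDiag M e, e * (u * d - d * u) * (1 - e) = e * x * (1 - e) := by
  let φ : offDiag M e × D → E := fun x =>
    ⟨(1 + x.1) * x.2 * (1 - x.1), hE _ x.1.2 _ (hDE x.2.2)⟩
  let dφ : offDiag M e × D → offDiag M e × D → E := fun x y =>
    ⟨(1 + x.1) * (y.2 + (y.1 * x.2 - x.2 * y.1)) * (1 - x.1),
      hE _ x.1.2 _ (E.add_mem (hDE y.2.2) (hE' _ y.1.2 _ (hDE x.2.2)))⟩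
  have hfst : IsRegular (polyFun (offDiag M e × D)) (fun x => (x.1 : 𝓔)) :=
    isRegular_linearMap ((offDiag M e).subtype ∘ₗ LinearMap.fst ℂ (offDiag M e) D)
  have hsnd : IsRegular (polyFun (offDiag M e × D)) (fun x => (x.2 : 𝓔)) :=
    isRegular_linearMap (D.subtype ∘ₗ LinearMap.snd ℂ (offDiag M e) D)
  have hφ : IsRegular (polyFun _) φ := IsRegular.codRestrict E
    ((((isRegular_const 1).add hfst).mul hsnd).mul ((isRegular_const 1).sub hfst))
  have hd : ∀ x y, ∀ ψ : Module.Dual ℂ E,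
      HasDerivAt (fun t : ℂ => ψ (φ (x + t • y))) (ψ (dφ x y)) 0 := by
    intro x y ψ'
    obtain ⟨ψ, hψ⟩ := ψ'.exists_extend
    have hψ' : ∀ z : E, ψ' z = ψ z := fun z => by rw [← hψ]; rfl
    simp only [hψ']
    obtain ⟨⟨u, hu⟩, ⟨d, -⟩⟩ := x
    obtain ⟨⟨v, hv⟩, ⟨c, -⟩⟩ := y
    have huv := mul_eq_zero_of_mem_offDiag hu hv
    have hvu := mul_eq_zero_of_mem_offDiag hv hu
    convert hasDerivAt_cubic ψ ((1 + u) * d * (1 - u))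
      ((1 + u) * c * (1 - u) + v * d * (1 - u) - (1 + u) * d * v)
      (v * c * (1 - u) - (1 + u) * c * v - v * d * v) (-(v * c * v)) using 2
    · rename_i t
      congr 1
      change (1 + (u + t • v)) * (d + t • c) * (1 - (u + t • v)) = _
      simp only [mul_add, add_mul, mul_sub, smul_mul_assoc, mul_smul_comm, smul_add, smul_sub,
        smul_neg, one_mul, mul_one, smul_smul, pow_succ, pow_zero, mul_assoc]
      abel
    · change (1 + u) * (c + (v * d - d * v)) * (1 - u) = _
      linear_combination (norm := noncomm_ring) huv * d * (1 - u) + (1 + u) * d * hvu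
  have h1 := dominant_iff_exists_surjective_deriv hφ dφ hd
  have h2 : (E : Set 𝓔) ⊆ zclosure (conjSet (unipSet M e) D) ↔
      ∀ w, w ∈ zclosure (Set.range φ) := by
    have h3 : Subtype.val '' Set.range φ = conjSet (unipSet M e) (D : Set 𝓔) := by
      ext T
      rw [mem_conjSet_unipSet]
      constructor
      · rintro ⟨_, ⟨⟨u, d⟩, rfl⟩, rfl⟩
        exact ⟨u, u.2, d, d.2, rfl⟩
      · rintro ⟨u, hu, d, hd, rfl⟩
        exact ⟨_, ⟨⟨⟨u, hu⟩, ⟨d, hd⟩⟩, rfl⟩, rfl⟩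
    simp only [mem_zclosure_submodule_iff, h3]
    exact ⟨fun h w => h w.2, fun h w hw => h ⟨w, hw⟩⟩
  rw [h2, h1]
  constructor
  · rintro ⟨⟨⟨u, hu⟩, ⟨d, hd⟩⟩, hs⟩
    refine ⟨d, hd, fun x hx => ?_⟩
    obtain ⟨⟨⟨v, hv⟩, ⟨c, hc⟩⟩, hvc⟩ := hs ⟨_, hE u hu x hx⟩
    refine ⟨v, hv, ?_⟩
    have h3 : (1 + u) * (c + (v * d - d * v)) * (1 - u) = (1 + u) * x * (1 - u) :=
      congrArg Subtype.val hvc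
    have h4 : c + (v * d - d * v) = x := by
      have h5 := congrArg (fun z => (1 - u) * z * (1 + u)) h3
      simp only [mul_assoc, one_sub_mul_one_add hu, mul_one] at h5
      simpa only [← mul_assoc, one_sub_mul_one_add hu, one_mul] using h5
    rw [← h4, mul_add, add_mul, hD c hc, zero_add]
  · rintro ⟨d, hd, hs⟩
    refine ⟨⟨0, ⟨d, hd⟩⟩, fun ⟨x, hx⟩ => ?_⟩
    obtain ⟨v, hv, hvx⟩ := hs x hx
    refine ⟨⟨⟨v, hv⟩, ⟨x - (v * d - d * v), hED _ (E.sub_mem hx (hE' _ hv _ (hDE hd))) ?_⟩⟩, ?_⟩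
    · linear_combination (norm := noncomm_ring) -hvx
    · refine Subtype.ext ?_
      change (1 + 0) * (x - (v * d - d * v) + (v * d - d * v)) * (1 - 0) = x
      simp

end UnipDense

/-! ### Slices -/

section Slice

variable {𝓔 : Type*} [Ring 𝓔] [Algebra ℂ 𝓔] [FiniteDimensional ℂ 𝓔]

/-- The elements `A` which are conjugate to `N` under an invertible element of `H`. -/
def conjTo (H : Set 𝓔) (N : 𝓔) : Set 𝓔 :=
  {A | ∃ g h, g ∈ H ∧ g * h = 1 ∧ h * g = 1 ∧ g * A = N * g}

/-- Let `S` be a set of pairs `(A, B)`, where `A` belongs to the closure of the orbit of `N`, such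
that `B` is mapped to `Q` under every element of the group that conjugates `A` to `N`. If `(N, B)`
is in the closure of `S`, then `B` is in the closure of `Q`. The reason is that the orbit has a
rational section near `N`: the equation `g A = N g` for `g` is linear of constant rank along the
orbit. -/
theorem mem_zclosure_of_slice (H : Subalgebra ℂ 𝓔) (N : 𝓔) {S : Set (𝓔 × 𝓔)} {Q : Set 𝓔}
    (hQ : ∀ c : ℂ, ∀ B ∈ Q, c • B ∈ Q)
    (hS : ∀ p ∈ S, p.1 ∈ zclosure (conjTo (H : Set 𝓔) N))
    (hSQ : ∀ p ∈ S, ∀ g h, g ∈ H → g * h = 1 → h * g = 1 → g * p.1 = N * g → g * p.2 * h ∈ Q)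
    {B : 𝓔} (hB : (N, B) ∈ zclosure S) : B ∈ zclosure Q := by
  intro f hf hfQ
  -- the linear equation `L A g = g A - N g = 0`, and its kernel at `A = N`
  let L : 𝓔 → H →ₗ[ℂ] 𝓔 := fun A => (LinearMap.mulRight ℂ A - LinearMap.mulLeft ℂ N) ∘ₗ
    H.val.toLinearMap
  have hLapp : ∀ A (g : H), L A g = g * A - N * g := fun A g => rfl
  have hLreg : IsRegular (polyFun 𝓔) L := by
    have h1 : IsRegular (polyFun 𝓔) (fun A : 𝓔 => LinearMap.mulRight ℂ A) :=
      isRegular_linearMap (LinearMap.mul ℂ 𝓔).flip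
    exact (h1.sub (isRegular_const (LinearMap.mulLeft ℂ N))).linear
      (LinearMap.lcomp ℂ 𝓔 H.val.toLinearMap)
  have hrank : ∀ A ∈ zclosure (conjTo (H : Set 𝓔) N),
      Module.finrank ℂ (LinearMap.range (L A)) ≤ Module.finrank ℂ (LinearMap.range (L N)) := by
    intro A hA
    refine finrank_range_le_of_mem_zclosure hLreg ?_ hA
    rintro A' ⟨g, h, hg, hgh, hhg, hgA⟩
    -- multiplication by `h` on the right, and by `g`, intertwines `L A'` and `L N`
    have h1 : LinearMap.range (L A') ≤ (LinearMap.range (L N)).map (LinearMap.mulRight ℂ g) := by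
      rintro _ ⟨k, rfl⟩
      refine ⟨_, ⟨k * ⟨h, inv_mem_subalgebra H hg hhg⟩, rfl⟩, ?_⟩
      change ((k : 𝓔) * h * N - N * (k * h)) * g = k * A' - N * k
      have h2 : h * N * g = A' := by rw [mul_assoc, ← hgA, ← mul_assoc, hhg, one_mul]
      linear_combination (norm := noncomm_ring) (k : 𝓔) * h2 - N * k * hhg
    exact (Submodule.finrank_mono h1).trans (Submodule.finrank_map_le _ _)
  -- a generalized inverse `K` of `L N`
  obtain ⟨K, hK⟩ : ∃ K : 𝓔 →ₗ[ℂ] H, ∀ g, L N (K (L N g)) = L N g := by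
    obtain ⟨α, hα⟩ := (L N).rangeRestrict.exists_rightInverse_of_surjective
      (LinearMap.range_rangeRestrict _)
    obtain ⟨β, hβ⟩ := (LinearMap.range (L N)).subtype.exists_leftInverse_of_injective
      (Submodule.ker_subtype _)
    refine ⟨α ∘ₗ β, fun g => ?_⟩
    have h1 : β (L N g) = (L N).rangeRestrict g := LinearMap.congr_fun hβ ((L N).rangeRestrict g)
    have h2 := congrArg Subtype.val (LinearMap.congr_fun hα ((L N).rangeRestrict g))
    change L N (α (β (L N g))) = L N g
    rw [h1]
    exact h2
  let T : 𝓔 → Module.End ℂ H := fun A => 1 + K ∘ₗ (L A - L N)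
  have hTreg : IsRegular (polyFun 𝓔) T :=
    (isRegular_const 1).add ((hLreg.sub (isRegular_const (L N))).linear
      (LinearMap.llcomp ℂ H 𝓔 H K))
  have hTN : T N = 1 := by simp [T]
  have hL1 : L N 1 = 0 := by rw [hLapp]; simp
  let γ : 𝓔 → 𝓔 := fun A => (endAdj (T A) 1 : H)
  have hγreg : IsRegular (polyFun 𝓔) γ :=
    hTreg.endAdj.linear (H.val.toLinearMap ∘ₗ LinearMap.applyₗ 1)
  have hγ : ∀ A ∈ zclosure (conjTo (H : Set 𝓔) N), LinearMap.det (T A) ≠ 0 →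
      γ A * A = N * γ A := by
    intro A hA hdet
    have hinj := (LinearMap.equivOfDetNeZero _ hdet).injective
    -- `T A` maps the kernel of `L A` to that of `L N`, and the dimensions agree
    have hTker : ∀ g ∈ LinearMap.ker (L A), T A g ∈ LinearMap.ker (L N) := by
      intro g hg
      have h1 : T A g = g + K (L A g - L N g) := rfl
      rw [h1, LinearMap.mem_ker.1 hg, zero_sub, map_neg, LinearMap.mem_ker, map_add, map_neg, hK,
        add_neg_cancel]
    let T' : LinearMap.ker (L A) →ₗ[ℂ] LinearMap.ker (L N) := (T A).restrict hTker
    have hT' : Function.Injective T' := fun x y hxy =>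
      Subtype.ext (hinj (congrArg Subtype.val hxy))
    have hfr : Module.finrank ℂ (LinearMap.ker (L A)) = Module.finrank ℂ (LinearMap.ker (L N)) := by
      refine le_antisymm (LinearMap.finrank_le_finrank_of_injective hT') ?_
      have h1 := (L A).finrank_range_add_finrank_ker
      have h2 := (L N).finrank_range_add_finrank_ker
      have h3 := hrank A hA
      omega
    obtain ⟨⟨g, hg⟩, hTg⟩ := (LinearMap.injective_iff_surjective_of_finrank_eq_finrank hfr).1 hT'
      ⟨1, hL1⟩
    have hTg' : T A g = 1 := congrArg Subtype.val hTg
    have h1 : endAdj (T A) 1 = LinearMap.det (T A) • g := by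
      refine hinj ?_
      change T A _ = T A _
      rw [map_smul, hTg']
      exact LinearMap.congr_fun (mul_endAdj (T A)) 1
    have h2 : (g : 𝓔) * A - N * g = 0 := hg
    have h3 : γ A = LinearMap.det (T A) • (g : 𝓔) := congrArg Subtype.val h1
    rw [h3, smul_mul_assoc, mul_smul_comm, sub_eq_zero.1 h2]
  have hγN : γ N = 1 := by
    change ((endAdj (T N) 1 : H) : 𝓔) = 1
    rw [hTN, endAdj_one]
    rfl
  have hfst : IsRegular (polyFun (𝓔 × 𝓔)) (Prod.fst : 𝓔 × 𝓔 → 𝓔) :=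
    isRegular_linearMap (LinearMap.fst ℂ 𝓔 𝓔)
  have hsnd : IsRegular (polyFun (𝓔 × 𝓔)) (Prod.snd : 𝓔 × 𝓔 → 𝓔) :=
    isRegular_linearMap (LinearMap.snd ℂ 𝓔 𝓔)
  have hγ1 : IsRegular (polyFun (𝓔 × 𝓔)) (fun p : 𝓔 × 𝓔 => γ p.1) := fun ψ =>
    hfst.polyFun_comp (hγreg ψ)
  have hF : (fun p : 𝓔 × 𝓔 => LinearMap.det (T p.1) * LinearMap.det (LinearMap.mulLeft ℂ (γ p.1)) *
      f (γ p.1 * p.2 * algAdj (γ p.1))) ∈ polyFun (𝓔 × 𝓔) :=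
    (polyFun _).mul_mem ((polyFun _).mul_mem (hfst.polyFun_comp hTreg.det) hγ1.det_mulLeft)
      (((hγ1.mul hsnd).mul hγ1.algAdj).polyFun_comp hf)
  have key := hB _ hF fun p hp => ?_
  · simpa [hγN, hTN, algAdj_one, LinearMap.mulLeft_one] using key
  · by_cases h1 : LinearMap.det (T p.1) = 0
    · simp [h1]
    by_cases h2 : LinearMap.det (LinearMap.mulLeft ℂ (γ p.1)) = 0
    · simp [h2]
    obtain ⟨k, h3, h4, h5⟩ := exists_inv_of_det_mulLeft_ne_zero h2
    rw [h5, mul_smul_comm, hfQ, mul_zero]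
    exact hQ _ _ (hSQ p hp _ _ (Subtype.prop _) h3 h4 (hγ _ (hS p hp) h1))

end Slice

/-! ### Splitting of block triangular elements -/

section Splitting

variable {𝓔 : Type*} [Ring 𝓔] [Algebra ℂ 𝓔] [FiniteDimensional ℂ 𝓔]

/-- Let `N` be block diagonal, and let `A = N + γ` be block triangular with the same diagonal
blocks as `N`. If `A` is in the closure of the orbit of `N`, it is conjugate to `N` under the
unipotent group. This is Miyata's argument: by semicontinuity the space of the `X` with `A X = X
N` is at least as large as for `A = N`, which makes an exact sequence of spaces of homomorphisms
short exact. -/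
theorem exists_offDiag_of_mem_zclosure_conjTo (H : Subalgebra ℂ 𝓔) {e N γ : 𝓔}
    (he : IsIdempotentElem e) (heH : e ∈ H) (hN : e * N = N * e) (hγ : e * γ = γ)
    (hγ' : γ * e = 0) (hA : N + γ ∈ zclosure (conjTo (H : Set 𝓔) N)) :
    ∃ u ∈ offDiag H e, (1 + u) * N = (N + γ) * (1 + u) := by
  have hee := he.eq
  let P : Submodule ℂ 𝓔 := Subalgebra.toSubmodule H ⊓ LinearMap.ker (LinearMap.mulRight ℂ e)
  have hP : ∀ X : P, (X : 𝓔) ∈ H ∧ (X : 𝓔) * e = 0 := fun X => X.2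
  let L : 𝓔 → P →ₗ[ℂ] 𝓔 := fun A => (LinearMap.mulLeft ℂ A - LinearMap.mulRight ℂ N) ∘ₗ P.subtype
  have hLapp : ∀ A (X : P), L A X = A * X - X * N := fun A X => rfl
  have hLreg : IsRegular (polyFun 𝓔) L := by
    have h1 : IsRegular (polyFun 𝓔) (fun A : 𝓔 => LinearMap.mulLeft ℂ A) :=
      isRegular_linearMap (LinearMap.mul ℂ 𝓔)
    exact (h1.sub (isRegular_const (LinearMap.mulRight ℂ N))).linear (LinearMap.lcomp ℂ 𝓔 P.subtype)
  have hrank : Module.finrank ℂ (LinearMap.range (L (N + γ))) ≤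
      Module.finrank ℂ (LinearMap.range (L N)) := by
    refine finrank_range_le_of_mem_zclosure hLreg ?_ hA
    rintro A' ⟨g, h, hg, hgh, hhg, hgA⟩
    have h1 : LinearMap.range (L A') ≤ (LinearMap.range (L N)).map (LinearMap.mulLeft ℂ h) := by
      rintro _ ⟨k, rfl⟩
      refine ⟨_, ⟨⟨g * k, H.mul_mem hg (hP k).1, ?_⟩, rfl⟩, ?_⟩
      · change g * k * e = 0
        rw [mul_assoc, (hP k).2, mul_zero]
      · change h * (N * (g * k) - g * k * N) = A' * k - k * N
        linear_combination (norm := noncomm_ring) -h * hgA * (k : 𝓔) + hhg * A' * k - hhg * k * N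
    exact (Submodule.finrank_mono h1).trans (Submodule.finrank_map_le _ _)
  -- the two summands of the kernel of `L N`
  let K₁ : Submodule ℂ P := LinearMap.ker (L N) ⊓
    LinearMap.ker (LinearMap.mulLeft ℂ (1 - e) ∘ₗ P.subtype)
  let K₂ : Submodule ℂ P := LinearMap.ker (L N) ⊓ LinearMap.ker (LinearMap.mulLeft ℂ e ∘ₗ P.subtype)
  have hK₁ : ∀ X : P, X ∈ K₁ ↔ N * X - X * N = 0 ∧ (1 - e) * (X : 𝓔) = 0 := fun X => Iff.rfl
  have hK₂ : ∀ X : P, X ∈ K₂ ↔ N * X - X * N = 0 ∧ e * (X : 𝓔) = 0 := fun X => Iff.rfl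
  have hsum : Module.finrank ℂ K₁ + Module.finrank ℂ K₂ ≤
      Module.finrank ℂ (LinearMap.ker (L N)) := by
    have h1 : K₁ ⊓ K₂ = ⊥ := by
      refine (Submodule.eq_bot_iff _).2 fun X hX => Subtype.ext ?_
      have h2 := ((hK₁ X).1 hX.1).2
      have h3 := ((hK₂ X).1 hX.2).2
      change (X : 𝓔) = 0
      linear_combination (norm := noncomm_ring) h2 + h3
    have h2 := Submodule.finrank_sup_add_finrank_inf_eq K₁ K₂
    rw [h1, finrank_bot, add_zero] at h2
    rw [← h2]
    exact Submodule.finrank_mono (sup_le inf_le_left inf_le_left)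
  -- the projection of the kernel of `L A` to its lower block
  let pr : P →ₗ[ℂ] P := (LinearMap.mulLeft ℂ (1 - e) ∘ₗ P.subtype).codRestrict P fun X =>
    ⟨H.mul_mem (H.sub_mem H.one_mem heH) (hP X).1, by
      change (1 - e) * (X : 𝓔) * e = 0
      rw [mul_assoc, (hP X).2, mul_zero]⟩
  have hpr : ∀ X : P, (pr X : 𝓔) = (1 - e) * X := fun X => rfl
  have hkerA : ∀ X : P, X ∈ LinearMap.ker (L (N + γ)) ↔ (N + γ) * X - X * N = 0 := fun X => Iff.rfl
  have hmap : (LinearMap.ker (L (N + γ))).map pr ≤ K₂ := by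
    rintro _ ⟨X, hX, rfl⟩
    have h1 := (hkerA X).1 hX
    refine (hK₂ _).2 ⟨?_, ?_⟩
    · rw [hpr]
      linear_combination (norm := noncomm_ring) (1 - e) * h1 + hN * X + hγ * X
    · rw [hpr]
      linear_combination (norm := noncomm_ring) -hee * X
  have hker : Module.finrank ℂ (LinearMap.ker (pr.domRestrict (LinearMap.ker (L (N + γ))))) ≤
      Module.finrank ℂ K₁ := by
    let ι : LinearMap.ker (pr.domRestrict (LinearMap.ker (L (N + γ)))) →ₗ[ℂ] K₁ :=
      ((LinearMap.ker (L (N + γ))).subtype ∘ₗ Submodule.subtype _).codRestrict K₁ fun X => by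
        have h1 := (hkerA X.1.1).1 X.1.2
        have h2 : (1 - e) * (X.1.1 : 𝓔) = 0 := congrArg Subtype.val X.2
        refine (hK₁ _).2 ⟨?_, h2⟩
        change N * (X.1.1 : 𝓔) - X.1.1 * N = 0
        linear_combination (norm := noncomm_ring) h1 - γ * h2 - hγ' * X.1.1
    refine LinearMap.finrank_le_finrank_of_injective (f := ι) fun X Y hXY => ?_
    have h1 := congrArg (fun k : K₁ => (k : P)) hXY
    exact Subtype.ext (Subtype.ext h1)
  have heq : (LinearMap.ker (L (N + γ))).map pr = K₂ := by
    refine Submodule.eq_of_le_of_finrank_le hmap ?_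
    have h1 := LinearMap.finrank_range_add_finrank_ker (K := ℂ) (V := LinearMap.ker (L (N + γ)))
      (V₂ := P) (pr.domRestrict (LinearMap.ker (L (N + γ))))
    rw [LinearMap.range_domRestrict] at h1
    have h2 := (L (N + γ)).finrank_range_add_finrank_ker
    have h3 := (L N).finrank_range_add_finrank_ker
    omega
  have hmem : (⟨1 - e, H.sub_mem H.one_mem heH, by
      change (1 - e) * e = 0
      linear_combination (norm := noncomm_ring) -hee⟩ : P) ∈ K₂ := by
    refine (hK₂ _).2 ⟨?_, ?_⟩
    · change N * (1 - e) - (1 - e) * N = 0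
      linear_combination (norm := noncomm_ring) hN
    · change e * (1 - e) = 0
      linear_combination (norm := noncomm_ring) -hee
  rw [← heq] at hmem
  obtain ⟨X, hX, hXe⟩ := hmem
  have h1 := (hkerA X).1 hX
  have h2 : (1 - e) * (X : 𝓔) = 1 - e := congrArg Subtype.val hXe
  have h3 := (hP X).2
  refine ⟨e * X, ⟨H.mul_mem heH (hP X).1, ?_, ?_⟩, ?_⟩
  · rw [← mul_assoc, hee]
  · rw [mul_assoc, h3, mul_zero]
  · linear_combination (norm := noncomm_ring) -h1 + N * h2 - h2 * N + γ * h2 + hN - hγ'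

end Splitting

/-! ### Commuting pairs and block triangular pairs for an idempotent -/

section Pairs

variable {𝓔 : Type*} [Ring 𝓔]

/-- Taking block diagonal parts is multiplicative on block upper triangular elements. -/
theorem levi_mul {e p q : 𝓔} (he : IsIdempotentElem e) (hp : e * p * e = p * e)
    (hq : e * q * e = q * e) :
    (e * p * e + (1 - e) * p * (1 - e)) * (e * q * e + (1 - e) * q * (1 - e)) =
      e * (p * q) * e + (1 - e) * (p * q) * (1 - e) := by
  have hee := he.eq
  linear_combination (norm := noncomm_ring) e * p * hee * q * e -
    e * p * hee * q * (1 - e) - (1 - e) * p * hee * q * e + (1 - e) * p * hee * q * (1 - e) +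
    e * p * hq + hp * q * (1 - e)

theorem levi_one {e : 𝓔} (he : IsIdempotentElem e) :
    e * 1 * e + (1 - e) * 1 * (1 - e) = 1 := by
  linear_combination (norm := noncomm_ring) 2 * he.eq

theorem levi_eq_self {e N : 𝓔} (he : IsIdempotentElem e) (hN : e * N = N * e) :
    e * N * e + (1 - e) * N * (1 - e) = N := by
  linear_combination (norm := noncomm_ring) 2 * hN * e + 2 * N * he.eq - hN

theorem upper_mul {e p q : 𝓔} (hp : e * p * e = p * e) (hq : e * q * e = q * e) :
    e * (p * q) * e = p * q * e := by
  linear_combination (norm := noncomm_ring) -(e * p * hq) + hp * q * e + p * hq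

theorem levi_comm {e : 𝓔} (he : IsIdempotentElem e) (p : 𝓔) :
    e * (e * p * e + (1 - e) * p * (1 - e)) = (e * p * e + (1 - e) * p * (1 - e)) * e := by
  have hee := he.eq
  linear_combination (norm := noncomm_ring) hee * p * e - hee * p * (1 - e) - e * p * hee
    + (1 - e) * p * hee

theorem lower_mul {e p q : 𝓔} (hp : e * p * e = e * p) (hq : e * q * e = e * q) :
    e * (p * q) * e = e * (p * q) := by
  linear_combination (norm := noncomm_ring) e * p * hq - hp * q * e + hp * q

theorem lower_iff_upper_one_sub (e z : 𝓔) :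
    e * z * e = e * z ↔ (1 - e) * z * (1 - e) = z * (1 - e) := by
  constructor
  · intro h
    linear_combination (norm := noncomm_ring) h
  · intro h
    linear_combination (norm := noncomm_ring) h

theorem commute_one_sub_iff (e z : 𝓔) :
    (1 - e) * z = z * (1 - e) ↔ e * z = z * e := by
  constructor
  · intro h
    linear_combination (norm := noncomm_ring) -h
  · intro h
    linear_combination (norm := noncomm_ring) -h

theorem conjPair_mono {H H' : Set 𝓔} {S S' : Set (𝓔 × 𝓔)} (h : H ⊆ H') (h' : S ⊆ S') :
    conjPair H S ⊆ conjPair H' S' := by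
  rintro _ ⟨g, k, hg, h1, h2, c, hc, rfl⟩
  exact ⟨g, k, h hg, h1, h2, c, h' hc, rfl⟩

variable [Algebra ℂ 𝓔]

/-- The elements of `H` which commute with `N`. -/
def centAlg (H : Subalgebra ℂ 𝓔) (N : 𝓔) : Subalgebra ℂ 𝓔 := H ⊓ Subalgebra.centralizer ℂ {N}

theorem mem_centAlg {H : Subalgebra ℂ 𝓔} {N m : 𝓔} : m ∈ centAlg H N ↔ m ∈ H ∧ N * m = m * N := by
  simp [centAlg, Subalgebra.mem_centralizer_iff]

/-- The elements of `𝒞` which commute with `N`. -/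
def centSub (𝒞 : Submodule ℂ 𝓔) (N : 𝓔) : Submodule ℂ 𝓔 where
  carrier := {B | B ∈ 𝒞 ∧ N * B = B * N}
  add_mem' := by
    rintro a b ⟨h1, h2⟩ ⟨h3, h4⟩
    exact ⟨𝒞.add_mem h1 h3, by rw [mul_add, add_mul, h2, h4]⟩
  zero_mem' := ⟨𝒞.zero_mem, by simp⟩
  smul_mem' := by
    rintro c a ⟨h1, h2⟩
    exact ⟨𝒞.smul_mem c h1, by rw [mul_smul_comm, smul_mul_assoc, h2]⟩

/-- The elements `B` of `C` with `e B (1 - e) = 0`. -/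
def lowerSub (C : Submodule ℂ 𝓔) (e : 𝓔) : Submodule ℂ 𝓔 where
  carrier := {B | B ∈ C ∧ e * B * e = e * B}
  add_mem' := by
    rintro a b ⟨h1, h2⟩ ⟨h3, h4⟩
    exact ⟨C.add_mem h1 h3, by rw [mul_add, add_mul, h2, h4]⟩
  zero_mem' := ⟨C.zero_mem, by simp⟩
  smul_mem' := by
    rintro c a ⟨h1, h2⟩
    exact ⟨C.smul_mem c h1, by rw [mul_smul_comm, smul_mul_assoc, h2]⟩

/-- The elements `B` of `C` with `(1 - e) B e = 0`. -/
def upperSub (C : Submodule ℂ 𝓔) (e : 𝓔) : Submodule ℂ 𝓔 where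
  carrier := {B | B ∈ C ∧ e * B * e = B * e}
  add_mem' := by
    rintro a b ⟨h1, h2⟩ ⟨h3, h4⟩
    exact ⟨C.add_mem h1 h3, by rw [mul_add, add_mul, add_mul, h2, h4]⟩
  zero_mem' := ⟨C.zero_mem, by simp⟩
  smul_mem' := by
    rintro c a ⟨h1, h2⟩
    exact ⟨C.smul_mem c h1, by rw [mul_smul_comm, smul_mul_assoc, smul_mul_assoc, h2]⟩

variable {M H : Subalgebra ℂ 𝓔} {C 𝒞 : Submodule ℂ 𝓔} {N e : 𝓔}

theorem lowerSub_one_sub : lowerSub C (1 - e) = upperSub C e := by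
  ext B
  refine and_congr_right fun _ => ⟨fun h => ?_, fun h => ?_⟩
  · linear_combination (norm := noncomm_ring) h
  · linear_combination (norm := noncomm_ring) h

theorem upperSub_one_sub : upperSub C (1 - e) = lowerSub C e := by
  rw [← lowerSub_one_sub, sub_sub_cancel]

theorem mem_lower_inf_upper {B : 𝓔} :
    B ∈ lowerSub C e ⊓ upperSub C e ↔ B ∈ C ∧ e * B * e = e * B ∧ e * B = B * e :=
  ⟨fun ⟨h1, h2⟩ => ⟨h1.1, h1.2, h1.2.symm.trans h2.2⟩,
    fun ⟨h1, h2, h3⟩ => ⟨⟨h1, h2⟩, ⟨h1, h2.trans h3⟩⟩⟩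

theorem levi_mem {e p : 𝓔} (heH : e ∈ H) (hp : p ∈ H) : e * p * e + (1 - e) * p * (1 - e) ∈ H :=
  H.add_mem (H.mul_mem (H.mul_mem heH hp) heH)
    (H.mul_mem (H.mul_mem (H.sub_mem H.one_mem heH) hp) (H.sub_mem H.one_mem heH))

/-- The pairs `(N, B)` with `B ∈ C`. -/
def fiberSet (N : 𝓔) (C : Set 𝓔) : Set (𝓔 × 𝓔) := {p | p.1 = N ∧ p.2 ∈ C}

theorem subset_conjPair (H : Subalgebra ℂ 𝓔) (S : Set (𝓔 × 𝓔)) : S ⊆ conjPair (H : Set 𝓔) S :=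
  fun p hp => ⟨1, 1, H.one_mem, by simp, by simp, p, hp, by simp⟩

theorem conjPair_conjPair (H : Subalgebra ℂ 𝓔) (S : Set (𝓔 × 𝓔)) :
    conjPair (H : Set 𝓔) (conjPair (H : Set 𝓔) S) ⊆ conjPair (H : Set 𝓔) S := by
  rintro _ ⟨g, h, hg, hgh, hhg, _, ⟨g', h', hg', hgh', hhg', p, hp, rfl⟩, rfl⟩
  refine ⟨g * g', h' * h, H.mul_mem hg hg', ?_, ?_, p, hp, ?_⟩
  · linear_combination (norm := noncomm_ring) g * hgh' * h + hgh
  · linear_combination (norm := noncomm_ring) h' * hhg * g' + hhg'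
  · simp only [mul_assoc]

variable (H 𝒞 N) in
/-- The pairs of commuting elements which are conjugate to `(N, B)` with `B ∈ 𝒞`. -/
def orbitPairs : Set (𝓔 × 𝓔) := conjPair (H : Set 𝓔) (fiberSet N (centSub 𝒞 N))

variable (H 𝒞 N e) in
/-- The pairs in the closure of `orbitPairs` which are block upper triangular with respect to `e`,
the diagonal part of the first component being conjugate to `N` by a block diagonal element. -/
def triangPairs : Set (𝓔 × 𝓔) :=
  {p | p ∈ zclosure (orbitPairs H 𝒞 N) ∧ e * p.1 * e = p.1 * e ∧ e * p.2 * e = p.2 * e ∧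
    ∃ l k, l ∈ H ∧ l * k = 1 ∧ k * l = 1 ∧ e * l = l * e ∧
      l * (e * p.1 * e + (1 - e) * p.1 * (1 - e)) = N * l}

/-- If the conjugates of `D` under the elements of `M` which commute with `N` are dense in `C`,
then all `(N, B)` with `B ∈ C` are in the closure of the conjugates of the `(N, B)` with `B ∈ D`.
-/
theorem fiberSet_subset_zclosure_conjPair {M H : Set 𝓔} (hMH : M ⊆ H) (hM : ∀ m ∈ M, N * m = m * N)
    {C D : Set 𝓔} (hCD : C ⊆ zclosure (conjSet M D)) :
    fiberSet N C ⊆ zclosure (conjPair H (fiberSet N D)) := by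
  rintro ⟨A, B⟩ ⟨hA, hB⟩
  obtain rfl : A = N := hA
  refine ((isRegular_const A).prodMk (isRegular_linearMap LinearMap.id)).mapsTo_zclosure
    (Φ := fun B : 𝓔 => (A, LinearMap.id (R := ℂ) B)) ?_ (hCD hB)
  rintro _ ⟨g, h, hg, hgh, hhg, d, hd, rfl⟩
  refine subset_zclosure _ ⟨g, h, hMH hg, hgh, hhg, (A, d), ⟨rfl, hd⟩, Prod.ext ?_ rfl⟩
  change A = g * A * h
  rw [← hM g hg, mul_assoc, hgh, mul_one]

variable [FiniteDimensional ℂ 𝓔]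

theorem isRegular_conj (g h : 𝓔) :
    IsRegular (polyFun (𝓔 × 𝓔)) (fun p : 𝓔 × 𝓔 => (g * p.1 * h, g * p.2 * h)) :=
  (((isRegular_const g).mul (isRegular_linearMap (LinearMap.fst ℂ 𝓔 𝓔))).mul
    (isRegular_const h)).prodMk
  (((isRegular_const g).mul (isRegular_linearMap (LinearMap.snd ℂ 𝓔 𝓔))).mul (isRegular_const h))

theorem conjPair_zclosure (H : Set 𝓔) (S : Set (𝓔 × 𝓔)) :
    conjPair H (zclosure S) ⊆ zclosure (conjPair H S) := by
  rintro _ ⟨g, h, hg, hgh, hhg, p, hp, rfl⟩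
  exact (isRegular_conj g h).mapsTo_zclosure (T := conjPair H S)
    (fun s hs => subset_zclosure _ ⟨g, h, hg, hgh, hhg, s, hs, rfl⟩) hp

theorem commute_of_mem_zclosure_orbitPairs {p : 𝓔 × 𝓔} (hp : p ∈ zclosure (orbitPairs H 𝒞 N)) :
    p.1 * p.2 = p.2 * p.1 := by
  have h1 : IsRegular (polyFun (𝓔 × 𝓔)) (Prod.fst : 𝓔 × 𝓔 → 𝓔) :=
    isRegular_linearMap (LinearMap.fst ℂ 𝓔 𝓔)
  have h2 : IsRegular (polyFun (𝓔 × 𝓔)) (Prod.snd : 𝓔 × 𝓔 → 𝓔) :=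
    isRegular_linearMap (LinearMap.snd ℂ 𝓔 𝓔)
  refine sub_eq_zero.1 (((h1.mul h2).sub (h2.mul h1)).eq_zero_of_mem_zclosure ?_ hp)
  rintro _ ⟨g, h, -, -, hhg, ⟨A, B⟩, ⟨hA, -, hB⟩, rfl⟩
  obtain rfl : A = N := hA
  dsimp only at hB ⊢
  linear_combination (norm := noncomm_ring) g * A * hhg * B * h - g * B * hhg * A * h + g * hB * h

theorem mem_of_mem_zclosure_orbitPairs (h𝒞l : ∀ g ∈ H, ∀ c ∈ 𝒞, g * c ∈ 𝒞)
    (h𝒞r : ∀ g ∈ H, ∀ c ∈ 𝒞, c * g ∈ 𝒞) {p : 𝓔 × 𝓔} (hp : p ∈ zclosure (orbitPairs H 𝒞 N)) :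
    p.2 ∈ 𝒞 := by
  have h1 : zclosure (orbitPairs H 𝒞 N) ⊆ 𝒞.comap (LinearMap.snd ℂ 𝓔 𝓔) := by
    refine zclosure_submodule_subset _ ?_
    rintro _ ⟨g, h, hg, -, hhg, ⟨A, B⟩, ⟨-, hB⟩, rfl⟩
    exact h𝒞r _ (inv_mem_subalgebra H hg hhg) _ (h𝒞l _ hg _ hB.1)
  exact h1 hp

/-- Block triangular pairs are conjugate to pairs `(N, B)` under the parabolic group: the diagonal
part of the first component is conjugate to `N` by assumption, and the off-diagonal part is
removed by a unipotent element, the first component being in the closure of the orbit of `N`. -/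
theorem triangPairs_eq (h𝒞l : ∀ g ∈ H, ∀ c ∈ 𝒞, g * c ∈ 𝒞) (h𝒞r : ∀ g ∈ H, ∀ c ∈ 𝒞, c * g ∈ 𝒞)
    (he : IsIdempotentElem e) (heH : e ∈ H) (hN : e * N = N * e) :
    triangPairs H 𝒞 N e = conjPair (triang H he.one_sub : Set 𝓔)
      (fiberSet N (upperSub (centSub 𝒞 N) e)) := by
  have hee := he.eq
  refine Set.Subset.antisymm ?_ ?_
  · rintro ⟨A, B⟩ ⟨hp, hA, hB, l, k, hl, hlk, hkl, hel, hlA⟩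
    have hAB : A * B = B * A := commute_of_mem_zclosure_orbitPairs hp
    have hB𝒞 : B ∈ 𝒞 := mem_of_mem_zclosure_orbitPairs h𝒞l h𝒞r hp
    dsimp only at hA hB hlA
    have hk := inv_mem_subalgebra H hl hkl
    have hek : e * k = k * e := by
      linear_combination (norm := noncomm_ring) -hkl * e * k + k * e * hlk - k * hel * k
    -- after conjugation by `l`, the diagonal blocks of `A` are those of `N`
    have hlA' : l * (e * A * e + (1 - e) * A * (1 - e)) * k = N := by
      rw [hlA, mul_assoc, hlk, mul_one]
    have hγ' : (l * A * k - N) * e = 0 := by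
      linear_combination (norm := noncomm_ring) -(l * A * hek) - l * hA * k + hlA' * e +
        l * (e * A * e + (1 - e) * A * (1 - e)) * hek - l * e * A * hee * k + l * (1 - e) * A *
            hee * k
    have hγ : e * (l * A * k - N) = l * A * k - N := by
      linear_combination (norm := noncomm_ring) l * hA * k - l * hee * A * e * k
        + l * hee * A * (1 - e) * k + hel * A * k
        - hel * (e * A * e + (1 - e) * A * (1 - e)) * k - (1 - e) * hlA'
    have hN' : N + (l * A * k - N) ∈ zclosure (conjTo (H : Set 𝓔) N) := by
      have h1 : IsRegular (polyFun (𝓔 × 𝓔)) (fun p : 𝓔 × 𝓔 => l * p.1 * k) :=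
        ((isRegular_const l).mul (isRegular_linearMap (LinearMap.fst ℂ 𝓔 𝓔))).mul (isRegular_const
            k)
      rw [add_sub_cancel]
      refine h1.mapsTo_zclosure (S := orbitPairs H 𝒞 N) (T := conjTo (H : Set 𝓔) N) ?_ hp
      rintro _ ⟨g, h, hg, hgh, hhg, ⟨A', B'⟩, ⟨hA', -⟩, rfl⟩
      obtain rfl : A' = N := hA'
      refine subset_zclosure _ ⟨h * k, l * g, H.mul_mem (inv_mem_subalgebra H hg hhg) hk, ?_, ?_,
          ?_⟩
      · linear_combination (norm := noncomm_ring) h * hkl * g + hhg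
      · linear_combination (norm := noncomm_ring) l * hgh * k + hlk
      · linear_combination (norm := noncomm_ring) h * hkl * g * A' * h * k + hhg * A' * h * k
    -- the unipotent element which removes the off-diagonal block `l A k - N`
    obtain ⟨u, hu, huN⟩ := exists_offDiag_of_mem_zclosure_conjTo H he heH hN hγ hγ' hN'
    have hp := unipSet_subset_triang he (M := H) ⟨u, hu, rfl⟩
    have hkP : k ∈ triang H he.one_sub := by
      refine (mem_triang_one_sub he).2 ⟨hk, ?_⟩
      linear_combination (norm := noncomm_ring) hek * e + k * hee
    have hlP : l ∈ triang H he.one_sub := by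
      refine (mem_triang_one_sub he).2 ⟨hl, ?_⟩
      linear_combination (norm := noncomm_ring) hel * e + l * hee
    have h1 := one_add_mul_one_sub hu
    have h2 := one_sub_mul_one_add hu
    have hpk : k * (1 + u) ∈ triang H he.one_sub := Subalgebra.mul_mem _ hkP hp
    have hpq : k * (1 + u) * ((1 - u) * l) = 1 := by
      linear_combination (norm := noncomm_ring) k * h1 * l + hkl
    have hqp : (1 - u) * l * (k * (1 + u)) = 1 := by
      linear_combination (norm := noncomm_ring) (1 - u) * hlk * (1 + u) + h2
    have hAN : A = k * (1 + u) * N * ((1 - u) * l) := by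
      linear_combination (norm := noncomm_ring) -(k * huN * (1 - u) * l) - k * l * A * k * h1 * l
        - hkl * A * k * l - A * hkl
    have hq := inv_mem_subalgebra _ hpk hqp
    have hPe := ((mem_triang_one_sub he).1 hpk).2
    have hQe := ((mem_triang_one_sub he).1 hq).2
    set P := k * (1 + u)
    set Q := (1 - u) * l
    have hQA : Q * A = N * Q := by
      linear_combination (norm := noncomm_ring) Q * hAN + hqp * N * Q
    have hAP : A * P = P * N := by
      linear_combination (norm := noncomm_ring) hAN * P + P * N * hqp
    refine ⟨P, Q, hpk, hpq, hqp, (N, Q * B * P), ⟨rfl, ⟨?_, ?_⟩, ?_⟩, ?_⟩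
    · exact h𝒞r _ hpk.1 _ (h𝒞l _ hq.1 _ hB𝒞)
    · linear_combination (norm := noncomm_ring) -(hQA * B * P) + Q * hAB * P + Q * B * hAP
    · exact upper_mul (upper_mul hQe hB) hPe
    · refine Prod.ext hAN ?_
      change B = P * (Q * B * P) * Q
      linear_combination (norm := noncomm_ring) -(hpq * B * P * Q) - B * hpq
  · rintro _ ⟨p, q, hp, hpq, hqp, ⟨N', B⟩, ⟨hN', hB⟩, rfl⟩
    obtain rfl : N' = N := hN'
    have hq := inv_mem_subalgebra _ hp hqp
    obtain ⟨hpH, hpe⟩ := (mem_triang_one_sub he).1 hp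
    obtain ⟨hqH, hqe⟩ := (mem_triang_one_sub he).1 hq
    have hNe : e * N' * e = N' * e := by
      linear_combination (norm := noncomm_ring) hN * e + N' * hee
    have hpN := upper_mul (upper_mul hpe hNe) hqe
    refine ⟨subset_zclosure _ ⟨p, q, hpH, hpq, hqp, (N', B), ⟨rfl, hB.1⟩, rfl⟩, hpN,
      upper_mul (upper_mul hpe hB.2) hqe, _, e * p * e + (1 - e) * p * (1 - e),
      levi_mem heH hqH, ?_, ?_, levi_comm he q, ?_⟩
    · rw [levi_mul he hqe hpe, hqp, levi_one he]
    · rw [levi_mul he hpe hqe, hpq, levi_one he]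
    · have h1 : q * (p * N' * q) = N' * q := by
        linear_combination (norm := noncomm_ring) hqp * N' * q
      rw [levi_mul he hqe hpN, h1, ← levi_mul he hNe hqe, levi_eq_self he hN]

end Pairs

/-! ### The density conditions and the linear condition -/

section Density

variable {𝓔 : Type*} [Ring 𝓔] [Algebra ℂ 𝓔] {M H : Subalgebra ℂ 𝓔} {C 𝒞 : Submodule ℂ 𝓔} {N e : 𝓔}

theorem mul_mem_centSub (h𝒞l : ∀ g ∈ H, ∀ c ∈ 𝒞, g * c ∈ 𝒞) {m x : 𝓔} (hm : m ∈ centAlg H N)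
    (hx : x ∈ centSub 𝒞 N) : m * x ∈ centSub 𝒞 N := by
  obtain ⟨h1, h2⟩ := mem_centAlg.1 hm
  refine ⟨h𝒞l m h1 x hx.1, ?_⟩
  linear_combination (norm := noncomm_ring) h2 * x + m * hx.2

theorem mem_centSub_mul (h𝒞r : ∀ g ∈ H, ∀ c ∈ 𝒞, c * g ∈ 𝒞) {m x : 𝓔} (hm : m ∈ centAlg H N)
    (hx : x ∈ centSub 𝒞 N) : x * m ∈ centSub 𝒞 N := by
  obtain ⟨h1, h2⟩ := mem_centAlg.1 hm
  refine ⟨h𝒞r m h1 x hx.1, ?_⟩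
  linear_combination (norm := noncomm_ring) hx.2 * m + x * h2

/-- The linear condition: for some block diagonal `d ∈ C`, the map `u ↦ u d - d u` from the upper
right block of `M` to the upper right block of `C` is surjective. -/
def SurjComm (M : Subalgebra ℂ 𝓔) (C : Submodule ℂ 𝓔) (e : 𝓔) : Prop :=
  ∃ d ∈ lowerSub C e ⊓ upperSub C e, ∀ x ∈ C, ∃ u ∈ offDiag M e, u * d - d * u = e * x * (1 - e)

theorem smul_mem_conjSet {X : Set 𝓔} {D : Submodule ℂ 𝓔} (c : ℂ) {B : 𝓔}
    (hB : B ∈ conjSet X (D : Set 𝓔)) : c • B ∈ conjSet X (D : Set 𝓔) := by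
  obtain ⟨g, h, hg, hgh, hhg, d, hd, rfl⟩ := hB
  exact ⟨g, h, hg, hgh, hhg, c • d, D.smul_mem c hd, by rw [mul_smul_comm, smul_mul_assoc]⟩

theorem triangPairs_subset (𝒞 : Submodule ℂ 𝓔) (N e : 𝓔) :
    triangPairs H 𝒞 N e ⊆ zclosure (orbitPairs H 𝒞 N) := fun _ h => h.1

variable [FiniteDimensional ℂ 𝓔]

/-- The first equality of the theorem, from the density of the big cell in the units of `M`. -/
theorem zclosure_conjSet_lowerSub (he : IsIdempotentElem e) (heM : e ∈ M)
    (hl : ∀ m ∈ M, ∀ x ∈ C, m * x ∈ C) (hr : ∀ m ∈ M, ∀ x ∈ C, x * m ∈ C) :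
    zclosure (conjSet (M : Set 𝓔) (lowerSub C e)) =
      zclosure (conjSet (unipSet M e) (lowerSub C e)) := by
  refine Set.Subset.antisymm (zclosure_subset_of_subset
    (conjSet_subset_zclosure_unipSet he heM (lowerSub C e) ?_))
    (zclosure_mono (conjSet_mono (unipSet_subset M e) subset_rfl))
  rintro p ⟨hpM, hp⟩ q ⟨hqM, hq⟩ d ⟨hdC, hd⟩
  exact ⟨hr _ hqM _ (hl _ hpM _ hdC), lower_mul (lower_mul hp hd) hq⟩

/-- The second equality of the theorem, from the Levi decomposition. -/
theorem conjSet_triang_lower_inf_upper (he : IsIdempotentElem e) (heM : e ∈ M)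
    (hl : ∀ m ∈ M, ∀ x ∈ C, m * x ∈ C) (hr : ∀ m ∈ M, ∀ x ∈ C, x * m ∈ C) :
    conjSet (triang M he.one_sub : Set 𝓔) (lowerSub C e ⊓ upperSub C e : Submodule ℂ 𝓔) =
      conjSet (unipSet M e) (lowerSub C e ⊓ upperSub C e : Submodule ℂ 𝓔) := by
  refine conjSet_triang_eq_unipSet he heM _ fun l hlM k hkM hel hek d hd => ?_
  have h1 : ∀ z : 𝓔, e * z = z * e → e * z * e = e * z := fun z hz => by
    linear_combination (norm := noncomm_ring) hz * e + z * he.eq - hz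
  have h2 : ∀ z : 𝓔, e * z = z * e → e * z * e = z * e := fun z hz => (h1 z hz).trans hz
  exact ⟨⟨hr _ hkM _ (hl _ hlM _ hd.1.1), lower_mul (lower_mul (h1 l hel) hd.1.2) (h1 k hek)⟩,
    ⟨hr _ hkM _ (hl _ hlM _ hd.1.1), upper_mul (upper_mul (h2 l hel) hd.2.2) (h2 k hek)⟩⟩

/-- Density in `C` is the condition `SurjComm`: the differential of `(u, d) ↦ (1 + u) d (1 - u)`
only depends on the diagonal blocks of `d`. -/
theorem subset_zclosure_lowerSub_iff (he : IsIdempotentElem e) (heM : e ∈ M)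
    (hl : ∀ m ∈ M, ∀ x ∈ C, m * x ∈ C) (hr : ∀ m ∈ M, ∀ x ∈ C, x * m ∈ C) :
    (C : Set 𝓔) ⊆ zclosure (conjSet (unipSet M e) (lowerSub C e)) ↔ SurjComm M C e := by
  have hee := he.eq
  have heM' : 1 - e ∈ M := M.sub_mem M.one_mem heM
  rw [subset_zclosure_unipSet_iff (D := lowerSub C e) (E := C) (fun x hx => hx.1)
    (fun u hu x hx => hr _ (M.sub_mem M.one_mem hu.1) _ (hl _ (M.add_mem M.one_mem hu.1) _ hx))
    (fun u hu x hx => C.sub_mem (hl _ hu.1 _ hx) (hr _ hu.1 _ hx))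
    (fun x hx h => ⟨hx, by linear_combination (norm := noncomm_ring) -h⟩)
    (fun x hx => by linear_combination (norm := noncomm_ring) -hx.2)]
  constructor
  · rintro ⟨d, hd, h⟩
    -- the lower left block of `d` does not contribute to the upper right block of `u d - d u`
    have hd' : e * d * e + (1 - e) * d * (1 - e) ∈ C :=
      C.add_mem (hr _ heM _ (hl _ heM _ hd.1)) (hr _ heM' _ (hl _ heM' _ hd.1))
    refine ⟨_, mem_lower_inf_upper.2 ⟨hd', ?_, levi_comm he d⟩, fun x hx => ?_⟩
    · rw [levi_comm he d, mul_assoc, hee]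
    · obtain ⟨u, hu, hux⟩ := h x hx
      refine ⟨u, hu, ?_⟩
      linear_combination (norm := noncomm_ring) hux + hu.2.2 * d * e - hu.2.2 * d * (1 - e)
        - e * d * hu.2.1 + (1 - e) * d * hu.2.1 - hu.2.1 * d * (1 - e) - e * d * hu.2.2
  · rintro ⟨d, hd, h⟩
    refine ⟨d, hd.1, fun x hx => ?_⟩
    obtain ⟨u, hu, hux⟩ := h x hx
    refine ⟨u, hu, ?_⟩
    rw [hux]
    linear_combination (norm := noncomm_ring) hee * x * (1 - e) * (1 - e) + e * x * hee

/-- Density in the upper triangular part of `C` is the condition `SurjComm` too. -/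
theorem upperSub_subset_zclosure_iff (he : IsIdempotentElem e) (heM : e ∈ M)
    (hl : ∀ m ∈ M, ∀ x ∈ C, m * x ∈ C) (hr : ∀ m ∈ M, ∀ x ∈ C, x * m ∈ C) :
    (upperSub C e : Set 𝓔) ⊆ zclosure (conjSet (unipSet M e)
      (lowerSub C e ⊓ upperSub C e : Submodule ℂ 𝓔)) ↔ SurjComm M C e := by
  have hee := he.eq
  have heM' : 1 - e ∈ M := M.sub_mem M.one_mem heM
  have hup : ∀ u ∈ offDiag M e, e * u * e = u * e := fun u hu => by rw [hu.2.1]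
  have h1 : ∀ u : 𝓔, e * u * e = u * e → e * (1 + u) * e = (1 + u) * e := fun u hu => by
    linear_combination (norm := noncomm_ring) hu + hee
  have h2 : ∀ u : 𝓔, e * u * e = u * e → e * (1 - u) * e = (1 - u) * e := fun u hu => by
    linear_combination (norm := noncomm_ring) -hu + hee
  rw [subset_zclosure_unipSet_iff (D := lowerSub C e ⊓ upperSub C e) (E := upperSub C e)
      inf_le_right
    (fun u hu x hx => ⟨hr _ (M.sub_mem M.one_mem hu.1) _ (hl _ (M.add_mem M.one_mem hu.1) _ hx.1),
      upper_mul (upper_mul (h1 u (hup u hu)) hx.2) (h2 u (hup u hu))⟩)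
    (fun u hu x hx => (upperSub C e).sub_mem ⟨hl _ hu.1 _ hx.1, upper_mul (hup u hu) hx.2⟩
      ⟨hr _ hu.1 _ hx.1, upper_mul hx.2 (hup u hu)⟩)
    (fun x hx h => ⟨⟨hx.1, by linear_combination (norm := noncomm_ring) -h⟩, hx⟩)
    (fun x hx => by linear_combination (norm := noncomm_ring) -hx.1.2)]
  refine exists_congr fun d => and_congr_right fun hd => ?_
  have hdC : ∀ u ∈ offDiag M e, e * (u * d - d * u) * (1 - e) = u * d - d * u := fun u hu => by
    have hde := hd.1.2.symm.trans hd.2.2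
    linear_combination (norm := noncomm_ring) hu.2.1 * d - hu.2.1 * d * e - hde * u * (1 - e)
      - d * hu.2.1 * (1 - e) + u * hde - hu.2.2 * d + d * hu.2.2
  constructor
  · intro h x hx
    obtain ⟨u, hu, hux⟩ := h (e * x * (1 - e)) ⟨hr _ heM' _ (hl _ heM _ hx), by
      linear_combination (norm := noncomm_ring) hee * x * (1 - e) * e⟩
    refine ⟨u, hu, ?_⟩
    rw [← hdC u hu, hux]
    linear_combination (norm := noncomm_ring) hee * x * (1 - e) * (1 - e) + e * x * hee
  · intro h x hx
    obtain ⟨u, hu, hux⟩ := h x hx.1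
    exact ⟨u, hu, by rw [hdC u hu, hux]⟩

theorem conjPair_subset_zclosure {F G : Set (𝓔 × 𝓔)}
    (h : F ⊆ zclosure (conjPair (H : Set 𝓔) G)) :
    conjPair (H : Set 𝓔) F ⊆ zclosure (conjPair (H : Set 𝓔) G) :=
  (conjPair_mono subset_rfl h).trans ((conjPair_zclosure _ _).trans
    (zclosure_mono (conjPair_conjPair H G)))

/-- The first form of the condition LC is a density statement in the fibre above `N`. Density
passes from the fibre to the whole variety by homogeneity, and back by `mem_zclosure_of_slice`. -/
theorem denseIn_conjPair_iff (h𝒞l : ∀ g ∈ H, ∀ c ∈ 𝒞, g * c ∈ 𝒞)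
    (h𝒞r : ∀ g ∈ H, ∀ c ∈ 𝒞, c * g ∈ 𝒞) (he : IsIdempotentElem e) (heH : e ∈ H)
    (hN : e * N = N * e) :
    DenseIn (conjPair (H : Set 𝓔) (zclosure (triangPairs H 𝒞 N (1 - e))))
      (zclosure (orbitPairs H 𝒞 N)) ↔
    (centSub 𝒞 N : Set 𝓔) ⊆
      zclosure (conjSet (centAlg H N : Set 𝓔) (lowerSub (centSub 𝒞 N) e)) := by
  have hN' : (1 - e) * N = N * (1 - e) := by linear_combination (norm := noncomm_ring) -hN
  have hT := triangPairs_eq h𝒞l h𝒞r he.one_sub (H.sub_mem H.one_mem heH) hN'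
  rw [upperSub_one_sub] at hT
  have hT1 : triangPairs H 𝒞 N (1 - e) ⊆
      conjPair (H : Set 𝓔) (fiberSet N (lowerSub (centSub 𝒞 N) e)) := by
    rw [hT]
    exact conjPair_mono (fun p hp => hp.1) subset_rfl
  have hT2 : fiberSet N (lowerSub (centSub 𝒞 N) e) ⊆ triangPairs H 𝒞 N (1 - e) := by
    rw [hT]
    exact subset_conjPair _ _
  constructor
  · rintro ⟨-, hd⟩ B hB
    have h1 : (N, B) ∈ zclosure (conjPair (H : Set 𝓔) (fiberSet N (lowerSub (centSub 𝒞 N) e))) :=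
      zclosure_subset_of_subset ((conjPair_zclosure _ _).trans (zclosure_subset_of_subset
        (conjPair_subset_zclosure (hT1.trans (subset_zclosure _)))))
        (hd (subset_zclosure _ (subset_conjPair H _ ⟨rfl, hB⟩)))
    refine mem_zclosure_of_slice H N (fun c _ => smul_mem_conjSet c) ?_ ?_ h1
    · rintro _ ⟨g, h, hg, hgh, hhg, ⟨A, B⟩, ⟨hA, -⟩, rfl⟩
      obtain rfl : A = N := hA
      refine subset_zclosure _ ⟨h, g, inv_mem_subalgebra H hg hhg, hhg, hgh, ?_⟩
      linear_combination (norm := noncomm_ring) hhg * A * h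
    · rintro _ ⟨g, h, hg, hgh, hhg, ⟨A, B⟩, ⟨hA, hB⟩, rfl⟩ k l hk hkl hlk hkN
      obtain rfl : A = N := hA
      dsimp only at hkN ⊢
      refine ⟨k * g, h * l, mem_centAlg.2 ⟨H.mul_mem hk hg, ?_⟩, ?_, ?_, B, hB, ?_⟩
      · linear_combination (norm := noncomm_ring) -(hkN * g) + k * g * A * hhg
      · linear_combination (norm := noncomm_ring) k * hgh * l + hkl
      · linear_combination (norm := noncomm_ring) h * hlk * g + hhg
      · simp only [mul_assoc]
  · intro h
    refine ⟨(conjPair_zclosure _ _).trans (zclosure_subset_of_subset (conjPair_subset_zclosure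
      (triangPairs_subset 𝒞 N (1 - e)))), zclosure_subset_of_subset (conjPair_subset_zclosure ?_)⟩
    exact (fiberSet_subset_zclosure_conjPair (fun m hm => (mem_centAlg.1 hm).1)
      (fun m hm => (mem_centAlg.1 hm).2) h).trans
      (zclosure_mono (conjPair_mono subset_rfl (hT2.trans (subset_zclosure _))))

/-- The second form of the condition LC is a density statement in the fibre above `N`, under the
parabolic group. -/
theorem denseIn_conjPair_triang_iff (h𝒞l : ∀ g ∈ H, ∀ c ∈ 𝒞, g * c ∈ 𝒞)
    (h𝒞r : ∀ g ∈ H, ∀ c ∈ 𝒞, c * g ∈ 𝒞) (he : IsIdempotentElem e) (heH : e ∈ H)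
    (hN : e * N = N * e) :
    DenseIn (conjPair (triang H he.one_sub : Set 𝓔)
        (zclosure (triangPairs H 𝒞 N e) ∩ zclosure (triangPairs H 𝒞 N (1 - e))))
      (zclosure (triangPairs H 𝒞 N e)) ↔
    (upperSub (centSub 𝒞 N) e : Set 𝓔) ⊆
      zclosure (conjSet (triang (centAlg H N) he.one_sub : Set 𝓔)
        (lowerSub (centSub 𝒞 N) e ⊓ upperSub (centSub 𝒞 N) e : Submodule ℂ 𝓔)) := by
  have hN' : (1 - e) * N = N * (1 - e) := by linear_combination (norm := noncomm_ring) -hN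
  have hT := triangPairs_eq h𝒞l h𝒞r he heH hN
  have hT' := triangPairs_eq h𝒞l h𝒞r he.one_sub (H.sub_mem H.one_mem heH) hN'
  rw [upperSub_one_sub] at hT'
  have h0 : conjPair (triang H he.one_sub : Set 𝓔)
        (zclosure (triangPairs H 𝒞 N e) ∩ zclosure (triangPairs H 𝒞 N (1 - e))) ⊆
      zclosure (triangPairs H 𝒞 N e) := by
    refine (conjPair_mono subset_rfl Set.inter_subset_left).trans ?_
    rw [hT]
    exact conjPair_subset_zclosure subset_rfl
  constructor
  · rintro ⟨-, hd⟩ B hB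
    have hB' : (N, B) ∈ triangPairs H 𝒞 N e := by
      rw [hT]
      exact subset_conjPair _ _ ⟨rfl, hB⟩
    refine mem_zclosure_of_slice (triang H he.one_sub) N (fun c _ => smul_mem_conjSet c) ?_ ?_
      (hd (subset_zclosure _ hB'))
    · intro p hp
      refine (isRegular_linearMap (LinearMap.fst ℂ 𝓔 𝓔)).mapsTo_zclosure
        (T := conjTo (triang H he.one_sub : Set 𝓔) N) ?_ (h0 hp)
      rw [hT]
      rintro _ ⟨g, h, hg, hgh, hhg, ⟨A, B⟩, ⟨hA, -⟩, rfl⟩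
      obtain rfl : A = N := hA
      refine subset_zclosure _ ⟨h, g, inv_mem_subalgebra _ hg hhg, hhg, hgh, ?_⟩
      change h * (g * A * h) = A * h
      linear_combination (norm := noncomm_ring) hhg * A * h
    · rintro _ ⟨g, h, hg, hgh, hhg, ⟨A, B⟩, ⟨hZ, hZ'⟩, rfl⟩ p q hp hpq hqp hpN
      dsimp only at hpN ⊢
      have hAB : A * B = B * A := commute_of_mem_zclosure_orbitPairs
        (zclosure_subset_of_subset (triangPairs_subset 𝒞 N e) hZ)
      have hB𝒞 : B ∈ 𝒞 := mem_of_mem_zclosure_orbitPairs h𝒞l h𝒞r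
        (zclosure_subset_of_subset (triangPairs_subset 𝒞 N e) hZ)
      -- `A` and `B` are both upper and lower triangular
      have hup : ∀ {f : 𝓔} {p : 𝓔 × 𝓔}, p ∈ zclosure (triangPairs H 𝒞 N f) →
          f * p.1 * f = p.1 * f ∧ f * p.2 * f = p.2 * f := by
        intro f p hp
        have h1 : zclosure (triangPairs H 𝒞 N f) ⊆
            (upperSub ⊤ f).prod (upperSub (⊤ : Submodule ℂ 𝓔) f) :=
          zclosure_submodule_subset _ fun p hp => ⟨⟨trivial, hp.2.1⟩, ⟨trivial, hp.2.2.1⟩⟩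
        exact ⟨(h1 hp).1.2, (h1 hp).2.2⟩
      have hlow : ∀ {z : 𝓔}, (1 - e) * z * (1 - e) = z * (1 - e) → e * z * e = e * z := by
        intro z hz
        linear_combination (norm := noncomm_ring) hz
      obtain ⟨hA1, hB1⟩ : e * A * e = A * e ∧ e * B * e = B * e := hup hZ
      have hA2 : e * A = A * e := (hlow (hup hZ').1).symm.trans hA1
      have hB2 : e * B * e = e * B := hlow (hup hZ').2
      have hP : p * g ∈ triang H he.one_sub := Subalgebra.mul_mem _ hp hg
      have hPQ : p * g * (h * q) = 1 := by
        linear_combination (norm := noncomm_ring) p * hgh * q + hpq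
      have hQP : h * q * (p * g) = 1 := by
        linear_combination (norm := noncomm_ring) h * hqp * g + hhg
      have hPA : p * g * A = N * (p * g) := by
        linear_combination (norm := noncomm_ring) hpN * g - p * g * A * hhg
      -- `P = p g` conjugates `A` to `N`; so does its block diagonal part `l`, as `A` and `N` are
      -- block diagonal, and `P` differs from `l` by an element of the centralizer of `N`
      rw [show p * (g * B * h) * q = p * g * B * (h * q) by simp only [mul_assoc]]
      generalize p * g = P at hP hPQ hQP hPA
      generalize h * q = Q at hPQ hQP
      have hQ := inv_mem_subalgebra _ hP hQP
      obtain ⟨hPH, hPe⟩ := (mem_triang_one_sub he).1 hP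
      obtain ⟨hQH, hQe⟩ := (mem_triang_one_sub he).1 hQ
      have hlk : (e * P * e + (1 - e) * P * (1 - e)) * (e * Q * e + (1 - e) * Q * (1 - e)) = 1 := by
        rw [levi_mul he hPe hQe, hPQ, levi_one he]
      have hkl : (e * Q * e + (1 - e) * Q * (1 - e)) * (e * P * e + (1 - e) * P * (1 - e)) = 1 := by
        rw [levi_mul he hQe hPe, hQP, levi_one he]
      have hNe : e * N * e = N * e := by
        linear_combination (norm := noncomm_ring) hN * e + N * he.eq
      have hlA : (e * P * e + (1 - e) * P * (1 - e)) * A =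
          N * (e * P * e + (1 - e) * P * (1 - e)) := by
        have h1 := levi_mul he hPe hA1
        rw [hPA, ← levi_mul he hNe hPe, levi_eq_self he hA2, levi_eq_self he hN] at h1
        exact h1
      have hl := levi_mem heH hPH
      have hk := levi_mem heH hQH
      have hel := levi_comm he P
      have hek := levi_comm he Q
      generalize e * P * e + (1 - e) * P * (1 - e) = l at hlk hkl hlA hl hel
      generalize e * Q * e + (1 - e) * Q * (1 - e) = k at hlk hkl hk hek
      have hAk : A * k = k * N := by
        linear_combination (norm := noncomm_ring) -(hkl * A * k) + k * hlA * k + k * N * hlk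
      have h1 : ∀ z : 𝓔, e * z = z * e → e * z * e = e * z := fun z hz => by
        linear_combination (norm := noncomm_ring) hz * e + z * he.eq - hz
      have h2 : ∀ z : 𝓔, e * z = z * e → e * z * e = z * e := fun z hz => (h1 z hz).trans hz
      have hBC : l * B * k ∈ centSub 𝒞 N := by
        refine ⟨h𝒞r _ hk _ (h𝒞l _ hl _ hB𝒞), ?_⟩
        linear_combination (norm := noncomm_ring) -(hlA * B * k) + l * hAB * k + l * B * hAk
      refine ⟨P * k, l * Q, ⟨mem_centAlg.2 ⟨H.mul_mem hPH hk, ?_⟩, ?_⟩, ?_, ?_, l * B * k,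
        ⟨⟨hBC, lower_mul (lower_mul (h1 l hel) hB2) (h1 k hek)⟩,
          ⟨hBC, upper_mul (upper_mul (h2 l hel) hB1) (h2 k hek)⟩⟩, ?_⟩
      · linear_combination (norm := noncomm_ring) -(hPA * k) + P * hAk
      · have h3 := upper_mul hPe (h2 k hek)
        linear_combination (norm := noncomm_ring) h3
      · linear_combination (norm := noncomm_ring) P * hkl * Q + hPQ
      · linear_combination (norm := noncomm_ring) l * hQP * k + hlk
      · linear_combination (norm := noncomm_ring) -(P * hkl * B * k * l * Q) - P * B * hkl * Q
  · intro h
    refine ⟨h0, zclosure_subset_of_subset ?_⟩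
    nth_rw 1 [hT]
    refine conjPair_subset_zclosure ((fiberSet_subset_zclosure_conjPair
      (H := (triang H he.one_sub : Set 𝓔)) (fun m hm => ⟨(mem_centAlg.1 hm.1).1, hm.2⟩)
      (fun m hm => (mem_centAlg.1 hm.1).2) h).trans
      (zclosure_mono (conjPair_mono subset_rfl ?_)))
    rintro ⟨A, B⟩ ⟨hA, hB⟩
    refine ⟨subset_zclosure _ ?_, subset_zclosure _ ?_⟩
    · rw [hT]
      exact subset_conjPair _ _ ⟨hA, hB.2⟩
    · rw [hT']
      exact subset_conjPair _ _ ⟨hA, hB.1⟩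

end Density

/-! ### Graded vector spaces: homogeneous maps and blocks -/

section Homogeneous

variable {R : Type*} {W : Type*} [AddCommGroup W] [Module ℂ W]

/-- The algebra of the endomorphisms of degree zero of a graded vector space. -/
def homAlg (𝒲 : R → Submodule ℂ W) : Subalgebra ℂ (Module.End ℂ W) where
  carrier := {g | ∀ ρ, ∀ v ∈ 𝒲 ρ, g v ∈ 𝒲 ρ}
  mul_mem' := fun ha hb ρ v hv => ha ρ _ (hb ρ v hv)
  add_mem' := fun ha hb ρ v hv => (𝒲 ρ).add_mem (ha ρ v hv) (hb ρ v hv)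
  algebraMap_mem' := fun r ρ _ hv => (𝒲 ρ).smul_mem r hv

/-- The space `degDown` of the endomorphisms of degree minus one, as a submodule. -/
def downSub (σ : Equiv.Perm R) (𝒲 : R → Submodule ℂ W) : Submodule ℂ (Module.End ℂ W) where
  carrier := degDown σ 𝒲
  add_mem' := fun ha hb ρ v hv => Submodule.add_mem _ (ha ρ v hv) (hb ρ v hv)
  zero_mem' := fun _ _ _ => Submodule.zero_mem _
  smul_mem' := fun r _ ha ρ v hv => Submodule.smul_mem _ r (ha ρ v hv)

variable {𝒲 : R → Submodule ℂ W} {σ : Equiv.Perm R}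

theorem mul_mem_downSub : ∀ g ∈ homAlg 𝒲, ∀ c ∈ downSub σ 𝒲, g * c ∈ downSub σ 𝒲 :=
  fun _ hg _ hc ρ v hv => hg _ _ (hc ρ v hv)

theorem mem_downSub_mul : ∀ g ∈ homAlg 𝒲, ∀ c ∈ downSub σ 𝒲, c * g ∈ downSub σ 𝒲 :=
  fun _ hg _ hc ρ v hv => hc _ _ (hg ρ v hv)

theorem coe_mul_symm (g : W ≃ₗ[ℂ] W) : (g : Module.End ℂ W) * (g.symm : Module.End ℂ W) = 1 := by
  ext; simp

theorem symm_mul_coe (g : W ≃ₗ[ℂ] W) : (g.symm : Module.End ℂ W) * (g : Module.End ℂ W) = 1 := by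
  ext; simp

theorem conj_eq_mul (g : W ≃ₗ[ℂ] W) (A : Module.End ℂ W) :
    g.conj A = (g : Module.End ℂ W) * A * (g.symm : Module.End ℂ W) := rfl

theorem exists_linearEquiv {g h : Module.End ℂ W} (hgh : g * h = 1) (hhg : h * g = 1) :
    ∃ k : W ≃ₗ[ℂ] W, (k : Module.End ℂ W) = g ∧ (k.symm : Module.End ℂ W) = h :=
  ⟨LinearEquiv.ofLinearMap g h hgh hhg, rfl, rfl⟩

theorem orb_eq_conjSet {X : Set (W ≃ₗ[ℂ] W)} {Y : Set (Module.End ℂ W)}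
    (hXY : ∀ g, g ∈ X ↔ (g : Module.End ℂ W) ∈ Y) (S : Set (Module.End ℂ W)) :
    orb X S = conjSet Y S := by
  ext T
  constructor
  · rintro ⟨g, hg, A, hA, rfl⟩
    exact ⟨g, g.symm, (hXY g).1 hg, coe_mul_symm g, symm_mul_coe g, A, hA, rfl⟩
  · rintro ⟨g, h, hg, hgh, hhg, A, hA, rfl⟩
    obtain ⟨k, rfl, rfl⟩ := exists_linearEquiv hgh hhg
    exact ⟨k, (hXY k).2 hg, A, hA, rfl⟩

theorem orbPair_eq_conjPair {X : Set (W ≃ₗ[ℂ] W)} {Y : Set (Module.End ℂ W)}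
    (hXY : ∀ g, g ∈ X ↔ (g : Module.End ℂ W) ∈ Y) (S : Set (Module.End ℂ W × Module.End ℂ W)) :
    orbPair X S = conjPair Y S := by
  ext T
  constructor
  · rintro ⟨g, hg, A, hA, rfl⟩
    exact ⟨g, g.symm, (hXY g).1 hg, coe_mul_symm g, symm_mul_coe g, A, hA, rfl⟩
  · rintro ⟨g, h, hg, hgh, hhg, A, hA, rfl⟩
    obtain ⟨k, rfl, rfl⟩ := exists_linearEquiv hgh hhg
    exact ⟨k, (hXY k).2 hg, A, hA, rfl⟩

variable [FiniteDimensional ℂ W]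

theorem mem_gradedAut_iff (g : W ≃ₗ[ℂ] W) :
    g ∈ gradedAut 𝒲 ↔ (g : Module.End ℂ W) ∈ homAlg 𝒲 := by
  constructor
  · intro hg ρ v hv
    rw [← hg ρ]
    exact ⟨v, hv, rfl⟩
  · intro hg ρ
    have hg' := inv_mem_subalgebra _ hg (symm_mul_coe g)
    refine le_antisymm (by rintro _ ⟨v, hv, rfl⟩; exact hg ρ v hv) fun v hv =>
      ⟨g.symm v, hg' ρ v hv, by simp⟩

theorem mem_stab_iff (A : Module.End ℂ W) (g : W ≃ₗ[ℂ] W) :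
    g ∈ stab 𝒲 A ↔ (g : Module.End ℂ W) ∈ centAlg (homAlg 𝒲) A := by
  rw [mem_centAlg, ← mem_gradedAut_iff]
  refine and_congr_right fun _ => ?_
  rw [conj_eq_mul]
  have h1 := coe_mul_symm g
  have h2 := symm_mul_coe g
  constructor
  · intro h
    linear_combination (norm := noncomm_ring) -(h * (g : Module.End ℂ W)) +
      (g : Module.End ℂ W) * A * h2
  · intro h
    linear_combination (norm := noncomm_ring) -(h * (g.symm : Module.End ℂ W)) + A * h1

end Homogeneous

section Blocks

variable (V V' : Type*) [AddCommGroup V] [Module ℂ V] [AddCommGroup V'] [Module ℂ V']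

/-- The projection of `V ⊕ V'` onto `V`. -/
def proj : Module.End ℂ (V × V') := LinearMap.inl ℂ V V' ∘ₗ LinearMap.fst ℂ V V'

variable {V V'}

theorem proj_apply (w : V × V') : proj V V' w = (w.1, 0) := rfl

theorem one_sub_proj_apply (w : V × V') : (1 - proj V V') w = (0, w.2) := by
  change w - (w.1, 0) = _
  ext <;> simp

theorem isIdempotentElem_proj : IsIdempotentElem (proj V V') := rfl

theorem mem_presFst_iff (A : Module.End ℂ (V × V')) :
    A ∈ presFst V V' ↔ proj V V' * A * proj V V' = A * proj V V' := by
  constructor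
  · intro h
    refine LinearMap.ext fun w => Prod.ext rfl ?_
    exact (h w.1).symm
  · intro h v
    exact (congrArg Prod.snd (LinearMap.congr_fun h (v, 0))).symm

theorem mem_presSnd_iff (A : Module.End ℂ (V × V')) :
    A ∈ presSnd V V' ↔ proj V V' * A * proj V V' = proj V V' * A := by
  constructor
  · intro h
    refine LinearMap.ext fun w => Prod.ext ?_ rfl
    change (A (w.1, 0)).1 = (A w).1
    have h1 : A w = A (w.1, 0) + A (0, w.2) := by rw [← map_add]; simp
    rw [h1, Prod.fst_add, h, add_zero]
  · intro h v
    have := congrArg Prod.fst (LinearMap.congr_fun h (0, v))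
    refine Eq.trans this.symm ?_
    change (A (0, 0)).1 = 0
    rw [Prod.mk_zero_zero, map_zero]
    rfl

theorem levi_eq_prodMap (A : Module.End ℂ (V × V')) :
    proj V V' * A * proj V V' + (1 - proj V V') * A * (1 - proj V V') =
      (blockFst A).prodMap (blockSnd A) := by
  refine LinearMap.ext fun w => ?_
  simp only [LinearMap.add_apply, Module.End.mul_apply, one_sub_proj_apply, proj_apply,
    LinearMap.prodMap_apply]
  ext <;> simp [blockFst, blockSnd]

theorem proj_mul_prodMap (A : Module.End ℂ V) (A' : Module.End ℂ V') :
    proj V V' * A.prodMap A' = A.prodMap A' * proj V V' := by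
  ext <;> simp [proj]

theorem prodMap_injective {A B : Module.End ℂ V} {A' B' : Module.End ℂ V'}
    (h : A.prodMap A' = B.prodMap B') : A = B ∧ A' = B' :=
  ⟨LinearMap.ext fun v => congrArg Prod.fst (LinearMap.congr_fun h (v, 0)),
    LinearMap.ext fun v => congrArg Prod.snd (LinearMap.congr_fun h (0, v))⟩

theorem prodMap_mul_prodMap (A B : Module.End ℂ V) (A' B' : Module.End ℂ V') :
    A.prodMap A' * B.prodMap B' = (A * B).prodMap (A' * B') := rfl

theorem eq_prodMap_of_commute {l : Module.End ℂ (V × V')} (h : proj V V' * l = l * proj V V') :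
    l = (blockFst l).prodMap (blockSnd l) := by
  rw [← levi_eq_prodMap, levi_eq_self isIdempotentElem_proj h]

variable {R : Type*} {𝒱 : R → Submodule ℂ V} {𝒱' : R → Submodule ℂ V'}

theorem proj_mem_homAlg : proj V V' ∈ homAlg (sumGrading 𝒱 𝒱') :=
  fun ρ _ hv => ⟨hv.1, (𝒱' ρ).zero_mem⟩

theorem prodMap_mem_homAlg {g : Module.End ℂ V} {g' : Module.End ℂ V'} (hg : g ∈ homAlg 𝒱)
    (hg' : g' ∈ homAlg 𝒱') : g.prodMap g' ∈ homAlg (sumGrading 𝒱 𝒱') :=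
  fun ρ _ hv => ⟨hg ρ _ hv.1, hg' ρ _ hv.2⟩

theorem blockFst_mem_homAlg {g : Module.End ℂ (V × V')} (hg : g ∈ homAlg (sumGrading 𝒱 𝒱')) :
    blockFst g ∈ homAlg 𝒱 := fun ρ v hv => (hg ρ (v, 0) ⟨hv, (𝒱' ρ).zero_mem⟩).1

theorem blockSnd_mem_homAlg {g : Module.End ℂ (V × V')} (hg : g ∈ homAlg (sumGrading 𝒱 𝒱')) :
    blockSnd g ∈ homAlg 𝒱' := fun ρ v hv => (hg ρ (0, v) ⟨(𝒱 ρ).zero_mem, hv⟩).2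

theorem blockFst_mem_degDown {σ : Equiv.Perm R} {g : Module.End ℂ (V × V')}
    (hg : g ∈ degDown σ (sumGrading 𝒱 𝒱')) : blockFst g ∈ degDown σ 𝒱 :=
  fun ρ v hv => (hg ρ (v, 0) ⟨hv, (𝒱' ρ).zero_mem⟩).1

theorem blockSnd_mem_degDown {σ : Equiv.Perm R} {g : Module.End ℂ (V × V')}
    (hg : g ∈ degDown σ (sumGrading 𝒱 𝒱')) : blockSnd g ∈ degDown σ 𝒱' :=
  fun ρ v hv => (hg ρ (0, v) ⟨(𝒱 ρ).zero_mem, hv⟩).2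

/-- Conjugacy of a block diagonal endomorphism to `A ⊕ A'` under block diagonal automorphisms is
conjugacy of the blocks. -/
theorem exists_levi_conj_iff (A : Module.End ℂ V) (A' : Module.End ℂ V')
    (T : Module.End ℂ (V × V')) :
    (∃ l k, l ∈ homAlg (sumGrading 𝒱 𝒱') ∧ l * k = 1 ∧ k * l = 1 ∧
      proj V V' * l = l * proj V V' ∧
      l * (blockFst T).prodMap (blockSnd T) = A.prodMap A' * l) ↔
    blockFst T ∈ conjTo (homAlg 𝒱 : Set (Module.End ℂ V)) A ∧
      blockSnd T ∈ conjTo (homAlg 𝒱' : Set (Module.End ℂ V')) A' := by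
  constructor
  · rintro ⟨l, k, hl, hlk, hkl, hel, hlT⟩
    have hek : proj V V' * k = k * proj V V' := by
      linear_combination (norm := noncomm_ring) -(hkl * proj V V' * k) + k * proj V V' * hlk
        - k * hel * k
    have hl1 := eq_prodMap_of_commute hel
    have hk1 := eq_prodMap_of_commute hek
    have h1 := blockFst_mem_homAlg hl
    have h2 := blockSnd_mem_homAlg hl
    generalize blockFst l = l1 at hl1 h1
    generalize blockSnd l = l2 at hl1 h2
    generalize blockFst k = k1 at hk1
    generalize blockSnd k = k2 at hk1
    subst hl1 hk1
    obtain ⟨h3, h4⟩ := prodMap_injective (A := l1 * k1) (A' := l2 * k2) (B := 1) (B' := 1) hlk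
    obtain ⟨h5, h6⟩ := prodMap_injective (A := k1 * l1) (A' := k2 * l2) (B := 1) (B' := 1) hkl
    obtain ⟨h7, h8⟩ := prodMap_injective (A := l1 * blockFst T) (A' := l2 * blockSnd T)
      (B := A * l1) (B' := A' * l2) hlT
    exact ⟨⟨l1, k1, h1, h3, h5, h7⟩, ⟨l2, k2, h2, h4, h6, h8⟩⟩
  · rintro ⟨⟨l1, k1, h1, h3, h5, h7⟩, ⟨l2, k2, h2, h4, h6, h8⟩⟩
    refine ⟨l1.prodMap l2, k1.prodMap k2, prodMap_mem_homAlg h1 h2, ?_, ?_, proj_mul_prodMap _ _,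
        ?_⟩
    · rw [prodMap_mul_prodMap, h3, h4]; rfl
    · rw [prodMap_mul_prodMap, h5, h6]; rfl
    · rw [prodMap_mul_prodMap, prodMap_mul_prodMap, h7, h8]

variable (A : Module.End ℂ V) (A' : Module.End ℂ V') (σ : Equiv.Perm R)

theorem cFst_eq : cFst σ 𝒱 𝒱' A A' =
    (upperSub (centSub (downSub σ (sumGrading 𝒱 𝒱')) (A.prodMap A')) (proj V V') : Set _) :=
  Set.ext fun B => and_congr_right fun _ => mem_presFst_iff B

theorem cSnd_eq : cSnd σ 𝒱 𝒱' A A' =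
    (lowerSub (centSub (downSub σ (sumGrading 𝒱 𝒱')) (A.prodMap A')) (proj V V') : Set _) :=
  Set.ext fun B => and_congr_right fun _ => mem_presSnd_iff B

theorem cBoth_eq : cBoth σ 𝒱 𝒱' A A' =
    (lowerSub (centSub (downSub σ (sumGrading 𝒱 𝒱')) (A.prodMap A')) (proj V V') ⊓
    upperSub (centSub (downSub σ (sumGrading 𝒱 𝒱')) (A.prodMap A')) (proj V V') :
      Submodule ℂ _) := by
  rw [cBoth, cFst_eq, cSnd_eq, Set.inter_comm]
  rfl

variable [FiniteDimensional ℂ V] [FiniteDimensional ℂ V']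

theorem map_range_inl_iff (g : (V × V') ≃ₗ[ℂ] (V × V')) :
    (LinearMap.range (LinearMap.inl ℂ V V')).map (g : (V × V') →ₗ[ℂ] (V × V')) =
      LinearMap.range (LinearMap.inl ℂ V V') ↔
    proj V V' * (g : Module.End ℂ (V × V')) * proj V V' = (g : Module.End ℂ (V × V')) * proj V V'
        := by
  rw [← mem_presFst_iff]
  have key : ∀ k : (V × V') ≃ₗ[ℂ] (V × V'), (k : Module.End ℂ (V × V')) ∈ presFst V V' →
      (LinearMap.range (LinearMap.inl ℂ V V')).map (k : (V × V') →ₗ[ℂ] (V × V')) ≤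
      LinearMap.range (LinearMap.inl ℂ V V') := by
    rintro k hk _ ⟨_, ⟨v, rfl⟩, rfl⟩
    exact ⟨(k (v, 0)).1, Prod.ext rfl (hk v).symm⟩
  constructor
  · intro h v
    have h1 : g (v, 0) ∈ (LinearMap.range (LinearMap.inl ℂ V V')).map
      (g : (V × V') →ₗ[ℂ] (V × V')) := ⟨(v, 0), ⟨v, rfl⟩, rfl⟩
    rw [h] at h1
    obtain ⟨w, hw⟩ := h1
    exact (congrArg Prod.snd hw).symm
  · intro h
    have h2 : (g.symm : Module.End ℂ (V × V')) ∈ presFst V V' := by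
      rw [mem_presFst_iff] at h ⊢
      have h3 := inv_mem_subalgebra (triang ⊤ isIdempotentElem_proj.one_sub)
        ((mem_triang_one_sub isIdempotentElem_proj).2 ⟨trivial, h⟩) (symm_mul_coe g)
      exact ((mem_triang_one_sub isIdempotentElem_proj).1 h3).2
    refine le_antisymm (key g h) fun w hw => ⟨g.symm w, key g.symm h2 ⟨w, hw, rfl⟩, by simp⟩

theorem mem_parab_iff (g : (V × V') ≃ₗ[ℂ] (V × V')) :
    g ∈ parab 𝒱 𝒱' ↔ (g : Module.End ℂ (V × V')) ∈
      (triang (homAlg (sumGrading 𝒱 𝒱')) isIdempotentElem_proj.one_sub : Set _) := by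
  rw [SetLike.mem_coe, mem_triang_one_sub isIdempotentElem_proj, ← mem_gradedAut_iff, ←
      map_range_inl_iff]
  rfl

theorem mem_pN_iff (g : (V × V') ≃ₗ[ℂ] (V × V')) :
    g ∈ pN 𝒱 𝒱' A A' ↔ (g : Module.End ℂ (V × V')) ∈
      (triang (centAlg (homAlg (sumGrading 𝒱 𝒱')) (A.prodMap A'))
        isIdempotentElem_proj.one_sub : Set _) := by
  rw [SetLike.mem_coe, mem_triang_one_sub isIdempotentElem_proj, ← mem_stab_iff, ←
      map_range_inl_iff]
  exact ⟨fun h => ⟨h.1, h.2.2⟩, fun h => ⟨h.1, h.1.1, h.2⟩⟩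

theorem mem_uN_iff (g : (V × V') ≃ₗ[ℂ] (V × V')) :
    g ∈ uN 𝒱 𝒱' A A' ↔ (g : Module.End ℂ (V × V')) ∈
      unipSet (centAlg (homAlg (sumGrading 𝒱 𝒱')) (A.prodMap A')) (proj V V') := by
  constructor
  · rintro ⟨h1, -, h2, h3⟩
    refine ⟨(g : Module.End ℂ (V × V')) - 1, ⟨Subalgebra.sub_mem _ ((mem_stab_iff _ g).1 h1)
      (Subalgebra.one_mem _), ?_, ?_⟩, by abel⟩
    · refine LinearMap.ext fun w => Prod.ext rfl ?_
      change 0 = (g w - w).2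
      rw [Prod.snd_sub, h3, sub_self]
    · refine LinearMap.ext fun w => ?_
      change g (w.1, 0) - (w.1, 0) = 0
      rw [h2, sub_self]
  · rintro ⟨u, hu, hg⟩
    have h1 : (g : Module.End ℂ (V × V')) ∈ centAlg (homAlg (sumGrading 𝒱 𝒱')) (A.prodMap A') :=
      unipSet_subset _ _ ⟨u, hu, hg⟩
    have h2 : ∀ w, g w = w + u w := fun w => LinearMap.congr_fun hg w
    refine ⟨(mem_stab_iff _ g).2 h1, ((mem_stab_iff _ g).2 h1).1, fun v => ?_, fun w => ?_⟩
    · have h3 : u (v, 0) = 0 := LinearMap.congr_fun hu.2.2 (v, 0)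
      rw [h2, h3, add_zero]
    · have h3 : 0 = (u w).2 := congrArg Prod.snd (LinearMap.congr_fun hu.2.1 w)
      rw [h2, Prod.snd_add, ← h3, add_zero]

end Blocks

/-! ### Graded Jordan bases and orbits -/

section Homogeneous

variable {R : Type*} {W W' : Type*} [AddCommGroup W] [Module ℂ W] [AddCommGroup W'] [Module ℂ W']
  {𝒲 : R → Submodule ℂ W} {𝒲' : R → Submodule ℂ W'}

/-- The coordinates of a homogeneous vector in a homogeneous basis vanish outside its degree. -/
theorem repr_eq_zero_of_deg_ne (h𝒲 : iSupIndep 𝒲) {κ : Type*} [Fintype κ] (b : Module.Basis κ ℂ W)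
    {deg : κ → R} (hb : ∀ k, b k ∈ 𝒲 (deg k)) {ρ : R} {v : W} (hv : v ∈ 𝒲 ρ) {k : κ}
    (hk : deg k ≠ ρ) : b.repr v k = 0 := by
  classical
  have hsum : v = ∑ k, (if deg k = ρ then b.repr v k else 0) • b k +
      ∑ k, (if deg k = ρ then 0 else b.repr v k) • b k := by
    rw [← Finset.sum_add_distrib]
    conv_lhs => rw [← b.sum_repr v]
    refine Finset.sum_congr rfl fun k _ => ?_
    split_ifs <;> simp
  have h1 : ∑ k, (if deg k = ρ then b.repr v k else 0) • b k ∈ 𝒲 ρ := by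
    refine Submodule.sum_mem _ fun k _ => ?_
    split_ifs with h
    · exact Submodule.smul_mem _ _ (h ▸ hb k)
    · simp
  have h2 : ∑ k, (if deg k = ρ then 0 else b.repr v k) • b k ∈ ⨆ τ, ⨆ _ : τ ≠ ρ, 𝒲 τ := by
    refine Submodule.sum_mem _ fun k _ => ?_
    split_ifs with h
    · simp
    · exact Submodule.smul_mem _ _ (Submodule.mem_iSup_of_mem _ (Submodule.mem_iSup_of_mem h (hb
        k)))
  have h3 : ∑ k, (if deg k = ρ then 0 else b.repr v k) • b k ∈ 𝒲 ρ := by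
    rw [eq_sub_of_add_eq' hsum.symm]
    exact Submodule.sub_mem _ hv h1
  have h4 := Submodule.disjoint_def.1 (h𝒲 ρ) _ h3 h2
  have h5 := Fintype.linearIndependent_iff.1 b.linearIndependent _ h4 k
  rwa [if_neg hk] at h5

/-- Homogeneity of a linear map can be checked on a homogeneous basis. -/
theorem apply_mem_of_basis (h𝒲 : iSupIndep 𝒲) {κ : Type*} [Fintype κ] (b : Module.Basis κ ℂ W)
    {deg : κ → R} (hb : ∀ k, b k ∈ 𝒲 (deg k)) (T : W →ₗ[ℂ] W') (τ : R → R)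
    (hT : ∀ k, T (b k) ∈ 𝒲' (τ (deg k))) {ρ : R} {v : W} (hv : v ∈ 𝒲 ρ) : T v ∈ 𝒲' (τ ρ) := by
  rw [← b.sum_repr v, map_sum]
  refine Submodule.sum_mem _ fun k _ => ?_
  rw [map_smul]
  by_cases hk : deg k = ρ
  · exact Submodule.smul_mem _ _ (hk ▸ hT k)
  · rw [repr_eq_zero_of_deg_ne h𝒲 b hb hv hk, zero_smul]
    exact Submodule.zero_mem _

theorem iSupIndep_sumGrading (h𝒲 : iSupIndep 𝒲) (h𝒲' : iSupIndep 𝒲') :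
    iSupIndep (sumGrading 𝒲 𝒲') := by
  intro ρ
  rw [Submodule.disjoint_def]
  intro w hw hw'
  have h1 : w.1 ∈ ⨆ τ, ⨆ _ : τ ≠ ρ, 𝒲 τ := by
    have h2 : w.1 ∈ (⨆ τ, ⨆ _ : τ ≠ ρ, sumGrading 𝒲 𝒲' τ).map (LinearMap.fst ℂ W W') :=
      ⟨w, hw', rfl⟩
    simp only [Submodule.map_iSup] at h2
    refine (iSup₂_mono fun τ _ => ?_ : _ ≤ ⨆ τ, ⨆ _ : τ ≠ ρ, 𝒲 τ) h2
    rintro _ ⟨z, hz, rfl⟩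
    exact hz.1
  have h1' : w.2 ∈ ⨆ τ, ⨆ _ : τ ≠ ρ, 𝒲' τ := by
    have h2 : w.2 ∈ (⨆ τ, ⨆ _ : τ ≠ ρ, sumGrading 𝒲 𝒲' τ).map (LinearMap.snd ℂ W W') :=
      ⟨w, hw', rfl⟩
    simp only [Submodule.map_iSup] at h2
    refine (iSup₂_mono fun τ _ => ?_ : _ ≤ ⨆ τ, ⨆ _ : τ ≠ ρ, 𝒲' τ) h2
    rintro _ ⟨z, hz, rfl⟩
    exact hz.2
  exact Prod.ext (Submodule.disjoint_def.1 (h𝒲 ρ) _ hw.1 h1)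
    (Submodule.disjoint_def.1 (h𝒲' ρ) _ hw.2 h1')

end Homogeneous

section Jordan

theorem exists_equiv_of_multiseg_eq {R I J : Type*} [Fintype I] [Fintype J] {Δ : I → Seg R}
    {Δ₀ : J → Seg R} (h : multiseg Δ₀ = multiseg Δ) : ∃ φ : J ≃ I, Δ₀ = Δ ∘ φ := by
  classical
  have h1 : ∀ s, Nonempty ({j // Δ₀ j = s} ≃ {i // Δ i = s}) := by
    intro s
    have h2 := congrArg (Multiset.count s) h
    rw [multiseg, multiseg, Multiset.count_map, Multiset.count_map] at h2
    refine ⟨Fintype.equivOfCardEq ?_⟩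
    rw [Fintype.card_subtype, Fintype.card_subtype]
    simp only [Finset.card_def, Finset.filter_val]
    simpa only [eq_comm] using h2
  exact ⟨Equiv.ofFiberEquiv fun s => (h1 s).some,
    funext fun j => (Equiv.ofFiberEquiv_map (fun s => (h1 s).some) j).symm⟩

theorem multiseg_sumElim {R I I' : Type*} [Fintype I] [Fintype I'] (Δ : I → Seg R)
    (Δ' : I' → Seg R) : multiseg (Sum.elim Δ Δ') = multiseg Δ + multiseg Δ' := by
  rw [multiseg, ← Finset.univ_disjSum_univ, Finset.val_disjSum, Multiset.map_disjSum]
  rfl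

variable {R : Type*} {σ : Equiv.Perm R} {V : Type*} [AddCommGroup V] [Module ℂ V]
  {𝒱 : R → Submodule ℂ V} {I J : Type*} {Δ : I → Seg R} {A : Module.End ℂ V}
  {x : Module.Basis (Pts σ Δ) ℂ V}

theorem bvec_of_mem (x : Module.Basis (Pts σ Δ) ℂ V) {ρ : R} {i : I} (h : ρ ∈ (Δ i).elems σ) :
    bvec x ρ i = x ⟨(i, ρ), h⟩ := dif_pos h

theorem bvec_of_notMem (x : Module.Basis (Pts σ Δ) ℂ V) {ρ : R} {i : I} (h : ρ ∉ (Δ i).elems σ) :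
    bvec x ρ i = 0 := dif_neg h

theorem IsJordanBasis.mem (hx : IsJordanBasis σ 𝒱 Δ A x) (p : Pts σ Δ) : x p ∈ 𝒱 p.1.2 := by
  have := (hx p.1.1 p.1.2 p.2).1
  rwa [bvec_of_mem x p.2] at this

theorem IsJordanBasis.bvec_mem (hx : IsJordanBasis σ 𝒱 Δ A x) (ρ : R) (i : I) :
    bvec x ρ i ∈ 𝒱 ρ := by
  by_cases h : ρ ∈ (Δ i).elems σ
  · exact (hx i ρ h).1
  · rw [bvec_of_notMem x h]
    exact Submodule.zero_mem _

theorem IsJordanBasis.apply (hx : IsJordanBasis σ 𝒱 Δ A x) (p : Pts σ Δ) :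
    A (x p) = bvec x (σ p.1.2) p.1.1 := by
  rw [← (hx p.1.1 p.1.2 p.2).2, bvec_of_mem x p.2]

/-- The bijection between the index sets of the bases attached to a reindexing of a family of
segments. -/
def ptsEquiv (φ : J ≃ I) : Pts σ (Δ ∘ φ) ≃ Pts σ Δ where
  toFun p := ⟨(φ p.1.1, p.1.2), p.2⟩
  invFun p := ⟨(φ.symm p.1.1, p.1.2), by simpa using p.2⟩
  left_inv p := by simp
  right_inv p := by simp

theorem bvec_map_reindex (φ : J ≃ I) (g : V ≃ₗ[ℂ] V) (ρ : R) (j : J) :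
    bvec ((x.map g).reindex (ptsEquiv φ).symm) ρ j = g (bvec x ρ (φ j)) := by
  by_cases h : ρ ∈ (Δ (φ j)).elems σ
  · rw [bvec_of_mem x h, bvec_of_mem _ (show ρ ∈ ((Δ ∘ φ) j).elems σ from h)]
    simp [ptsEquiv]
  · rw [bvec_of_notMem x h, bvec_of_notMem _ (show ρ ∉ ((Δ ∘ φ) j).elems σ from h), map_zero]

theorem IsJordanBasis.conj (hx : IsJordanBasis σ 𝒱 Δ A x) (φ : J ≃ I) (g : V ≃ₗ[ℂ] V)
    (hg : ∀ ρ, ∀ v ∈ 𝒱 ρ, g v ∈ 𝒱 ρ) {A₀ : Module.End ℂ V} (hA : ∀ v, g (A v) = A₀ (g v)) :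
    IsJordanBasis σ 𝒱 (Δ ∘ φ) A₀ ((x.map g).reindex (ptsEquiv φ).symm) := by
  intro j ρ h
  simp only [bvec_map_reindex]
  obtain ⟨h1, h2⟩ := hx (φ j) ρ h
  exact ⟨hg _ _ h1, by rw [← hA, h2]⟩

variable [FiniteDimensional ℂ V]

theorem IsJordanBasis.mem_degUp (h𝒱 : iSupIndep 𝒱) (hx : IsJordanBasis σ 𝒱 Δ A x) :
    A ∈ degUp σ 𝒱 := by
  have := Module.Finite.finite_basis x
  have := Fintype.ofFinite (Pts σ Δ)
  intro ρ v hv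
  refine apply_mem_of_basis h𝒱 x (deg := fun p => p.1.2) hx.mem A σ (fun p => ?_) hv
  rw [hx.apply]
  exact hx.bvec_mem _ _

/-- The orbit attached to a multisegment is the conjugacy class of any of its elements. -/
theorem orbitOf_eq [Fintype I] (h𝒱 : iSupIndep 𝒱) (hx : IsJordanBasis σ 𝒱 Δ A x) :
    orbitOf σ 𝒱 (multiseg Δ) = conjTo (homAlg 𝒱 : Set (Module.End ℂ V)) A := by
  ext A₀
  constructor
  · rintro ⟨-, k, Δ₀, hΔ, x₀, hx₀⟩
    obtain ⟨φ, rfl⟩ := exists_equiv_of_multiseg_eq hΔ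
    have := Module.Finite.finite_basis x₀
    have := Fintype.ofFinite (Pts σ (Δ ∘ φ))
    have hgb : ∀ ρ i, x₀.equiv x (ptsEquiv φ) (bvec x₀ ρ i) = bvec x ρ (φ i) := by
      intro ρ i
      by_cases h : ρ ∈ (Δ (φ i)).elems σ
      · rw [bvec_of_mem x h, bvec_of_mem x₀ (show ρ ∈ ((Δ ∘ φ) i).elems σ from h),
          Module.Basis.equiv_apply]
        rfl
      · rw [bvec_of_notMem x h, bvec_of_notMem x₀ (show ρ ∉ ((Δ ∘ φ) i).elems σ from h), map_zero]
    refine ⟨(x₀.equiv x (ptsEquiv φ) : V →ₗ[ℂ] V), _, fun ρ v hv => ?_, coe_mul_symm _,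
      symm_mul_coe _, x₀.ext fun p => ?_⟩
    · refine apply_mem_of_basis h𝒱 x₀ (deg := fun p => p.1.2) hx₀.mem
        (x₀.equiv x (ptsEquiv φ) : V →ₗ[ℂ] V) id (fun p => ?_) hv
      rw [← bvec_of_mem x₀ p.2]
      exact (hgb _ _).symm ▸ hx.bvec_mem _ _
    · change x₀.equiv x (ptsEquiv φ) (A₀ (x₀ p)) = A (x₀.equiv x (ptsEquiv φ) (x₀ p))
      rw [hx₀.apply, hgb, Module.Basis.equiv_apply, hx.apply]
      rfl
  · rintro ⟨g, h, hg, hgh, hhg, hgA⟩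
    have hh := inv_mem_subalgebra (homAlg 𝒱) hg hhg
    obtain ⟨k, rfl, rfl⟩ := exists_linearEquiv hhg hgh
    have hk : ∀ v, k (A v) = A₀ (k v) := by
      intro v
      have h1 := LinearMap.congr_fun hgA (k v)
      have h2 : k.symm (A₀ (k v)) = A (k.symm (k v)) := h1
      rw [k.symm_apply_apply] at h2
      rw [← h2, k.apply_symm_apply]
    have hJ := hx.conj (Fintype.equivFin I).symm k hh hk
    refine ⟨hJ.mem_degUp h𝒱, Fintype.card I, _, ?_, _, hJ⟩
    rw [multiseg, multiseg, ← Multiset.map_map, Multiset.map_univ_val_equiv]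

theorem compOpen_eq [Fintype I] (h𝒱 : iSupIndep 𝒱) (hx : IsJordanBasis σ 𝒱 Δ A x) :
    compOpen σ 𝒱 (multiseg Δ) = orbitPairs (homAlg 𝒱) (downSub σ 𝒱) A := by
  ext ⟨A₀, B₀⟩
  constructor
  · rintro ⟨⟨-, hB, hAB⟩, hA⟩
    rw [orbitOf_eq h𝒱 hx] at hA
    obtain ⟨g, h, hg, hgh, hhg, hgA⟩ := hA
    dsimp only at hB hAB hgA
    have hh := inv_mem_subalgebra (homAlg 𝒱) hg hhg
    have hAh : A₀ * h = h * A := by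
      linear_combination (norm := noncomm_ring) -(hhg * A₀ * h) + h * hgA * h + h * A * hgh
    refine ⟨h, g, hh, hhg, hgh, (A, g * B₀ * h), ⟨rfl, mem_downSub_mul _ hh _
      (mul_mem_downSub _ hg _ hB), ?_⟩, Prod.ext ?_ ?_⟩
    · dsimp only
      linear_combination (norm := noncomm_ring) -(hgA * B₀ * h) + g * hAB * h + g * B₀ * hAh
    · dsimp only
      linear_combination (norm := noncomm_ring) hAh * g - A₀ * hhg
    · dsimp only
      linear_combination (norm := noncomm_ring) -(hhg * B₀ * h * g) - B₀ * hhg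
  · intro hp
    have h1 := commute_of_mem_zclosure_orbitPairs (subset_zclosure _ hp)
    have h2 := mem_of_mem_zclosure_orbitPairs mul_mem_downSub mem_downSub_mul (subset_zclosure _ hp)
    obtain ⟨g, h, hg, hgh, hhg, ⟨A', B⟩, ⟨hA, hB⟩, hT⟩ := hp
    obtain rfl : A' = A := hA
    have h3 : A₀ ∈ orbitOf σ 𝒱 (multiseg Δ) := by
      rw [orbitOf_eq h𝒱 hx]
      refine ⟨h, g, inv_mem_subalgebra _ hg hhg, hhg, hgh, ?_⟩
      rw [(Prod.mk.inj hT).1]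
      linear_combination (norm := noncomm_ring) hhg * A' * h
    exact ⟨⟨h3.1, h2, h1⟩, h3⟩

end Jordan

section DirectSum

variable {R : Type*} {σ : Equiv.Perm R} {V : Type*} [AddCommGroup V] [Module ℂ V]
  {V' : Type*} [AddCommGroup V'] [Module ℂ V'] {𝒱 : R → Submodule ℂ V} {𝒱' : R → Submodule ℂ V'}
  {I I' : Type*} {Δ : I → Seg R} {Δ' : I' → Seg R} {A : Module.End ℂ V} {A' : Module.End ℂ V'}
  {x : Module.Basis (Pts σ Δ) ℂ V} {x' : Module.Basis (Pts σ Δ') ℂ V'}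

/-- The index set of the basis attached to a sum of two families of segments. -/
def ptsSum : Pts σ Δ ⊕ Pts σ Δ' ≃ Pts σ (Sum.elim Δ Δ') where
  toFun := Sum.elim (fun p => ⟨(Sum.inl p.1.1, p.1.2), p.2⟩) fun p => ⟨(Sum.inr p.1.1, p.1.2), p.2⟩
  invFun p := match p with
    | ⟨(Sum.inl i, ρ), h⟩ => Sum.inl ⟨(i, ρ), h⟩
    | ⟨(Sum.inr i, ρ), h⟩ => Sum.inr ⟨(i, ρ), h⟩
  left_inv p := by rcases p with p | p <;> rfl
  right_inv p := by
    obtain ⟨⟨i | i, ρ⟩, h⟩ := p <;> rfl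

theorem bvec_sum_inl (ρ : R) (i : I) :
    bvec ((x.prod x').reindex ptsSum) ρ (Sum.inl i) = (bvec x ρ i, 0) := by
  by_cases h : ρ ∈ (Δ i).elems σ
  · rw [bvec_of_mem x h, bvec_of_mem _ (show ρ ∈ (Sum.elim Δ Δ' (Sum.inl i)).elems σ from h),
      Module.Basis.reindex_apply]
    exact Prod.ext (Module.Basis.prod_apply_inl_fst _ _ _) (Module.Basis.prod_apply_inl_snd _ _ _)
  · rw [bvec_of_notMem x h,
      bvec_of_notMem _ (show ρ ∉ (Sum.elim Δ Δ' (Sum.inl i)).elems σ from h)]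
    rfl

theorem bvec_sum_inr (ρ : R) (i : I') :
    bvec ((x.prod x').reindex ptsSum) ρ (Sum.inr i) = (0, bvec x' ρ i) := by
  by_cases h : ρ ∈ (Δ' i).elems σ
  · rw [bvec_of_mem x' h, bvec_of_mem _ (show ρ ∈ (Sum.elim Δ Δ' (Sum.inr i)).elems σ from h),
      Module.Basis.reindex_apply]
    exact Prod.ext (Module.Basis.prod_apply_inr_fst _ _ _) (Module.Basis.prod_apply_inr_snd _ _ _)
  · rw [bvec_of_notMem x' h,
      bvec_of_notMem _ (show ρ ∉ (Sum.elim Δ Δ' (Sum.inr i)).elems σ from h)]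
    rfl

theorem IsJordanBasis.prod (hx : IsJordanBasis σ 𝒱 Δ A x) (hx' : IsJordanBasis σ 𝒱' Δ' A' x') :
    IsJordanBasis σ (sumGrading 𝒱 𝒱') (Sum.elim Δ Δ') (A.prodMap A')
      ((x.prod x').reindex ptsSum) := by
  rintro (i | i) ρ h
  · obtain ⟨h1, h2⟩ := hx i ρ h
    simp only [bvec_sum_inl]
    exact ⟨⟨h1, Submodule.zero_mem _⟩, Prod.ext h2 (map_zero A')⟩
  · obtain ⟨h1, h2⟩ := hx' i ρ h
    simp only [bvec_sum_inr]
    exact ⟨⟨Submodule.zero_mem _, h1⟩, Prod.ext (map_zero A) h2⟩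

variable [FiniteDimensional ℂ V] [FiniteDimensional ℂ V'] [Fintype I] [Fintype I']

theorem irrComp_eq (h𝒱 : iSupIndep 𝒱) (h𝒱' : iSupIndep 𝒱') (hx : IsJordanBasis σ 𝒱 Δ A x)
    (hx' : IsJordanBasis σ 𝒱' Δ' A' x') :
    irrComp σ (sumGrading 𝒱 𝒱') (multiseg Δ + multiseg Δ') =
      zclosure (orbitPairs (homAlg (sumGrading 𝒱 𝒱')) (downSub σ (sumGrading 𝒱 𝒱'))
        (A.prodMap A')) := by
  rw [irrComp, ← multiseg_sumElim, compOpen_eq (iSupIndep_sumGrading h𝒱 h𝒱') (hx.prod hx')]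

/-- For a commuting pair which is block triangular, the conditions on the diagonal blocks defining
`yVar` and `yVar'` only concern the first component. -/
theorem blocks_mem_compOpen_iff (h𝒱 : iSupIndep 𝒱) (h𝒱' : iSupIndep 𝒱')
    (hx : IsJordanBasis σ 𝒱 Δ A x) (hx' : IsJordanBasis σ 𝒱' Δ' A' x')
    {p : Module.End ℂ (V × V') × Module.End ℂ (V × V')}
    (hp : p ∈ zclosure (orbitPairs (homAlg (sumGrading 𝒱 𝒱')) (downSub σ (sumGrading 𝒱 𝒱'))
        (A.prodMap A')))
    (hc : (blockFst p.1).prodMap (blockSnd p.1) * (blockFst p.2).prodMap (blockSnd p.2) =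
      (blockFst p.2).prodMap (blockSnd p.2) * (blockFst p.1).prodMap (blockSnd p.1)) :
    ((blockFst p.1, blockFst p.2) ∈ compOpen σ 𝒱 (multiseg Δ) ∧
      (blockSnd p.1, blockSnd p.2) ∈ compOpen σ 𝒱' (multiseg Δ')) ↔
    ∃ l k, l ∈ homAlg (sumGrading 𝒱 𝒱') ∧ l * k = 1 ∧ k * l = 1 ∧
      proj V V' * l = l * proj V V' ∧
      l * (blockFst p.1).prodMap (blockSnd p.1) = A.prodMap A' * l := by
  rw [exists_levi_conj_iff, ← orbitOf_eq h𝒱 hx, ← orbitOf_eq h𝒱' hx']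
  have hB : p.2 ∈ degDown σ (sumGrading 𝒱 𝒱') :=
    mem_of_mem_zclosure_orbitPairs mul_mem_downSub mem_downSub_mul hp
  obtain ⟨hc1, hc2⟩ := prodMap_injective (A := blockFst p.1 * blockFst p.2)
    (A' := blockSnd p.1 * blockSnd p.2) (B := blockFst p.2 * blockFst p.1)
    (B' := blockSnd p.2 * blockSnd p.1) hc
  exact ⟨fun h => ⟨h.1.2, h.2.2⟩, fun h => ⟨⟨⟨h.1.1, blockFst_mem_degDown hB, hc1⟩, h.1⟩,
    ⟨⟨h.2.1, blockSnd_mem_degDown hB, hc2⟩, h.2⟩⟩⟩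

theorem yVar_eq (h𝒱 : iSupIndep 𝒱) (h𝒱' : iSupIndep 𝒱') (hx : IsJordanBasis σ 𝒱 Δ A x)
    (hx' : IsJordanBasis σ 𝒱' Δ' A' x') :
    yVar σ 𝒱 𝒱' (multiseg Δ) (multiseg Δ') =
      zclosure (triangPairs (homAlg (sumGrading 𝒱 𝒱')) (downSub σ (sumGrading 𝒱 𝒱'))
        (A.prodMap A') (proj V V')) := by
  rw [yVar, irrComp_eq h𝒱 h𝒱' hx hx']
  congr 1
  ext p
  simp only [triangPairs, Set.mem_ofPred_eq, mem_presFst_iff, levi_eq_prodMap]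
  refine and_congr_right fun hp => and_congr_right fun h1 => and_congr_right fun h2 => ?_
  refine blocks_mem_compOpen_iff h𝒱 h𝒱' hx hx' hp ?_
  simp only [← levi_eq_prodMap]
  rw [levi_mul isIdempotentElem_proj h1 h2, levi_mul isIdempotentElem_proj h2 h1,
    commute_of_mem_zclosure_orbitPairs hp]

theorem yVar'_eq (h𝒱 : iSupIndep 𝒱) (h𝒱' : iSupIndep 𝒱') (hx : IsJordanBasis σ 𝒱 Δ A x)
    (hx' : IsJordanBasis σ 𝒱' Δ' A' x') :
    yVar' σ 𝒱 𝒱' (multiseg Δ) (multiseg Δ') =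
      zclosure (triangPairs (homAlg (sumGrading 𝒱 𝒱')) (downSub σ (sumGrading 𝒱 𝒱'))
        (A.prodMap A') (1 - proj V V')) := by
  rw [yVar', irrComp_eq h𝒱 h𝒱' hx hx']
  congr 1
  ext p
  have hlevi : ∀ T : Module.End ℂ (V × V'), (1 - proj V V') * T * (1 - proj V V') +
      (1 - (1 - proj V V')) * T * (1 - (1 - proj V V')) =
      (blockFst T).prodMap (blockSnd T) := fun T => by
    rw [← levi_eq_prodMap, sub_sub_cancel, add_comm]
  simp only [triangPairs, Set.mem_ofPred_eq, mem_presSnd_iff, hlevi, lower_iff_upper_one_sub,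
    commute_one_sub_iff]
  refine and_congr_right fun hp => and_congr_right fun h1 => and_congr_right fun h2 => ?_
  rw [and_comm]
  refine blocks_mem_compOpen_iff h𝒱 h𝒱' hx hx' hp ?_
  simp only [← hlevi]
  rw [levi_mul isIdempotentElem_proj.one_sub h1 h2, levi_mul isIdempotentElem_proj.one_sub h2 h1,
    commute_of_mem_zclosure_orbitPairs hp]

end DirectSum

/-! ### Maps commuting with graded Jordan forms, in coordinates -/

section Segments

variable {R : Type*} {σ : Equiv.Perm R}

theorem Seg.b_mem (Δ : Seg R) : Δ.b ∈ Δ.elems σ := ⟨0, Δ.len_pos, rfl⟩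

theorem Seg.apply_e (Δ : Seg R) : σ (Δ.e σ) = (σ ^ Δ.len) Δ.b := by
  rw [Seg.e, ← Equiv.Perm.mul_apply, ← pow_succ', Nat.sub_add_cancel Δ.len_pos]

theorem Seg.mem_of_apply_mem {Δ : Seg R} {ρ : R} (h : σ ρ ∈ Δ.elems σ) (hb : σ ρ ≠ Δ.b) :
    ρ ∈ Δ.elems σ := by
  obtain ⟨m, hm, hρ⟩ := h
  rcases m with - | m
  · exact absurd hρ hb
  · rw [pow_succ', Equiv.Perm.mul_apply] at hρ
    exact ⟨m, by omega, σ.injective hρ⟩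

theorem Seg.pow_ne_b (hσ : ∀ k : ℕ, 0 < k → ∀ ρ : R, (σ ^ k) ρ ≠ ρ)
    {Δ : Seg R} {ρ : R} (h : ρ ∈ Δ.elems σ) (l : ℕ) : (σ ^ (l + 1)) ρ ≠ Δ.b := by
  obtain ⟨m, -, rfl⟩ := h
  rw [← Equiv.Perm.mul_apply, ← pow_add]
  exact hσ _ (by omega) _

theorem Seg.pow_len_notMem (hσ : ∀ k : ℕ, 0 < k → ∀ ρ : R, (σ ^ k) ρ ≠ ρ)
    (Δ : Seg R) : (σ ^ Δ.len) Δ.b ∉ Δ.elems σ := by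
  rintro ⟨m, hm, h⟩
  refine hσ (Δ.len - m) (by omega) ((σ ^ m) Δ.b) ?_
  rw [← Equiv.Perm.mul_apply, ← pow_add, Nat.sub_add_cancel hm.le, h]

/-- As `σ` has no finite orbits, the first condition in the definition of `Δ ≺ Δ'` is redundant. -/
theorem Seg.prec_iff (hσ : ∀ k : ℕ, 0 < k → ∀ ρ : R, (σ ^ k) ρ ≠ ρ)
    (Δ Δ' : Seg R) :
    Δ.Prec σ Δ' ↔ σ⁻¹ Δ'.b ∈ Δ.elems σ ∧ Δ'.e σ ∉ Δ.elems σ := by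
  have h1 : Δ'.b ∈ (Δ.rshift σ).elems σ ↔ σ⁻¹ Δ'.b ∈ Δ.elems σ := by
    refine exists_congr fun m => and_congr_right fun _ => ?_
    rw [Equiv.Perm.inv_eq_iff_eq, ← Equiv.Perm.mul_apply, ← pow_succ', pow_succ,
      Equiv.Perm.mul_apply]
    rfl
  rw [Seg.Prec, h1]
  refine ⟨fun h => h.2, fun h => ⟨?_, h⟩⟩
  rintro ⟨m, -, hm⟩
  refine Seg.pow_ne_b hσ h.1 m ?_
  rw [pow_succ, Equiv.Perm.mul_apply, show σ (σ⁻¹ Δ'.b) = Δ'.b from σ.apply_symm_apply _, hm]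

end Segments

section Coefficients

variable {R : Type*} {σ : Equiv.Perm R} {V : Type*} [AddCommGroup V] [Module ℂ V]
  {V' : Type*} [AddCommGroup V'] [Module ℂ V'] {𝒱 : R → Submodule ℂ V} {𝒱' : R → Submodule ℂ V'}
  {I I' : Type*} {Δ : I → Seg R} {Δ' : I' → Seg R} {A : Module.End ℂ V} {A' : Module.End ℂ V'}
  {x : Module.Basis (Pts σ Δ) ℂ V} {x' : Module.Basis (Pts σ Δ') ℂ V'} {τ : R → R}

/-- The linear maps `V' → V` which map `V'_ρ` to `V_{τ ρ}` and intertwine `A'` and `A`. -/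
def gradedHom (τ : R → R) (𝒱' : R → Submodule ℂ V') (𝒱 : R → Submodule ℂ V) (A' : Module.End ℂ V')
    (A : Module.End ℂ V) : Submodule ℂ (V' →ₗ[ℂ] V) where
  carrier := {u | (∀ ρ, ∀ v ∈ 𝒱' ρ, u v ∈ 𝒱 (τ ρ)) ∧ A ∘ₗ u = u ∘ₗ A'}
  add_mem' := fun ha hb => ⟨fun ρ v hv => Submodule.add_mem _ (ha.1 ρ v hv) (hb.1 ρ v hv), by
    rw [LinearMap.comp_add, LinearMap.add_comp, ha.2, hb.2]⟩
  zero_mem' := ⟨fun _ _ _ => Submodule.zero_mem _, by simp⟩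
  smul_mem' := fun r _ ha => ⟨fun ρ v hv => Submodule.smul_mem _ r (ha.1 ρ v hv), by
    rw [LinearMap.comp_smul, LinearMap.smul_comp, ha.2]⟩

/-- The pairs `(i, j)` for which `x'_{ρ,j} ↦ x_{τ ρ,i}` defines an intertwining map. -/
def CoeffSupp (σ : Equiv.Perm R) (τ : R → R) (Δ : I → Seg R) (Δ' : I' → Seg R) (i : I) (j : I') :
    Prop := τ (Δ' j).b ∈ (Δ i).elems σ ∧ σ (τ ((Δ' j).e σ)) ∉ (Δ i).elems σ

/-- The numbers `c i j` are the coefficients of `u`: one has `u x'_{ρ,j} = ∑ i, c i j x_{τ ρ,i}`,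
and `c i j = 0` unless `(i, j)` is in the set `CoeffSupp`. -/
def HasCoeff [Fintype I] (τ : R → R) (x' : Module.Basis (Pts σ Δ') ℂ V')
    (x : Module.Basis (Pts σ Δ) ℂ V) (u : V' →ₗ[ℂ] V) (c : I → I' → ℂ) : Prop :=
  (∀ i j, ¬ CoeffSupp σ τ Δ Δ' i j → c i j = 0) ∧
  ∀ j, ∀ ρ ∈ (Δ' j).elems σ, u (bvec x' ρ j) = ∑ i, c i j • bvec x (τ ρ) i

open Classical in
theorem repr_bvec (x : Module.Basis (Pts σ Δ) ℂ V) (ρ : R) (i : I) (p : Pts σ Δ) :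
    x.repr (bvec x ρ i) p = if p.1 = (i, ρ) then 1 else 0 := by
  by_cases h : ρ ∈ (Δ i).elems σ
  · rw [bvec_of_mem x h, Module.Basis.repr_self, Finsupp.single_apply]
    refine if_congr ?_ rfl rfl
    rw [Subtype.ext_iff, eq_comm]
  · rw [bvec_of_notMem x h, if_neg, map_zero, Finsupp.zero_apply]
    intro hp
    have := p.2
    rw [hp] at this
    exact h this

open Classical in
theorem repr_sum_bvec [Fintype I] (x : Module.Basis (Pts σ Δ) ℂ V) (ρ : R) (d : I → ℂ)
    (p : Pts σ Δ) :
    x.repr (∑ i, d i • bvec x ρ i) p = if p.1.2 = ρ then d p.1.1 else 0 := by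
  simp only [map_sum, map_smul, Finsupp.coe_finsetSum, Finset.sum_apply, Finsupp.smul_apply,
      repr_bvec,
    smul_eq_mul, mul_ite, mul_one, mul_zero, Prod.ext_iff]
  split_ifs with h
  · simp [h]
  · simp [h]

/-- The formula `A x_{ρ,i} = x_{σ ρ,i}` fails when `ρ ∉ Δ i` and `σ ρ` is the beginning of `Δ i`;
this does not occur along the orbit of an element of `Δ i`, as `σ` has no finite orbits. -/
theorem apply_pow_bvec (hσ : ∀ k : ℕ, 0 < k → ∀ ρ : R, (σ ^ k) ρ ≠ ρ)
    (hx : IsJordanBasis σ 𝒱 Δ A x) {ρ : R} {i : I} (h : ρ ∈ (Δ i).elems σ) (l : ℕ) :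
    (A ^ l) (bvec x ρ i) = bvec x ((σ ^ l) ρ) i := by
  induction l with
  | zero => rfl
  | succ l ih =>
    rw [pow_succ', Module.End.mul_apply, ih, pow_succ', Equiv.Perm.mul_apply]
    by_cases h1 : (σ ^ l) ρ ∈ (Δ i).elems σ
    · exact (hx i _ h1).2
    · rw [bvec_of_notMem x h1, map_zero, bvec_of_notMem]
      intro h2
      refine h1 (Seg.mem_of_apply_mem h2 ?_)
      rw [← Equiv.Perm.mul_apply, ← pow_succ']
      exact Seg.pow_ne_b hσ h l

theorem HasCoeff.repr [Fintype I] {u : V' →ₗ[ℂ] V} {c : I → I' → ℂ} (hc : HasCoeff τ x' x u c) {i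
    : I}
    {j : I'} (h : τ (Δ' j).b ∈ (Δ i).elems σ) :
    x.repr (u (bvec x' (Δ' j).b j)) ⟨(i, τ (Δ' j).b), h⟩ = c i j := by
  rw [hc.2 j _ (Δ' j).b_mem, repr_sum_bvec, if_pos rfl]

theorem pow_comm_apply (hτ : ∀ ρ, τ (σ ρ) = σ (τ ρ)) (l : ℕ) (ρ : R) :
    τ ((σ ^ l) ρ) = (σ ^ l) (τ ρ) := by
  induction l with
  | zero => rfl
  | succ l ih => rw [pow_succ', Equiv.Perm.mul_apply, Equiv.Perm.mul_apply, hτ, ih]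

/-- An intertwining map is determined by the images of the generators `x'_{ρ,j}`, `ρ = b(Δ' j)`,
of the Jordan blocks, and these have to be killed by the power of `A` whose exponent is the length
of the block. -/
theorem exists_hasCoeff [FiniteDimensional ℂ V] [Fintype I]
    (hσ : ∀ k : ℕ, 0 < k → ∀ ρ : R, (σ ^ k) ρ ≠ ρ) (hτ : ∀ ρ, τ (σ ρ) = σ (τ ρ))
    (h𝒱 : iSupIndep 𝒱) (hx : IsJordanBasis σ 𝒱 Δ A x) (hx' : IsJordanBasis σ 𝒱' Δ' A' x')
    {u : V' →ₗ[ℂ] V} (hu : u ∈ gradedHom τ 𝒱' 𝒱 A' A) : ∃ c, HasCoeff τ x' x u c := by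
  classical
  have := Module.Finite.finite_basis x
  have := Fintype.ofFinite (Pts σ Δ)
  -- the coefficients can be read off from the images of the `x'_{ρ,j}`, where `ρ` is the
  -- beginning of `Δ' j`
  let d : I → I' → ℂ := fun i j => if h : τ (Δ' j).b ∈ (Δ i).elems σ then
    x.repr (u (bvec x' (Δ' j).b j)) ⟨(i, τ (Δ' j).b), h⟩ else 0
  have hd0 : ∀ j, u (bvec x' (Δ' j).b j) = ∑ i, d i j • bvec x (τ (Δ' j).b) i := by
    intro j
    refine x.ext_elem ?_
    rintro ⟨⟨i, ρ⟩, hp⟩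
    rw [repr_sum_bvec]
    split_ifs with h
    · dsimp only at h hp
      subst h
      simp only [d, dif_pos hp]
    · exact repr_eq_zero_of_deg_ne h𝒱 x (deg := fun p => p.1.2) hx.mem
        (hu.1 _ _ (hx'.bvec_mem _ _)) h
  have hpow : ∀ l v, u ((A' ^ l) v) = (A ^ l) (u v) := by
    intro l
    induction l with
    | zero => exact fun v => rfl
    | succ l ih =>
      intro v
      rw [pow_succ', pow_succ', Module.End.mul_apply, Module.End.mul_apply, ← ih]
      exact (LinearMap.congr_fun hu.2 _).symm
  have hdl : ∀ j l, u (bvec x' ((σ ^ l) (Δ' j).b) j) =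
      ∑ i, d i j • bvec x ((σ ^ l) (τ (Δ' j).b)) i := by
    intro j l
    rw [← apply_pow_bvec hσ hx' (Δ' j).b_mem, hpow, hd0, map_sum]
    refine Finset.sum_congr rfl fun i _ => ?_
    rw [map_smul]
    by_cases h : τ (Δ' j).b ∈ (Δ i).elems σ
    · rw [apply_pow_bvec hσ hx h]
    · simp only [d, dif_neg h, zero_smul]
  refine ⟨d, fun i j hij => ?_, ?_⟩
  · by_cases h : τ (Δ' j).b ∈ (Δ i).elems σ
    · have h1 : (σ ^ (Δ' j).len) (τ (Δ' j).b) ∈ (Δ i).elems σ := by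
        by_contra h2
        refine hij ⟨h, ?_⟩
        rwa [← hτ, Seg.apply_e, pow_comm_apply hτ]
      have h2 := hdl j (Δ' j).len
      rw [bvec_of_notMem x' (Seg.pow_len_notMem hσ _), map_zero] at h2
      have h3 := repr_sum_bvec x ((σ ^ (Δ' j).len) (τ (Δ' j).b)) (fun i => d i j) ⟨(i, _), h1⟩
      rw [← h2, map_zero, if_pos rfl] at h3
      exact h3.symm
    · exact dif_neg h
  · rintro j _ ⟨l, -, rfl⟩
    rw [hdl, pow_comm_apply hτ]

/-- The conditions in `CoeffSupp` ensure that the map with given coefficients intertwines `A'` and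
`A`. -/
theorem HasCoeff.mem_gradedHom [FiniteDimensional ℂ V'] [Fintype I]
    (hσ : ∀ k : ℕ, 0 < k → ∀ ρ : R, (σ ^ k) ρ ≠ ρ) (hτ : ∀ ρ, τ (σ ρ) = σ (τ ρ))
    (h𝒱' : iSupIndep 𝒱') (hx : IsJordanBasis σ 𝒱 Δ A x) (hx' : IsJordanBasis σ 𝒱' Δ' A' x')
    {u : V' →ₗ[ℂ] V} {c : I → I' → ℂ} (hc : HasCoeff τ x' x u c) : u ∈ gradedHom τ 𝒱' 𝒱 A' A := by
  have := Module.Finite.finite_basis x'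
  have := Fintype.ofFinite (Pts σ Δ')
  have hu : ∀ p : Pts σ Δ', u (x' p) = ∑ i, c i p.1.1 • bvec x (τ p.1.2) i := fun p => by
    rw [← bvec_of_mem x' p.2, hc.2 _ _ p.2]
  refine ⟨fun ρ v hv => apply_mem_of_basis h𝒱' x' (deg := fun p => p.1.2) hx'.mem u τ (fun p => ?_)
    hv, x'.ext fun p => ?_⟩
  · rw [hu]
    exact Submodule.sum_mem _ fun i _ => Submodule.smul_mem _ _ (hx.bvec_mem _ _)
  · rw [LinearMap.comp_apply, LinearMap.comp_apply, hu, hx'.apply, map_sum]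
    obtain ⟨⟨j, ρ⟩, hρ⟩ := p
    obtain ⟨l, hl, hl'⟩ := id hρ
    dsimp only at hl hl' ⊢
    subst hl'
    have h1 : ∀ i, A (c i j • bvec x (τ ((σ ^ l) (Δ' j).b)) i) =
        c i j • bvec x ((σ ^ (l + 1)) (τ (Δ' j).b)) i := by
      intro i
      by_cases hij : CoeffSupp σ τ Δ Δ' i j
      · rw [map_smul, pow_comm_apply hτ, ← apply_pow_bvec hσ hx hij.1, ← apply_pow_bvec hσ hx hij.1,
          pow_succ', Module.End.mul_apply]
      · rw [hc.1 i j hij, zero_smul, zero_smul, map_zero]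
    rw [Finset.sum_congr rfl fun i _ => h1 i, ← Equiv.Perm.mul_apply, ← pow_succ']
    by_cases h : l + 1 < (Δ' j).len
    · rw [hc.2 j _ ⟨l + 1, h, rfl⟩, pow_comm_apply hτ]
    -- at the end of the Jordan block both sides vanish
    · obtain h : l + 1 = (Δ' j).len := by omega
      rw [h, bvec_of_notMem x' (Seg.pow_len_notMem hσ _), map_zero]
      refine Finset.sum_eq_zero fun i _ => ?_
      by_cases hij : CoeffSupp σ τ Δ Δ' i j
      · have h2 := hij.2
        rw [← hτ, Seg.apply_e, pow_comm_apply hτ] at h2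
        rw [bvec_of_notMem x h2, smul_zero]
      · rw [hc.1 i j hij, zero_smul]

theorem exists_of_coeff [Fintype I] (x' : Module.Basis (Pts σ Δ') ℂ V')
    (x : Module.Basis (Pts σ Δ) ℂ V) {c : I → I' → ℂ}
    (hc : ∀ i j, ¬ CoeffSupp σ τ Δ Δ' i j → c i j = 0) : ∃ u, HasCoeff τ x' x u c := by
  refine ⟨x'.constr ℂ fun p => ∑ i, c i p.1.1 • bvec x (τ p.1.2) i, hc, fun j ρ h => ?_⟩
  rw [bvec_of_mem x' h, Module.Basis.constr_basis]

theorem HasCoeff.ext [Fintype I] {u₁ u₂ : V' →ₗ[ℂ] V} {c₁ c₂ : I → I' → ℂ}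
    (h₁ : HasCoeff τ x' x u₁ c₁) (h₂ : HasCoeff τ x' x u₂ c₂)
    (h : ∀ i j, CoeffSupp σ τ Δ Δ' i j → c₁ i j = c₂ i j) : u₁ = u₂ := by
  have hc : ∀ i j, c₁ i j = c₂ i j := fun i j => by
    by_cases hij : CoeffSupp σ τ Δ Δ' i j
    · exact h i j hij
    · rw [h₁.1 i j hij, h₂.1 i j hij]
  refine x'.ext fun p => ?_
  rw [← bvec_of_mem x' p.2, h₁.2 _ _ p.2, h₂.2 _ _ p.2]
  simp only [hc]

end Coefficients

/-! ### The linear condition in coordinates -/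

section Coordinates

variable {R : Type*} {σ : Equiv.Perm R} {V : Type*} [AddCommGroup V] [Module ℂ V]
  {V' : Type*} [AddCommGroup V'] [Module ℂ V'] {𝒱 : R → Submodule ℂ V} {𝒱' : R → Submodule ℂ V'}
  {I I' : Type*} {Δ : I → Seg R} {Δ' : I' → Seg R} {A : Module.End ℂ V} {A' : Module.End ℂ V'}
  {x : Module.Basis (Pts σ Δ) ℂ V} {x' : Module.Basis (Pts σ Δ') ℂ V'}

/-- The condition `SurjComm` for a direct sum, in terms of the blocks. -/
theorem surjComm_iff :
    SurjComm (centAlg (homAlg (sumGrading 𝒱 𝒱')) (A.prodMap A'))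
      (centSub (downSub σ (sumGrading 𝒱 𝒱')) (A.prodMap A')) (proj V V') ↔
    ∃ l ∈ centDown σ 𝒱 A, ∃ l' ∈ centDown σ 𝒱' A', ∀ T ∈ gradedHom (⇑σ⁻¹) 𝒱' 𝒱 A' A,
      ∃ u ∈ gradedHom id 𝒱' 𝒱 A' A, u ∘ₗ l' - l ∘ₗ u = T := by
  have key : ∀ (l : Module.End ℂ V) (l' : Module.End ℂ V') (u : V' →ₗ[ℂ] V),
      (LinearMap.inl ℂ V V' ∘ₗ u ∘ₗ LinearMap.snd ℂ V V') * l.prodMap l' -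
        l.prodMap l' * (LinearMap.inl ℂ V V' ∘ₗ u ∘ₗ LinearMap.snd ℂ V V') =
      LinearMap.inl ℂ V V' ∘ₗ (u ∘ₗ l' - l ∘ₗ u) ∘ₗ LinearMap.snd ℂ V V' := by
    intro l l' u
    refine LinearMap.ext fun w => Prod.ext ?_ ?_
    · rfl
    · change 0 - l' 0 = 0
      rw [map_zero, sub_zero]
  have hoff : ∀ T : Module.End ℂ (V × V'), proj V V' * T * (1 - proj V V') =
      LinearMap.inl ℂ V V' ∘ₗ (LinearMap.fst ℂ V V' ∘ₗ T ∘ₗ LinearMap.inr ℂ V V') ∘ₗ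
        LinearMap.snd ℂ V V' := by
    intro T
    refine LinearMap.ext fun w => ?_
    rw [Module.End.mul_apply, one_sub_proj_apply]
    rfl
  have hinj : ∀ u v : V' →ₗ[ℂ] V, LinearMap.inl ℂ V V' ∘ₗ u ∘ₗ LinearMap.snd ℂ V V' =
      LinearMap.inl ℂ V V' ∘ₗ v ∘ₗ LinearMap.snd ℂ V V' → u = v := by
    intro u v h
    exact LinearMap.ext fun w => congrArg Prod.fst (LinearMap.congr_fun h (0, w))
  constructor
  · rintro ⟨d, hd, h⟩
    obtain ⟨⟨hd1, hd2⟩, hd3, hd4⟩ := mem_lower_inf_upper.1 hd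
    have hdl := eq_prodMap_of_commute hd4
    have h1 := blockFst_mem_degDown hd1
    have h2 := blockSnd_mem_degDown hd1
    generalize blockFst d = l at hdl h1
    generalize blockSnd d = l' at hdl h2
    subst hdl
    obtain ⟨h3, h4⟩ := prodMap_injective (A := A * l) (A' := A' * l') (B := l * A) (B' := l' * A')
        hd2
    refine ⟨l, ⟨h1, h3⟩, l', ⟨h2, h4⟩, fun T hT => ?_⟩
    obtain ⟨u, hu, huT⟩ := h (LinearMap.inl ℂ V V' ∘ₗ T ∘ₗ LinearMap.snd ℂ V V') ⟨fun ρ w hw =>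
      ⟨hT.1 ρ _ hw.2, Submodule.zero_mem _⟩, by
        refine LinearMap.ext fun w => Prod.ext ?_ (map_zero A')
        exact LinearMap.congr_fun hT.2 w.2⟩
    obtain ⟨hu1, hu2⟩ := mem_centAlg.1 hu.1
    have hu3 : u = LinearMap.inl ℂ V V' ∘ₗ (LinearMap.fst ℂ V V' ∘ₗ u ∘ₗ LinearMap.inr ℂ V V') ∘ₗ
        LinearMap.snd ℂ V V' := by
      rw [← hoff, hu.2.1, mul_sub, mul_one, hu.2.2, sub_zero]
    refine ⟨LinearMap.fst ℂ V V' ∘ₗ u ∘ₗ LinearMap.inr ℂ V V', ⟨fun ρ v hv =>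
      (hu1 ρ (0, v) ⟨Submodule.zero_mem _, hv⟩).1, ?_⟩, ?_⟩
    · refine LinearMap.ext fun v => ?_
      have h5 := congrArg Prod.fst (LinearMap.congr_fun hu2 (0, v))
      have h6 : A (u (0, v)).1 = (u (A 0, A' v)).1 := h5
      rw [map_zero] at h6
      exact h6
    · refine hinj _ _ ?_
      rw [← key, ← hu3, huT, hoff]
      rfl
  · rintro ⟨l, ⟨hl1, hl2⟩, l', ⟨hl1', hl2'⟩, h⟩
    refine ⟨l.prodMap l', mem_lower_inf_upper.2 ⟨⟨fun ρ w hw => ⟨hl1 ρ _ hw.1, hl1' ρ _ hw.2⟩, ?_⟩,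
      ?_, proj_mul_prodMap _ _⟩, fun T hT => ?_⟩
    · rw [prodMap_mul_prodMap, prodMap_mul_prodMap, hl2, hl2']
    · rw [proj_mul_prodMap, mul_assoc, isIdempotentElem_proj.eq]
    · obtain ⟨u, hu, huT⟩ := h (LinearMap.fst ℂ V V' ∘ₗ T ∘ₗ LinearMap.inr ℂ V V') ⟨fun ρ v hv =>
        (hT.1 ρ (0, v) ⟨Submodule.zero_mem _, hv⟩).1, by
          refine LinearMap.ext fun v => ?_
          have h5 := congrArg Prod.fst (LinearMap.congr_fun hT.2 (0, v))
          have h6 : A (T (0, v)).1 = (T (A 0, A' v)).1 := h5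
          rw [map_zero] at h6
          exact h6⟩
      refine ⟨LinearMap.inl ℂ V V' ∘ₗ u ∘ₗ LinearMap.snd ℂ V V', ⟨mem_centAlg.2 ⟨fun ρ w hw =>
        ⟨hu.1 ρ _ hw.2, Submodule.zero_mem _⟩, ?_⟩, rfl, ?_⟩, ?_⟩
      · refine LinearMap.ext fun w => Prod.ext ?_ (map_zero A')
        exact LinearMap.congr_fun hu.2 w.2
      · refine LinearMap.ext fun w => Prod.ext (map_zero u) rfl
      · rw [key, huT, hoff]

/-- Maps of degree minus one have their coefficients in `X`. -/
theorem coeffSupp_inv_iff (hσ : ∀ k : ℕ, 0 < k → ∀ ρ : R, (σ ^ k) ρ ≠ ρ) (i : I) (j : I') :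
    CoeffSupp σ (⇑σ⁻¹) Δ Δ' i j ↔ (Δ i).Prec σ (Δ' j) := by
  rw [Seg.prec_iff hσ, CoeffSupp, show σ (σ⁻¹ ((Δ' j).e σ)) = (Δ' j).e σ from σ.apply_symm_apply _]

/-- Maps of degree zero have their coefficients in `Y`. -/
theorem coeffSupp_id_iff (hσ : ∀ k : ℕ, 0 < k → ∀ ρ : R, (σ ^ k) ρ ≠ ρ) (i : I) (j : I') :
    CoeffSupp σ id Δ Δ' i j ↔ (Δ i).Prec σ ((Δ' j).rshift σ) := by
  have h1 : σ⁻¹ ((Δ' j).rshift σ).b = (Δ' j).b := σ.symm_apply_apply _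
  have h2 : ((Δ' j).rshift σ).e σ = σ ((Δ' j).e σ) := by
    rw [Seg.apply_e, Seg.e]
    change (σ ^ ((Δ' j).len - 1)) (σ (Δ' j).b) = _
    rw [← Equiv.Perm.mul_apply, ← pow_succ, Nat.sub_add_cancel (Δ' j).len_pos]
  rw [Seg.prec_iff hσ, h1, h2]
  rfl

open Classical in
/-- Extension by zero of a family of coefficients. -/
noncomputable def extendCoeff {P : I → I' → Prop} (c : {p : I × I' // P p.1 p.2} → ℂ) (i : I) (j :
    I') : ℂ :=
  if h : P i j then c ⟨(i, j), h⟩ else 0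

theorem extendCoeff_of_not {P : I → I' → Prop} (c : {p : I × I' // P p.1 p.2} → ℂ) {i : I} {j : I'}
    (h : ¬ P i j) : extendCoeff c i j = 0 := dif_neg h

theorem extendCoeff_apply {P : I → I' → Prop} (c : {p : I × I' // P p.1 p.2} → ℂ)
    (p : {p : I × I' // P p.1 p.2}) : extendCoeff c p.1.1 p.1.2 = c p := dif_pos p.2

theorem extendCoeff_restrict {P : I → I' → Prop} {c : I → I' → ℂ} (h : ∀ i j, ¬ P i j → c i j = 0) :
    extendCoeff (P := P) (fun p => c p.1.1 p.1.2) = c := by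
  funext i j
  by_cases hij : P i j
  · exact dif_pos hij
  · rw [extendCoeff_of_not _ hij, h i j hij]

theorem isCoord_iff [Fintype I] (hσ : ∀ k : ℕ, 0 < k → ∀ ρ : R, (σ ^ k) ρ ≠ ρ)
    (l : Module.End ℂ V) (c : XSet σ Δ Δ → ℂ) :
    IsCoord x l c ↔ HasCoeff (⇑σ⁻¹) x x l
      (extendCoeff (P := fun i j => (Δ i).Prec σ (Δ j)) c) := by
  classical
  have h1 : ∀ j ρ i, (if h : (Δ i).Prec σ (Δ j) then c ⟨(i, j), h⟩ • bvec x (σ⁻¹ ρ) i else 0) =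
      extendCoeff (P := fun i j => (Δ i).Prec σ (Δ j)) c i j • bvec x (σ⁻¹ ρ) i := by
    intro j ρ i
    rw [extendCoeff]
    split_ifs
    · rfl
    · rw [zero_smul]
  have h2 : ∀ i j, ¬ CoeffSupp σ (⇑σ⁻¹) Δ Δ i j →
      extendCoeff (P := fun i j => (Δ i).Prec σ (Δ j)) c i j = 0 := fun i j hij =>
    extendCoeff_of_not _ (by rwa [coeffSupp_inv_iff hσ] at hij)
  constructor
  · intro h
    exact ⟨h2, fun j ρ hρ => (h j ρ hρ).trans (Finset.sum_congr rfl fun i _ => by convert h1 j ρ i)⟩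
  · intro h j ρ hρ
    exact (h.2 j ρ hρ).trans (Finset.sum_congr rfl fun i _ => by convert (h1 j ρ i).symm)

variable [Fintype I] [Fintype I']

/-- The vectors `v_{i,j}` are the rows of the matrix of `u ↦ λ u - u λ'`. -/
theorem sum_vvec_mul [Fintype (YSet σ Δ Δ')] (c : XSet σ Δ Δ → ℂ) (c' : XSet σ Δ' Δ' → ℂ)
    (w : YSet σ Δ Δ' → ℂ) (i : I) (j : I') :
    ∑ y, vvec σ Δ Δ' c c' i j y * w y =
      ∑ r, extendCoeff (P := fun i j => (Δ i).Prec σ (Δ j)) c i r *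
        extendCoeff (P := fun i j => (Δ i).Prec σ ((Δ' j).rshift σ)) w r j -
      ∑ s, extendCoeff (P := fun i j => (Δ i).Prec σ ((Δ' j).rshift σ)) w i s *
        extendCoeff (P := fun i j => (Δ' i).Prec σ (Δ' j)) c' s j := by
  classical
  change vvec σ Δ Δ' c c' i j ⬝ᵥ w = _
  rw [vvec, sub_dotProduct, sum_dotProduct, sum_dotProduct]
  congr 1
  · refine Finset.sum_congr rfl fun r _ => ?_
    by_cases h1 : (Δ i).Prec σ (Δ r)
    · by_cases h2 : (Δ r).Prec σ ((Δ' j).rshift σ)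
      · rw [dif_pos ⟨h1, h2⟩, smul_dotProduct, single_dotProduct, one_mul, smul_eq_mul, extendCoeff,
          extendCoeff, dif_pos h1, dif_pos h2]
      · rw [dif_neg (fun h => h2 h.2), zero_dotProduct, extendCoeff_of_not (P := fun i j => (Δ
          i).Prec σ ((Δ' j).rshift σ))
          w h2, mul_zero]
    · rw [dif_neg (fun h => h1 h.1), zero_dotProduct, extendCoeff_of_not
        (P := fun i j => (Δ i).Prec σ (Δ j)) c h1, zero_mul]
  · refine Finset.sum_congr rfl fun s _ => ?_
    by_cases h1 : (Δ' s).Prec σ (Δ' j)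
    · by_cases h2 : (Δ i).Prec σ ((Δ' s).rshift σ)
      · rw [dif_pos ⟨h1, h2⟩, smul_dotProduct, single_dotProduct, one_mul, smul_eq_mul, extendCoeff,
          extendCoeff, dif_pos h1, dif_pos h2, mul_comm]
      · rw [dif_neg (fun h => h2 h.2), zero_dotProduct, extendCoeff_of_not (P := fun i j => (Δ
          i).Prec σ ((Δ' j).rshift σ))
          w h2, zero_mul]
    · rw [dif_neg (fun h => h1 h.1), zero_dotProduct, extendCoeff_of_not
        (P := fun i j => (Δ' i).Prec σ (Δ' j)) c' h1, mul_zero]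

/-- The coefficients of `λ u - u λ'`. -/
theorem repr_comm {l : Module.End ℂ V} {l' : Module.End ℂ V'} {u : V' →ₗ[ℂ] V} {c : I → I → ℂ}
    {c' : I' → I' → ℂ} {w : I → I' → ℂ} (hl : HasCoeff (⇑σ⁻¹) x x l c)
    (hl' : HasCoeff (⇑σ⁻¹) x' x' l' c') (hu : HasCoeff id x' x u w) {i : I} {j : I'}
    (h : σ⁻¹ (Δ' j).b ∈ (Δ i).elems σ) :
    x.repr ((l ∘ₗ u - u ∘ₗ l') (bvec x' (Δ' j).b j)) ⟨(i, σ⁻¹ (Δ' j).b), h⟩ =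
      ∑ r, c i r * w r j - ∑ s, w i s * c' s j := by
  have h1 : l (u (bvec x' (Δ' j).b j)) = ∑ i, (∑ r, c i r * w r j) • bvec x (σ⁻¹ (Δ' j).b) i := by
    rw [hu.2 j _ (Δ' j).b_mem, map_sum]
    simp only [Finset.sum_smul]
    rw [Finset.sum_comm]
    refine Finset.sum_congr rfl fun r _ => ?_
    by_cases hr : CoeffSupp σ id Δ Δ' r j
    · rw [map_smul, hl.2 r (id (Δ' j).b) hr.1, Finset.smul_sum]
      refine Finset.sum_congr rfl fun i _ => ?_
      rw [smul_smul, mul_comm]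
      rfl
    · simp [hu.1 r j hr]
  have h2 : u (l' (bvec x' (Δ' j).b j)) = ∑ i, (∑ s, w i s * c' s j) • bvec x (σ⁻¹ (Δ' j).b) i := by
    rw [hl'.2 j _ (Δ' j).b_mem, map_sum]
    simp only [Finset.sum_smul]
    rw [Finset.sum_comm]
    refine Finset.sum_congr rfl fun s _ => ?_
    by_cases hs : CoeffSupp σ (⇑σ⁻¹) Δ' Δ' s j
    · rw [map_smul, hu.2 s _ hs.1, Finset.smul_sum]
      refine Finset.sum_congr rfl fun i _ => ?_
      rw [smul_smul, mul_comm]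
      rfl
    · simp [hl'.1 s j hs]
  rw [LinearMap.sub_apply, LinearMap.comp_apply, LinearMap.comp_apply, map_sub, Finsupp.sub_apply,
      h1,
    h2, repr_sum_bvec, repr_sum_bvec, if_pos rfl, if_pos rfl]

variable [FiniteDimensional ℂ V] [FiniteDimensional ℂ V']

/-- Linear independence of the vectors `v_{i,j}` is the surjectivity of `u ↦ u λ' - λ u`. -/
theorem linearIndependent_vvec_iff (hσ : ∀ k : ℕ, 0 < k → ∀ ρ : R, (σ ^ k) ρ ≠ ρ)
    (h𝒱 : iSupIndep 𝒱) (h𝒱' : iSupIndep 𝒱') (hx : IsJordanBasis σ 𝒱 Δ A x)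
    (hx' : IsJordanBasis σ 𝒱' Δ' A' x') {l : Module.End ℂ V} {l' : Module.End ℂ V'}
    (hl : l ∈ centDown σ 𝒱 A) (hl' : l' ∈ centDown σ 𝒱' A') {c : XSet σ Δ Δ → ℂ}
    {c' : XSet σ Δ' Δ' → ℂ} (hc : IsCoord x l c) (hc' : IsCoord x' l' c') :
    (LinearIndependent ℂ fun p : XSet σ Δ Δ' => vvec σ Δ Δ' c c' p.1.1 p.1.2) ↔
      ∀ T ∈ gradedHom (⇑σ⁻¹) 𝒱' 𝒱 A' A, ∃ u ∈ gradedHom id 𝒱' 𝒱 A' A, u ∘ₗ l' - l ∘ₗ u = T := by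
  have hτ : ∀ ρ, σ⁻¹ (σ ρ) = σ (σ⁻¹ ρ) := fun ρ =>
    (σ.symm_apply_apply ρ).trans (σ.apply_symm_apply ρ).symm
  have := Fintype.ofFinite (YSet σ Δ Δ')
  rw [linearIndependent_rows_iff_surjective]
  rw [isCoord_iff hσ] at hc hc'
  simp only [sum_vvec_mul]
  have hsub : ∀ u ∈ gradedHom id 𝒱' 𝒱 A' A, u ∘ₗ l' - l ∘ₗ u ∈ gradedHom (⇑σ⁻¹) 𝒱' 𝒱 A' A := by
    rintro u ⟨hu1, hu2⟩
    refine Submodule.sub_mem _ ⟨fun ρ v hv => hu1 _ _ (hl'.1 ρ v hv), ?_⟩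
      ⟨fun ρ v hv => hl.1 _ _ (hu1 ρ v hv), ?_⟩
    · rw [← LinearMap.comp_assoc, hu2, LinearMap.comp_assoc, LinearMap.comp_assoc]
      exact congrArg (u ∘ₗ ·) hl'.2
    · rw [LinearMap.comp_assoc, ← hu2, ← LinearMap.comp_assoc, ← LinearMap.comp_assoc]
      exact congrArg (· ∘ₗ u) hl.2
  constructor
  · intro h T hT
    obtain ⟨t, ht⟩ := exists_hasCoeff hσ hτ h𝒱 hx hx' hT
    obtain ⟨w, hw⟩ := h fun p => -t p.1.1 p.1.2
    obtain ⟨u, hu⟩ := exists_of_coeff (τ := id) x' x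
      (c := extendCoeff (P := fun i j => (Δ i).Prec σ ((Δ' j).rshift σ)) w) fun i j hij =>
      extendCoeff_of_not (P := fun i j => (Δ i).Prec σ ((Δ' j).rshift σ)) w
        (by rwa [coeffSupp_id_iff hσ] at hij)
    have hu1 := hu.mem_gradedHom (τ := id) hσ (fun _ => rfl) h𝒱' hx hx'
    refine ⟨u, hu1, ?_⟩
    obtain ⟨t', ht'⟩ := exists_hasCoeff hσ hτ h𝒱 hx hx' (hsub u hu1)
    refine ht'.ext ht fun i j hij => ?_
    have h1 := repr_comm hc hc' hu hij.1
    rw [hw ⟨(i, j), (coeffSupp_inv_iff hσ i j).1 hij⟩, ← neg_sub, LinearMap.neg_apply, map_neg,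
      Finsupp.neg_apply, ht'.repr hij.1, neg_inj] at h1
    exact h1
  · intro h b
    obtain ⟨T, hT⟩ := exists_of_coeff (τ := ⇑σ⁻¹) x' x
      (c := extendCoeff (P := fun i j => (Δ i).Prec σ (Δ' j)) b) fun i j hij =>
      extendCoeff_of_not (P := fun i j => (Δ i).Prec σ (Δ' j)) b
        (by rwa [coeffSupp_inv_iff hσ] at hij)
    obtain ⟨u, hu, huT⟩ := h (-T) (Submodule.neg_mem _ (hT.mem_gradedHom hσ hτ h𝒱' hx hx'))
    obtain ⟨w, hw⟩ := exists_hasCoeff (τ := id) hσ (fun _ => rfl) h𝒱 hx hx' hu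
    refine ⟨fun y => w y.1.1 y.1.2, fun p => ?_⟩
    have hp := ((coeffSupp_inv_iff hσ p.1.1 p.1.2).2 p.2).1
    have h1 := repr_comm hc hc' hw hp
    rw [← neg_sub, huT, neg_neg, hT.repr hp, extendCoeff_apply] at h1
    rw [extendCoeff_restrict fun i j hij => hw.1 i j (by rwa [coeffSupp_id_iff hσ]), h1]

theorem exists_linearIndependent_vvec_iff (hσ : ∀ k : ℕ, 0 < k → ∀ ρ : R, (σ ^ k) ρ ≠ ρ)
    (h𝒱 : iSupIndep 𝒱) (h𝒱' : iSupIndep 𝒱') (hx : IsJordanBasis σ 𝒱 Δ A x)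
    (hx' : IsJordanBasis σ 𝒱' Δ' A' x') :
    (∃ l ∈ centDown σ 𝒱 A, ∃ l' ∈ centDown σ 𝒱' A', ∃ (c : XSet σ Δ Δ → ℂ) (c' : XSet σ Δ' Δ' → ℂ),
      IsCoord x l c ∧ IsCoord x' l' c' ∧
      LinearIndependent ℂ fun p : XSet σ Δ Δ' => vvec σ Δ Δ' c c' p.1.1 p.1.2) ↔
    SurjComm (centAlg (homAlg (sumGrading 𝒱 𝒱')) (A.prodMap A'))
      (centSub (downSub σ (sumGrading 𝒱 𝒱')) (A.prodMap A')) (proj V V') := by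
  have hτ : ∀ ρ, σ⁻¹ (σ ρ) = σ (σ⁻¹ ρ) := fun ρ =>
    (σ.symm_apply_apply ρ).trans (σ.apply_symm_apply ρ).symm
  rw [surjComm_iff]
  constructor
  · rintro ⟨l, hl, l', hl', c, c', hc, hc', h⟩
    exact ⟨l, hl, l', hl', (linearIndependent_vvec_iff hσ h𝒱 h𝒱' hx hx' hl hl' hc hc').1 h⟩
  · rintro ⟨l, hl, l', hl', h⟩
    obtain ⟨c, hc⟩ := exists_hasCoeff (τ := ⇑σ⁻¹) hσ hτ h𝒱 hx hx (u := l) hl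
    obtain ⟨c', hc'⟩ := exists_hasCoeff (τ := ⇑σ⁻¹) hσ hτ h𝒱' hx' hx' (u := l') hl'
    have h1 : IsCoord x l fun p : XSet σ Δ Δ => c p.1.1 p.1.2 := by
      rw [isCoord_iff hσ, extendCoeff_restrict fun i j hij => hc.1 i j (by
        rwa [coeffSupp_inv_iff hσ])]
      exact hc
    have h1' : IsCoord x' l' fun p : XSet σ Δ' Δ' => c' p.1.1 p.1.2 := by
      rw [isCoord_iff hσ, extendCoeff_restrict fun i j hij => hc'.1 i j (by
        rwa [coeffSupp_inv_iff hσ])]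
      exact hc'
    exact ⟨l, hl, l', hl', _, _, h1, h1',
      (linearIndependent_vvec_iff hσ h𝒱 h𝒱' hx hx' hl hl' h1 h1').2 h⟩

end Coordinates

end MultisegGeom

open MultisegGeom in
theorem proposition5p3 {F : Type*} [Field F] [ValuativeRel F] [TopologicalSpace F]
    [IsNonarchimedeanLocalField F] [DecidableEq (IrrC F)]
    {V : Type*} [AddCommGroup V] [Module ℂ V] [FiniteDimensional ℂ V]
    {V' : Type*} [AddCommGroup V'] [Module ℂ V'] [FiniteDimensional ℂ V']
    (𝒱 : IrrC F → Submodule ℂ V) (h𝒱 : DirectSum.IsInternal 𝒱)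
    (𝒱' : IrrC F → Submodule ℂ V') (h𝒱' : DirectSum.IsInternal 𝒱')
    {I : Type*} [Fintype I] (Δ : I → Seg (IrrC F))
    {I' : Type*} [Fintype I'] (Δ' : I' → Seg (IrrC F))
    (A : Module.End ℂ V) (A' : Module.End ℂ V')
    (x : Module.Basis (Pts (IrrC.shift F) Δ) ℂ V) (hx : IsJordanBasis (IrrC.shift F) 𝒱 Δ A x)
    (x' : Module.Basis (Pts (IrrC.shift F) Δ') ℂ V')
    (hx' : IsJordanBasis (IrrC.shift F) 𝒱' Δ' A' x') :
    zclosure (orb (gN 𝒱 𝒱' A A') (cSnd (IrrC.shift F) 𝒱 𝒱' A A')) =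
      zclosure (orb (uN 𝒱 𝒱' A A') (cSnd (IrrC.shift F) 𝒱 𝒱' A A')) ∧
    orb (pN 𝒱 𝒱' A A') (cBoth (IrrC.shift F) 𝒱 𝒱' A A') =
      orb (uN 𝒱 𝒱' A A') (cBoth (IrrC.shift F) 𝒱 𝒱' A A') ∧
    List.TFAE [
      DenseIn (orb (gN 𝒱 𝒱' A A') (cSnd (IrrC.shift F) 𝒱 𝒱' A A'))
        (cN (IrrC.shift F) 𝒱 𝒱' A A'),
      DenseIn (orb (uN 𝒱 𝒱' A A') (cSnd (IrrC.shift F) 𝒱 𝒱' A A'))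
        (cN (IrrC.shift F) 𝒱 𝒱' A A'),
      DenseIn (orb (pN 𝒱 𝒱' A A') (cBoth (IrrC.shift F) 𝒱 𝒱' A A'))
        (cFst (IrrC.shift F) 𝒱 𝒱' A A'),
      DenseIn (orb (uN 𝒱 𝒱' A A') (cBoth (IrrC.shift F) 𝒱 𝒱' A A'))
        (cFst (IrrC.shift F) 𝒱 𝒱' A A'),
      ∃ l ∈ centDown (IrrC.shift F) 𝒱 A, ∃ l' ∈ centDown (IrrC.shift F) 𝒱' A',
        ∃ (c : XSet (IrrC.shift F) Δ Δ → ℂ) (c' : XSet (IrrC.shift F) Δ' Δ' → ℂ),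
          IsCoord x l c ∧ IsCoord x' l' c' ∧
          LinearIndependent ℂ fun p : XSet (IrrC.shift F) Δ Δ' =>
            vvec (IrrC.shift F) Δ Δ' c c' p.1.1 p.1.2,
      LC (IrrC.shift F) 𝒱 𝒱' (multiseg Δ) (multiseg Δ'),
      LCparab (IrrC.shift F) 𝒱 𝒱' (multiseg Δ) (multiseg Δ')] := by
  have hi := h𝒱.submodule_iSupIndep
  have hi' := h𝒱'.submodule_iSupIndep
  have he := isIdempotentElem_proj (V := V) (V' := V')
  have heH : proj V V' ∈ homAlg (sumGrading 𝒱 𝒱') := proj_mem_homAlg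
  have heN : proj V V' * A.prodMap A' = A.prodMap A' * proj V V' := proj_mul_prodMap A A'
  have hgN := orb_eq_conjSet fun g => mem_stab_iff (𝒲 := sumGrading 𝒱 𝒱') (A.prodMap A') g
  rw [LC, LCparab, zVar, irrComp_eq hi hi' hx hx', yVar_eq hi hi' hx hx', yVar'_eq hi hi' hx hx',
    orbPair_eq_conjPair (Y := (homAlg (sumGrading 𝒱 𝒱') : Set _)) mem_gradedAut_iff,
    orbPair_eq_conjPair mem_parab_iff, denseIn_conjPair_iff mul_mem_downSub mem_downSub_mul he heH
        heN,
    denseIn_conjPair_triang_iff mul_mem_downSub mem_downSub_mul he heH heN,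
    exists_linearIndependent_vvec_iff IrrC.shift_pow_ne hi hi' hx hx',
    gN, hgN, orb_eq_conjSet (mem_uN_iff A A'), orb_eq_conjSet (mem_uN_iff A A'),
    orb_eq_conjSet (mem_pN_iff A A'), cBoth_eq, cFst_eq, cSnd_eq]
  have hcN : cN (IrrC.shift F) 𝒱 𝒱' A A' =
      (centSub (downSub (IrrC.shift F) (sumGrading 𝒱 𝒱')) (A.prodMap A') : Set _) := rfl
  rw [hcN]
  set M := centAlg (homAlg (sumGrading 𝒱 𝒱')) (A.prodMap A')
  set C := centSub (downSub (IrrC.shift F) (sumGrading 𝒱 𝒱')) (A.prodMap A')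
  have heM : proj V V' ∈ M := mem_centAlg.2 ⟨heH, heN.symm⟩
  have hl : ∀ m ∈ M, ∀ y ∈ C, m * y ∈ C := fun m hm y hy => mul_mem_centSub mul_mem_downSub hm hy
  have hr : ∀ m ∈ M, ∀ y ∈ C, y * m ∈ C := fun m hm y hy => mem_centSub_mul mem_downSub_mul hm hy
  have h1 := zclosure_conjSet_lowerSub he heM hl hr
  have h2 := conjSet_triang_lower_inf_upper he heM hl hr
  have h3 := subset_zclosure_lowerSub_iff he heM hl hr
  have h4 := upperSub_subset_zclosure_iff he heM hl hr
  have hsub : conjSet (M : Set _) (lowerSub C (proj V V') : Set _) ⊆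
      (C : Set (Module.End ℂ (V × V'))) := by
    rintro _ ⟨g, k, hg, -, hkg, d, hd, rfl⟩
    exact hr _ (inv_mem_subalgebra M hg hkg) _ (hl _ hg _ hd.1)
  have hsub' : conjSet (unipSet M (proj V V'))
      (lowerSub C (proj V V') ⊓ upperSub C (proj V V') : Submodule ℂ _) ⊆
      (upperSub C (proj V V') : Set (Module.End ℂ (V × V'))) := by
    rw [← h2]
    rintro _ ⟨g, k, hg, -, hkg, d, hd, rfl⟩
    obtain ⟨hgM, hge⟩ := (mem_triang_one_sub he).1 hg
    obtain ⟨hkM, hke⟩ := (mem_triang_one_sub he).1 (inv_mem_subalgebra _ hg hkg)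
    exact ⟨hr _ hkM _ (hl _ hgM _ hd.1.1), upper_mul (upper_mul hge hd.2.2) hke⟩
  refine ⟨h1, h2, ?_⟩
  rw [h2, h1, h3, h4]
  -- every condition amounts to the surjectivity condition `SurjComm M C (proj V V')`
  tfae_have 1 ↔ 5 := by
    rw [DenseIn, h1, h3]
    exact and_iff_right hsub
  tfae_have 2 ↔ 5 := by
    rw [DenseIn, h3]
    exact and_iff_right ((conjSet_mono (unipSet_subset M _) subset_rfl).trans hsub)
  tfae_have 3 ↔ 5 := by
    rw [DenseIn, h4]
    exact and_iff_right hsub'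
  tfae_have 4 ↔ 5 := by
    rw [DenseIn, h4]
    exact and_iff_right hsub'
  tfae_have 6 ↔ 5 := Iff.rfl
  tfae_have 7 ↔ 5 := Iff.rfl
  tfae_finish
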